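/- **Setting.** Let $G=\prod_{i=1}^D \mathbb Z/L_i\mathbb Z$ be the $D$-dimensional hypercubic lattice with periodic boundary conditions, with one qubit per site and $n=|G|$ sites; $\mathrm{dist}(a,b)$ is the graph ($\ell_1$) distance on it, and $\mathrm{dist}(A,B)=\min_{a\in A,b\in B}\mathrm{dist}(a,b)$. A state $\rho$ has correlation length at most $\xi>0$ (exponential clustering property) if $|\langle O_AO_B\rangle-\langle O_A\rangle\langle O_B\rangle|\le\|O_A\|\,\|O_B\|\,e^{-\mathrm{dist}(A,B)/\xi}$ for all observables $O_A,O_B$ acting on subsystems $A,B\subseteq G$, where $\langle X\rangle=\mathrm{tr}(X\rho)$ and $\|\cdot\|$ is the spectral norm. An $m$-body, degree-$p$ polynomial is $g(\rho)=\sum_i c_i\prod_{j=1}^p\mathrm{tr}(P_{ij}\rho)$ (a finite sum) with $c_i\in\mathbb R$ and Pauli strings $P_{ij}$ of weight at most $m$; $\|g\|_1=\sum_i|c_i|$. *Local-cover number.* For $\delta>0$, split each $P_{ij}$ into its parts on the clusters of $\mathrm{supp}(P_{ij})$, i.e. on the connected components of the graph on $\mathrm{supp}(P_{ij})$ that joins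 two sites at distance at most $\delta$ (an identity string has one, empty, cluster), and let $\mathcal P_i$ be the multiset of all the resulting strings for the term $i$. For an integer $\zeta\ge1$ let $\mathcal A(\zeta)$ be the set of all boxes $\{b\in G: a_j\le b_j<a_j+\zeta\ \forall j\}$ (read cyclically), $a\in G$. Let $a_i$ be the least number of parts in a partition of $\mathcal P_i$ such that, for each part, all its strings are supported in one common box of $\mathcal A(\zeta)$; then $\mathrm{LCN}(g;\delta,\zeta)=\max_i a_i$. *Classical shadows.* A classical shadow $S$ of size $T$ of $\rho$ is the record of $T$ independent rounds of measurement of $\rho$, in each of which every qubit is measured along an independent uniformly random axis $W\in\{X,Y,Z\}$, with outcome $o=\pm1$; put $\sigma_i^{(t)}=\tfrac12(3o_i^{(t)}W_i^{(t)}+I)$. For a probability distribution $\mathcal D$ on states, $\mathcal D_S$ is the distribution of $(S,g(\rho))$, where $\rho\sim\mathcal D$ and $S$ is a classical shadow of size $T$ of $\rho$. *Kernel.* For $\tau,\gamma>0$ the truncated shadow kernel on $A$ and the polynomial GLQK are $$k_A(S,\tilde S)=\exp\Big[\frac{\tau}{T^2}\sum_{t,t'=1}^T\prod_{i\in A}\Big(1+\frac{\gamma}{|A|}\mathrm{tr}\big(\sigma_i^{(t)}\tilde\sigma_i^{(t')}\big)\Big)\Big],\qquad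 k(S,\tilde S)=\Big[\frac1{|\mathcal A(\zeta)|}\sum_{A\in\mathcal A(\zeta)}k_A(S,\tilde S)\Big]^h .$$ *Kernel ridge regression.* Given data $Z=\{(S_i,y_i)\}_{i=1}^N$, with $K=(k(S_i,S_j))_{ij}$, let $\alpha^*_Z\in\mathbb R^N$ minimize $$\frac1N\sum_{i=1}^N\tfrac12\big(y_i-(K\alpha)_i\big)^2+\lambda\,\alpha^{\mathsf T}K\alpha\quad\text{subject to}\quad\alpha^{\mathsf T}K\alpha\le B^2 ,$$ and put $h_Z(S)=\sum_j(\alpha^*_Z)_j\,k(S_j,S)$. The expected loss is $L(h_Z)=\mathbb E_{(S,y)\sim\mathcal D_S}\big[\tfrac12(y-h_Z(S))^2\big]$. **Theorem.** Let $g$ be an $m$-body, degree-$p$ polynomial and let $\mathcal D$ be a probability distribution on states such that $\mathcal D$-almost every state has correlation length at most $\xi$. Let $\epsilon\in(0,\|g\|_1)$, $\delta=\xi\log(2\|g\|_1mp/\epsilon)$, $\zeta=\lceil m\delta\rceil$ and $\alpha_g=\mathrm{LCN}(g;\delta,\zeta)$, and assume $2\zeta^D/\gamma\ge1$ and $mp/\tau\ge1$.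 Suppose that $$N\ge\frac{600}{\epsilon^4}\|g\|_1^4\exp\big(\alpha_g\tau e^{5\gamma}\big)\Big(\frac{2mp\,\zeta^D}{\tau\gamma}\Big)^{mp}n^{\alpha_g},\qquad T\ge\frac{256}{3\epsilon^2}\|g\|_1^2\,12^m(mp)^2\log\Big[\frac{\|g\|_1^2\,2^{m+5}mp\,(3^{m^2p}+1)^2}{\epsilon^2}\Big].$$ Then, with $B^2=\|g\|_1^2\big(2mp\,\zeta^D/(\tau\gamma)\big)^{mp}n^{\alpha_g}$ and $\lambda=\epsilon^2/(6B^2)$, kernel ridge regression with the polynomial GLQK with $h=\alpha_g$ and width $\zeta$ is well defined (a minimizer $\alpha_Z^*$ exists for every data set $Z$) and, for every choice of the minimizers, $$\mathbb E_{Z\sim\mathcal D_S^N}\big[L(h_Z)\big]\le\epsilon^2 .$$ -/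

import Mathlib

open MeasureTheory
open scoped BigOperators ENNReal ComplexOrder

noncomputable section

namespace GLQK

/-! ### The lattice -/

/-- The `D`-dimensional hypercubic lattice with periodic boundary conditions and side lengths
`L 0, …, L (D - 1)`. -/
abbrev Lattice {D : ℕ} (L : Fin D → ℕ) : Type := (i : Fin D) → ZMod (L i)

section Geometry

variable {D : ℕ} {L : Fin D → ℕ}

/-- Graph distance on the periodic lattice: the sum over the coordinates of the cyclic
distances `|a i - b i|`. -/
def latticeDist (a b : Lattice L) : ℕ := ∑ i, (a i - b i).valMinAbs.natAbs

theorem latticeDist_comm (a b : Lattice L) : latticeDist a b = latticeDist b a := by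
  unfold latticeDist
  refine Finset.sum_congr rfl fun i _ => ?_
  rw [← neg_sub (b i) (a i), ZMod.natAbs_valMinAbs_neg]

/-- The distance of two sets of lattice points, the minimum of the distances of their points
(`0` if one of the sets is empty). -/
def setDist (A B : Finset (Lattice L)) : ℕ :=
  sInf {d | ∃ a ∈ A, ∃ b ∈ B, d = latticeDist a b}

/-- The box of width `ζ` with corner `a`: the points `b` with `a j ≤ b j < a j + ζ` for all `j`,
read cyclically. -/
def box [∀ i, NeZero (L i)] (ζ : ℕ) (a : Lattice L) : Finset (Lattice L) :=
  Finset.univ.filter fun b => ∀ j, (b j - a j).val < ζ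

open Classical in
/-- The set of all local subsystems (boxes) of width `ζ`. -/
def localSubsystems [∀ i, NeZero (L i)] (ζ : ℕ) : Finset (Finset (Lattice L)) :=
  Finset.univ.image fun a : Lattice L => box ζ a

/-- The graph on the points of `S` in which two points are joined if and only if their distance
is at most `δ` (points outside `S` are isolated). -/
def clusterGraph (δ : ℝ) (S : Finset (Lattice L)) : SimpleGraph (Lattice L) where
  Adj x y := x ≠ y ∧ x ∈ S ∧ y ∈ S ∧ (latticeDist x y : ℝ) ≤ δ
  symm := ⟨fun x y h => ⟨h.1.symm, h.2.2.1, h.2.1, latticeDist_comm x y ▸ h.2.2.2⟩⟩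
  loopless := ⟨fun _ h => h.1 rfl⟩

open Classical in
/-- The clusters of `S` at scale `δ`: the connected components of the cluster graph. The empty
set counts as one (empty) cluster, so that there is always at least one. -/
def clusters (δ : ℝ) (S : Finset (Lattice L)) : Finset (Finset (Lattice L)) :=
  if S = ∅ then {∅}
  else S.image fun a => S.filter fun b => (clusterGraph δ S).Reachable a b

end Geometry

/-! ### Qubits, Pauli strings and states -/

/-- The matrices `I, X, Y, Z`, numbered `0, 1, 2, 3`. -/
def pauli : Fin 4 → Matrix (Fin 2) (Fin 2) ℂ :=
  ![1, !![0, 1; 1, 0], !![0, -Complex.I; Complex.I, 0], !![1, 0; 0, -1]]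

section Quantum

variable {G : Type} [Fintype G] [DecidableEq G]

/-- Operators on the Hilbert space of one qubit per element of `G`. -/
abbrev Operator (G : Type) : Type := Matrix (G → Fin 2) (G → Fin 2) ℂ

/-- The tensor product of single-qubit operators. -/
def tensor (M : G → Matrix (Fin 2) (Fin 2) ℂ) : Operator G :=
  Matrix.of fun s t => ∏ i, M i (s i) (t i)

/-- A Pauli string chooses one of `I, X, Y, Z` for every qubit. -/
abbrev PauliString (G : Type) : Type := G → Fin 4

/-- The operator of a Pauli string. -/
def PauliString.op (P : PauliString G) : Operator G := tensor fun i => pauli (P i)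

/-- The set of qubits on which a Pauli string acts nontrivially. -/
def PauliString.supp (P : PauliString G) : Finset G := Finset.univ.filter fun i => P i ≠ 0

/-- The part of a Pauli string that acts on `C`. -/
def PauliString.restrict (P : PauliString G) (C : Finset G) : PauliString G :=
  fun i => if i ∈ C then P i else 0

/-- Quantum states (density matrices), with the measurable structure of the matrix entries. -/
def QState (G : Type) [Fintype G] [DecidableEq G] : Type :=
  {ρ : (G → Fin 2) → (G → Fin 2) → ℂ //
    (Matrix.of ρ).PosSemidef ∧ (Matrix.of ρ).trace = 1}

instance : MeasurableSpace (QState G) := Subtype.instMeasurableSpace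

/-- The density matrix of a state. -/
def QState.mat (ρ : QState G) : Operator G := Matrix.of ρ.1

/-- The expectation value `tr (O ρ)`. -/
def QState.expect (ρ : QState G) (O : Operator G) : ℂ := (O * ρ.mat).trace

/-- The operator `O` acts on the subsystem `A` only: it is `M ⊗ I` with `M` acting on the qubits
of `A`. -/
def ActsOn (O : Operator G) (A : Finset G) : Prop :=
  ∃ M : Operator A,
    (∀ s t : G → Fin 2, (∀ i, i ∉ A → s i = t i) → O s t = M (fun i => s i) (fun i => t i)) ∧
    ∀ s t : G → Fin 2, (¬ ∀ i, i ∉ A → s i = t i) → O s t = 0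

/-- The spectral norm, as the operator norm on the Hilbert space. -/
def specNorm (O : Operator G) : ℝ := ‖Matrix.toEuclideanCLM (𝕜 := ℂ) O‖

end Quantum

/-- The exponential clustering property with correlation length (at most) `ξ`. -/
def HasECP {D : ℕ} {L : Fin D → ℕ} [∀ i, NeZero (L i)] (ξ : ℝ) (ρ : QState (Lattice L)) : Prop :=
  ∀ (A B : Finset (Lattice L)) (OA OB : Operator (Lattice L)),
    OA.IsHermitian → OB.IsHermitian → ActsOn OA A → ActsOn OB B →
    ‖ρ.expect (OA * OB) - ρ.expect OA * ρ.expect OB‖ ≤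
      specNorm OA * specNorm OB * Real.exp (-(setDist A B : ℝ) / ξ)

/-! ### Pauli polynomials, cluster approximation, local-cover number -/

/-- A degree-`p` polynomial `∑ i, c i * ∏ j, tr (P i j * ρ)` in the state `ρ`, given by its
coefficients and Pauli strings. -/
structure PauliPoly (G : Type) (p : ℕ) where
  /-- the number of terms -/
  numTerms : ℕ
  /-- the coefficients -/
  coeff : Fin numTerms → ℝ
  /-- the Pauli strings -/
  strings : Fin numTerms → Fin p → PauliString G

namespace PauliPoly

section General

variable {G : Type} [Fintype G] [DecidableEq G] {p : ℕ}

/-- The value of the polynomial at a state. -/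
def eval (g : PauliPoly G p) (ρ : QState G) : ℝ :=
  ∑ i, g.coeff i * ∏ j, (ρ.expect (g.strings i j).op).re

/-- The polynomial is `m`-body: all its Pauli strings have weight at most `m`. -/
def IsBody (g : PauliPoly G p) (m : ℕ) : Prop := ∀ i j, (g.strings i j).supp.card ≤ m

/-- The `ℓ₁`-norm of the coefficients. -/
def norm1 (g : PauliPoly G p) : ℝ := ∑ i, |g.coeff i|

end General

variable {D : ℕ} {L : Fin D → ℕ} [∀ i, NeZero (L i)] {p : ℕ}

/-- The Pauli strings (with multiplicity) whose expectation values are multiplied in the `i`th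
term of the `δ`-cluster approximation: every string of the `i`th term of `g` is split into its
parts on the clusters of its support. -/
def clusterFactors (g : PauliPoly (Lattice L) p) (δ : ℝ) (i : Fin g.numTerms) :
    Multiset (PauliString (Lattice L)) :=
  ∑ j, (clusters δ (g.strings i j).supp).val.map (g.strings i j).restrict

/-- The factors of the `i`th term of the `δ`-cluster approximation can be partitioned into `a`
parts such that the strings of each part are supported in a common local subsystem. -/
def CoveredBy (g : PauliPoly (Lattice L) p) (δ : ℝ) (ζ : ℕ) (i : Fin g.numTerms) (a : ℕ) : Prop :=
  ∃ (Q : Fin a → Multiset (PauliString (Lattice L))) (A : Fin a → Finset (Lattice L)),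
    g.clusterFactors δ i = ∑ l, Q l ∧
    (∀ l, A l ∈ localSubsystems ζ) ∧
    ∀ l, ∀ P ∈ Q l, P.supp ⊆ A l

/-- The local-cover number: the maximum over the terms of the least number of parts. -/
def localCoverNumber (g : PauliPoly (Lattice L) p) (δ : ℝ) (ζ : ℕ) : ℕ :=
  Finset.univ.sup fun i => sInf {a | g.CoveredBy δ ζ i a}

end PauliPoly

/-! ### Classical shadows -/

/-- Classical shadows of size `T`: for every round and every qubit, the measured axis
(`X, Y, Z`, numbered `0, 1, 2`) and the outcome (`true` for `+1`, `false` for `-1`). -/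
abbrev Shadow (G : Type) (T : ℕ) : Type := Fin T → G → Fin 3 × Bool

/-- The sign `o * W` of a recorded outcome times the measured Pauli matrix. -/
def signedPauli (w : Fin 3 × Bool) : Matrix (Fin 2) (Fin 2) ℂ :=
  (if w.2 then (1 : ℂ) else -1) • pauli w.1.succ

/-- The single-qubit snapshot `(3 o W + I) / 2`. -/
def snapshot (w : Fin 3 × Bool) : Matrix (Fin 2) (Fin 2) ℂ :=
  (1 / 2 : ℂ) • ((3 : ℂ) • signedPauli w + 1)

/-- The projector `(I + o W) / 2` onto a measurement outcome. -/
def outcomeProj (w : Fin 3 × Bool) : Matrix (Fin 2) (Fin 2) ℂ :=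
  (1 / 2 : ℂ) • (1 + signedPauli w)

section Shadows

variable {G : Type} [Fintype G] [DecidableEq G]

/-- The probability of a record in one round: the axes are chosen uniformly and independently,
the outcomes follow the Born rule. -/
def roundProb (ρ : QState G) (w : G → Fin 3 × Bool) : ℝ :=
  (1 / 3) ^ Fintype.card G * (ρ.expect (tensor fun i => outcomeProj (w i))).re

/-- The distribution of the classical shadow of size `T` of the state `ρ` (the rounds are
independent). -/
def shadowDist (T : ℕ) (ρ : QState G) : Measure (Shadow G T) :=
  ∑ S : Shadow G T, ENNReal.ofReal (∏ t, roundProb ρ (S t)) • Measure.dirac S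

/-- The distribution of pairs (classical shadow of `ρ`, label `g ρ`) for `ρ` drawn from `𝒟`. -/
def dataDist {p : ℕ} (𝒟 : Measure (QState G)) (g : PauliPoly G p) (T : ℕ) :
    Measure (Shadow G T × ℝ) :=
  𝒟.bind fun ρ => (shadowDist T ρ).map fun S => (S, g.eval ρ)

/-- The truncated shadow kernel on the subsystem `A`. -/
def truncatedShadowKernel (τ γ : ℝ) (A : Finset G) {T : ℕ} (S S' : Shadow G T) : ℝ :=
  Real.exp (τ / (T : ℝ) ^ 2 * ∑ t, ∑ t',
    ∏ i ∈ A, (1 + γ / (A.card : ℝ) * (snapshot (S t i) * snapshot (S' t' i)).trace.re))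

end Shadows

/-- The polynomial geometrically local quantum kernel of degree `h` and width `ζ`, built from
truncated shadow kernels. -/
def polyGLQK {D : ℕ} {L : Fin D → ℕ} [∀ i, NeZero (L i)] (τ γ : ℝ) (ζ h : ℕ) {T : ℕ}
    (S S' : Shadow (Lattice L) T) : ℝ :=
  (1 / ((localSubsystems (L := L) ζ).card : ℝ) *
    ∑ A ∈ localSubsystems (L := L) ζ, truncatedShadowKernel τ γ A S S') ^ h

/-! ### Kernel ridge regression -/

section KRR

variable {X : Type} {N : ℕ}

/-- The kernel model `x ↦ ∑ j, α j * k (x j) x`. -/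
def kernelModel (k : X → X → ℝ) (Z : Fin N → X × ℝ) (α : Fin N → ℝ) (x : X) : ℝ :=
  ∑ j, α j * k (Z j).1 x

/-- The squared norm `αᵀ K α` of the weight vector `∑ j, α j • φ (x j)` in feature space. -/
def weightNormSq (k : X → X → ℝ) (Z : Fin N → X × ℝ) (α : Fin N → ℝ) : ℝ :=
  ∑ i, ∑ j, α i * α j * k (Z i).1 (Z j).1

/-- The regularized empirical loss. -/
def regLoss (k : X → X → ℝ) (lam : ℝ) (Z : Fin N → X × ℝ) (α : Fin N → ℝ) : ℝ :=
  1 / (N : ℝ) * ∑ i, ((Z i).2 - kernelModel k Z α (Z i).1) ^ 2 / 2 + lam * weightNormSq k Z α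

/-- `α` is an output of kernel ridge regression on the data `Z`: it minimizes the regularized
empirical loss subject to `αᵀ K α ≤ B²`. -/
def IsKRRSolution (k : X → X → ℝ) (lam Bsq : ℝ) (Z : Fin N → X × ℝ) (α : Fin N → ℝ) : Prop :=
  weightNormSq k Z α ≤ Bsq ∧
    ∀ β : Fin N → ℝ, weightNormSq k Z β ≤ Bsq → regLoss k lam Z α ≤ regLoss k lam Z β

/-- The expected loss of a model `f`, as an integral with values in `[0, ∞]`. -/
def expectedLoss [MeasurableSpace X] (P : Measure (X × ℝ)) (f : X → ℝ) : ℝ≥0∞ :=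
  ∫⁻ z, ENNReal.ofReal ((z.2 - f z.1) ^ 2 / 2) ∂P

end KRR

end GLQK

end

open GLQK

/-! The proof compares kernel ridge regression with one explicit function of the shadow,
`PauliPoly.shadowPoly`. Each Pauli string of `g` is split into its parts on the `δ`-clusters of its
support, and the expectation of each part is replaced by its empirical estimate `shadowEst`. Two
facts about this function are needed.

It is accurate. Distinct clusters are more than `δ` apart, so peeling them off one at a time costs
`exp (-δ/ξ)` per cluster. The choice of `δ` makes this error at most half of the allowance `ε /
‖g‖₁` for a single term. Shadow estimates are unbiased and bounded by `3 ^ m` in each round, so a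
Hoeffding bound over the `T` rounds controls the rest. The result is a mean squared error of at most
`ε ^ 2` for every state with exponential clustering, that is, loss at most `ε ^ 2 / 2`.

It is cheap in feature space. Kernels are ordered by `KernelLE`, the positive semidefinite order.
Domination of `rankOne f` by `Bsq * k` makes `f` a linear functional of squared norm at most `Bsq`
in a feature space of `k` (`KernelLE.exists_weight`). Such dominations multiply by Schur's theorem
and combine linearly (`kernelLE_rankOne_sum`), so it suffices to check a single qubit, where the
snapshot trace is a sum of rank-one kernels. Products of estimates in one box are powers of the mean
round kernel, and these are terms of the exponential series. A box kernel is dominated by the number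
of boxes times their mean, and the `h`-th power supplies one factor for each part of a cover.

Finally, ridge regression obeys an oracle inequality (`lintegral_expectedLoss_kernelModel_le`).
Strong convexity shows that exchanging one sample for a fresh one changes losses by at most a factor
`1 + 4 (q + q ^ 2)`, with `q = κ / (2 λ N)` and `κ` a bound for the kernel. By exchangeability the
expected loss is at most this factor times the expected training loss, which minimality bounds by
the loss of `shadowPoly` plus `λ B ^ 2 = ε ^ 2 / 6`. For the given `N` the factor is below `3 / 2`,
and `3 / 2 * (1 / 2 + 1 / 6) = 1`. -/

set_option linter.unusedSectionVars false

namespace GLQK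

/-! ### Pauli strings, expectation values and unbiased one-round estimates -/

section Quantum

variable {G : Type} [Fintype G] [DecidableEq G]

theorem tensor_mul (M N : G → Matrix (Fin 2) (Fin 2) ℂ) :
    tensor M * tensor N = tensor fun i => M i * N i := by
  ext s t
  simp only [tensor, Matrix.mul_apply, Matrix.of_apply, ← Finset.prod_mul_distrib]
  rw [Finset.prod_univ_sum, Fintype.piFinset_univ]

theorem tensor_one : tensor (fun _ : G => (1 : Matrix (Fin 2) (Fin 2) ℂ)) = 1 := by
  ext s t
  by_cases h : s = t
  · subst h; simp [tensor]
  · obtain ⟨i, hi⟩ := Function.ne_iff.mp h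
    rw [Matrix.one_apply_ne h]
    exact Finset.prod_eq_zero (Finset.mem_univ i) (Matrix.one_apply_ne hi)

theorem tensor_conjTranspose (M : G → Matrix (Fin 2) (Fin 2) ℂ) :
    (tensor M).conjTranspose = tensor fun i => (M i).conjTranspose := by
  ext s t
  simp [tensor, Matrix.conjTranspose_apply]

theorem sum_tensor {W : Type} [Fintype W] (f : G → W → Matrix (Fin 2) (Fin 2) ℂ) :
    ∑ w : G → W, tensor (fun i => f i (w i)) = tensor fun i => ∑ w, f i w := by
  ext s t
  simp only [tensor, Matrix.sum_apply, Matrix.of_apply]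
  rw [Finset.prod_univ_sum, Fintype.piFinset_univ]

theorem tensor_smul (c : G → ℂ) (M : G → Matrix (Fin 2) (Fin 2) ℂ) :
    tensor (fun i => c i • M i) = (∏ i, c i) • tensor M := by
  ext s t
  simp [tensor, Finset.prod_mul_distrib]

theorem pauli_mul_self (a : Fin 4) : pauli a * pauli a = 1 := by
  fin_cases a <;> ext i j <;> fin_cases i <;> fin_cases j <;> simp [pauli]

theorem pauli_conjTranspose (a : Fin 4) : (pauli a).conjTranspose = pauli a := by
  fin_cases a <;> ext i j <;> fin_cases i <;> fin_cases j <;> simp [pauli]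

theorem PauliString.op_mul_self (P : PauliString G) : P.op * P.op = 1 := by
  simp only [PauliString.op, tensor_mul, pauli_mul_self, tensor_one]

theorem PauliString.op_isHermitian (P : PauliString G) : P.op.IsHermitian := by
  simp only [Matrix.IsHermitian, PauliString.op, tensor_conjTranspose, pauli_conjTranspose]

/-- The operator is a Hermitian involution, so by the C*-identity its squared norm is the norm of
the identity. -/
theorem PauliString.specNorm_op (P : PauliString G) : specNorm P.op ≤ 1 := by
  unfold specNorm
  set A := Matrix.toEuclideanCLM (n := G → Fin 2) (𝕜 := ℂ) P.op with hA
  have hstar : star A * A = 1 := by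
    rw [hA, ← map_star, ← map_mul, Matrix.star_eq_conjTranspose, P.op_isHermitian.eq,
      P.op_mul_self, map_one]
  have h := CStarRing.norm_star_mul_self (x := A)
  rw [hstar] at h
  have h1 : ‖(1 : EuclideanSpace ℂ (G → Fin 2) →L[ℂ] EuclideanSpace ℂ (G → Fin 2))‖ ≤ 1 :=
    ContinuousLinearMap.norm_id_le
  nlinarith [norm_nonneg A]

theorem PauliString.op_zero : PauliString.op (0 : PauliString G) = 1 := by
  have h : pauli 0 = 1 := rfl
  simp only [PauliString.op, Pi.zero_apply, h, tensor_one]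

theorem PauliString.actsOn (P : PauliString G) {A : Finset G} (h : P.supp ⊆ A) :
    ActsOn P.op A := by
  have h0 : ∀ i, i ∉ A → pauli (P i) = 1 := by
    intro i hi
    have : P i = 0 := by
      by_contra hne
      exact hi (h (by simp [PauliString.supp, hne]))
    rw [this]; rfl
  refine ⟨tensor fun i : A => pauli (P i), fun s t hst => ?_, fun s t hst => ?_⟩
  · simp only [PauliString.op, tensor, Matrix.of_apply]
    rw [← Finset.prod_subset (Finset.subset_univ A), ← Finset.prod_coe_sort]
    intro i _ hi
    rw [h0 i hi, hst i hi, Matrix.one_apply_eq]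
  · push Not at hst
    obtain ⟨i, hi, hne⟩ := hst
    simp only [PauliString.op, tensor, Matrix.of_apply]
    exact Finset.prod_eq_zero (Finset.mem_univ i) (by rw [h0 i hi, Matrix.one_apply_ne hne])

theorem PauliString.op_restrict_union (P : PauliString G) {A B : Finset G} (h : Disjoint A B) :
    (P.restrict (A ∪ B)).op = (P.restrict A).op * (P.restrict B).op := by
  have hp : pauli 0 = 1 := rfl
  simp only [PauliString.op, tensor_mul]
  congr 1
  funext i
  by_cases hA : i ∈ A
  · simp [PauliString.restrict, hA, Finset.disjoint_left.mp h hA, hp]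
  · by_cases hB : i ∈ B <;> simp [PauliString.restrict, hA, hB, hp]

theorem PauliString.restrict_supp (P : PauliString G) : P.restrict P.supp = P := by
  funext i
  by_cases h : P i = 0 <;> simp [PauliString.restrict, PauliString.supp, h]

theorem PauliString.supp_restrict (P : PauliString G) (C : Finset G) :
    (P.restrict C).supp = P.supp ∩ C := by
  ext i
  by_cases h : i ∈ C <;> simp [PauliString.restrict, PauliString.supp, h]

theorem QState.expect_one (ρ : QState G) : ρ.expect 1 = 1 := by
  simp only [QState.expect, one_mul]; exact ρ.2.2

theorem QState.expect_add (ρ : QState G) (A B : Operator G) :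
    ρ.expect (A + B) = ρ.expect A + ρ.expect B := by
  simp [QState.expect, add_mul]

theorem QState.expect_sub (ρ : QState G) (A B : Operator G) :
    ρ.expect (A - B) = ρ.expect A - ρ.expect B := by
  simp [QState.expect, sub_mul]

theorem QState.expect_smul (ρ : QState G) (c : ℂ) (A : Operator G) :
    ρ.expect (c • A) = c * ρ.expect A := by
  simp [QState.expect]

theorem QState.expect_sum (ρ : QState G) {ι : Type} (s : Finset ι) (A : ι → Operator G) :
    ρ.expect (∑ i ∈ s, A i) = ∑ i ∈ s, ρ.expect (A i) := by
  simp [QState.expect, Finset.sum_mul, Matrix.trace_sum]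

theorem QState.expect_conjTranspose_mul_self_nonneg (ρ : QState G) (B : Operator G) :
    0 ≤ ρ.expect (B.conjTranspose * B) := by
  have h : ρ.expect (B.conjTranspose * B) = (B * ρ.mat * B.conjTranspose).trace := by
    rw [QState.expect, mul_assoc, Matrix.trace_mul_comm]
  rw [h]
  exact (Matrix.PosSemidef.mul_mul_conjTranspose_same ρ.2.1 B).trace_nonneg

theorem QState.expect_im (ρ : QState G) {A : Operator G} (hA : A.IsHermitian) :
    (ρ.expect A).im = 0 := by
  have hρ : ρ.mat.conjTranspose = ρ.mat := ρ.2.1.isHermitian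
  have h : star (ρ.expect A) = ρ.expect A := by
    rw [QState.expect, ← Matrix.trace_conjTranspose, Matrix.conjTranspose_mul, hA.eq, hρ,
      Matrix.trace_mul_comm]
  exact Complex.conj_eq_iff_im.mp h

/-- Both `1 + A` and `1 - A` are half of their own `Bᴴ * B`, hence have nonnegative expectation. -/
theorem QState.abs_expect_le_one (ρ : QState G) {A : Operator G} (hA : A.IsHermitian)
    (hA2 : A * A = 1) : |(ρ.expect A).re| ≤ 1 := by
  have h1 : (1 + A).conjTranspose * (1 + A) = (2 : ℂ) • (1 + A) := by
    rw [Matrix.conjTranspose_add, Matrix.conjTranspose_one, hA.eq, two_smul]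
    simp only [add_mul, mul_add, hA2, one_mul, mul_one]; abel
  have h2 : (1 - A).conjTranspose * (1 - A) = (2 : ℂ) • (1 - A) := by
    rw [Matrix.conjTranspose_sub, Matrix.conjTranspose_one, hA.eq, two_smul]
    simp only [sub_mul, mul_sub, hA2, one_mul, mul_one]; abel
  have e1 := ρ.expect_conjTranspose_mul_self_nonneg (1 + A)
  have e2 := ρ.expect_conjTranspose_mul_self_nonneg (1 - A)
  rw [h1, ρ.expect_smul, ρ.expect_add, ρ.expect_one] at e1
  rw [h2, ρ.expect_smul, ρ.expect_sub, ρ.expect_one] at e2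
  have e1' := (Complex.le_def.mp e1).1
  have e2' := (Complex.le_def.mp e2).1
  simp at e1' e2'
  rw [abs_le]; constructor <;> linarith

theorem QState.abs_expect_op_le_one (ρ : QState G) (P : PauliString G) :
    |(ρ.expect P.op).re| ≤ 1 :=
  ρ.abs_expect_le_one P.op_isHermitian P.op_mul_self

theorem outcomeProj_eq (w : Fin 3 × Bool) :
    outcomeProj w = (outcomeProj w).conjTranspose * outcomeProj w := by
  have h1 : (signedPauli w).conjTranspose = signedPauli w := by
    unfold signedPauli
    rw [Matrix.conjTranspose_smul, pauli_conjTranspose]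
    split_ifs <;> simp
  have h2 : signedPauli w * signedPauli w = 1 := by
    unfold signedPauli
    rw [smul_mul_smul_comm, pauli_mul_self]
    split_ifs <;> simp
  unfold outcomeProj
  rw [Matrix.conjTranspose_smul, Matrix.conjTranspose_add, h1, Matrix.conjTranspose_one,
    smul_mul_smul_comm, add_mul, mul_add, mul_add, h2, mul_one, one_mul, mul_one,
    show (1 + signedPauli w + (signedPauli w + 1)) = (2 : ℂ) • (1 + signedPauli w) by
      rw [two_smul]; abel, smul_smul]
  congr 1
  simp

theorem roundProb_nonneg (ρ : QState G) (w : G → Fin 3 × Bool) : 0 ≤ roundProb ρ w := by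
  have h : (tensor fun i => outcomeProj (w i)) =
      (tensor fun i => outcomeProj (w i)).conjTranspose * tensor fun i => outcomeProj (w i) := by
    rw [tensor_conjTranspose, tensor_mul]
    congr 1; funext i; exact outcomeProj_eq (w i)
  have h2 := (Complex.le_def.mp (ρ.expect_conjTranspose_mul_self_nonneg
    (tensor fun i => outcomeProj (w i)))).1
  rw [← h] at h2
  exact mul_nonneg (by positivity) h2

/-- The component of a single-qubit snapshot along the Pauli matrix numbered `a`. -/
noncomputable def pauliCoeff (a : Fin 4) (w : Fin 3 × Bool) : ℝ :=
  if a = 0 then 1 else if a = w.1.succ then (if w.2 then 3 else -3) else 0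

theorem pauliCoeff_zero (w : Fin 3 × Bool) : pauliCoeff 0 w = 1 := by simp [pauliCoeff]

theorem abs_pauliCoeff_le (a : Fin 4) (w : Fin 3 × Bool) : |pauliCoeff a w| ≤ 3 := by
  unfold pauliCoeff; split_ifs <;> norm_num

/-- Inversion of the random-axis measurement channel on one qubit. Tensoring it over the sites makes
`roundEst` unbiased. -/
theorem sum_pauliCoeff_smul_outcomeProj (a : Fin 4) :
    ∑ w, ((1 / 3 * pauliCoeff a w : ℝ) : ℂ) • outcomeProj w = pauli a := by
  rw [Fintype.sum_prod_type]
  simp only [Fin.sum_univ_three, Fintype.sum_bool]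
  fin_cases a <;> ext i j <;> fin_cases i <;> fin_cases j <;>
    simp [pauliCoeff, outcomeProj, signedPauli, pauli, Fin.ext_iff] <;> ring

/-- A snapshot is half the sum of its `pauliCoeff` times Pauli matrices, which are orthogonal with
squared trace norm 2. This exhibits the trace as a sum of rank-one kernels. -/
theorem trace_snapshot_mul_snapshot (w w' : Fin 3 × Bool) :
    (snapshot w * snapshot w').trace.re = 1 / 2 * ∑ a, pauliCoeff a w * pauliCoeff a w' := by
  obtain ⟨k, o⟩ := w
  obtain ⟨k', o'⟩ := w'
  rw [Fin.sum_univ_succ]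
  simp only [Fin.sum_univ_three]
  fin_cases k <;> fin_cases k' <;> cases o <;> cases o' <;>
    simp [pauliCoeff, snapshot, signedPauli, pauli, Matrix.trace_fin_two, Matrix.mul_apply] <;> norm_num

/-- The estimate of the expectation value of the Pauli string `P` from one round. -/
noncomputable def roundEst (P : PauliString G) (w : G → Fin 3 × Bool) : ℝ :=
  ∏ i, pauliCoeff (P i) (w i)

theorem sum_roundProb_mul_roundEst (ρ : QState G) (P : PauliString G) :
    ∑ w, roundProb ρ w * roundEst P w = (ρ.expect P.op).re := by
  have h : P.op = ∑ w : G → Fin 3 × Bool,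
      (((1 / 3) ^ Fintype.card G * roundEst P w : ℝ) : ℂ) •
        tensor fun i => outcomeProj (w i) := by
    have := sum_tensor fun (i : G) (w : Fin 3 × Bool) =>
      ((1 / 3 * pauliCoeff (P i) w : ℝ) : ℂ) • outcomeProj w
    simp only [sum_pauliCoeff_smul_outcomeProj] at this
    rw [PauliString.op, ← this]
    refine Finset.sum_congr rfl fun w _ => ?_
    rw [tensor_smul]
    congr 1
    rw [← Complex.ofReal_prod, Finset.prod_mul_distrib, Finset.prod_const, roundEst,
      Finset.card_univ]
  rw [h, ρ.expect_sum, Complex.re_sum]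
  refine Finset.sum_congr rfl fun w _ => ?_
  rw [ρ.expect_smul, Complex.re_ofReal_mul, roundProb]
  ring

theorem sum_roundProb (ρ : QState G) : ∑ w, roundProb ρ w = 1 := by
  have h := sum_roundProb_mul_roundEst ρ 0
  have h1 : ∀ w : G → Fin 3 × Bool, roundEst (0 : PauliString G) w = 1 := fun w => by
    simp [roundEst, pauliCoeff_zero]
  simpa [h1, PauliString.op_zero, ρ.expect_one] using h

theorem abs_roundEst_le (P : PauliString G) (w : G → Fin 3 × Bool) :
    |roundEst P w| ≤ 3 ^ P.supp.card := by
  rw [roundEst, Finset.abs_prod, ← Finset.prod_const,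
    ← Finset.prod_subset (Finset.subset_univ P.supp)]
  · exact Finset.prod_le_prod (fun _ _ => abs_nonneg _) fun _ _ => abs_pauliCoeff_le _ _
  · intro i _ hi
    have : P i = 0 := by simpa [PauliString.supp] using hi
    simp [this, pauliCoeff_zero]

end Quantum


/-! ### Clusters fit into boxes, and expectations factorize over clusters -/

section Geometry

variable {D : ℕ} {L : Fin D → ℕ} [∀ i, NeZero (L i)]

theorem latticeDist_self (a : Lattice L) : latticeDist a a = 0 := by
  simp [latticeDist]

theorem natAbs_valMinAbs_le_latticeDist (a b : Lattice L) (i : Fin D) :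
    (a i - b i).valMinAbs.natAbs ≤ latticeDist a b :=
  Finset.single_le_sum (f := fun i => (a i - b i).valMinAbs.natAbs)
    (fun _ _ => Nat.zero_le _) (Finset.mem_univ i)

theorem le_setDist {A B : Finset (Lattice L)} (hA : A.Nonempty) (hB : B.Nonempty) {δ : ℝ}
    (h : ∀ a ∈ A, ∀ b ∈ B, δ ≤ latticeDist a b) : δ ≤ setDist A B := by
  obtain ⟨a, ha⟩ := hA
  obtain ⟨b, hb⟩ := hB
  obtain ⟨a', ha', b', hb', h'⟩ := Nat.sInf_mem
    (s := {d | ∃ a ∈ A, ∃ b ∈ B, d = latticeDist a b}) ⟨_, a, ha, b, hb, rfl⟩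
  rw [setDist, h']
  exact h a' ha' b' hb'

/-- The points of `U` lie in a cyclic box of side length `w + 1`. -/
def FitsIn (w : ℕ) (U : Finset (Lattice L)) : Prop :=
  ∃ c : Lattice L, ∀ b ∈ U, ∀ j, ∃ t : ℕ, t ≤ w ∧ b j = c j + (t : ZMod (L j))

/-- The box is enlarged in each coordinate separately, on whichever side of it the new point lies.
-/
theorem FitsIn.insert_point {w r : ℕ} {U : Finset (Lattice L)} (h : FitsIn w U) {x y : Lattice L}
    (hx : x ∈ U) (hxy : latticeDist y x ≤ r) : FitsIn (w + r) (Insert.insert y U) := by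
  obtain ⟨c, hc⟩ := h
  have key : ∀ j, ∃ d : ZMod (L j), ∀ b ∈ Insert.insert y U, ∃ t : ℕ, t ≤ w + r ∧
      b j = d + (t : ZMod (L j)) := by
    intro j
    obtain ⟨v, hv, hxv⟩ := hc x hx j
    set e := (y j - x j).valMinAbs with he
    have he1 : e.natAbs ≤ r := (natAbs_valMinAbs_le_latticeDist y x j).trans hxy
    have hye : y j = x j + (e : ZMod (L j)) := by rw [he, ZMod.coe_valMinAbs]; ring
    -- `v + e` is the offset of `y j` from the corner. If it is negative, `y j` becomes the new
    -- corner and all offsets grow by `-(v + e) ≤ r`.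
    rcases le_or_gt 0 ((v : ℤ) + e) with hpos | hneg
    · refine ⟨c j, fun b hb => ?_⟩
      rcases Finset.mem_insert.mp hb with rfl | hb
      · obtain ⟨t, ht⟩ := Int.eq_ofNat_of_zero_le hpos
        refine ⟨t, by omega, ?_⟩
        have : ((t : ℤ) : ZMod (L j)) = ((v : ℤ) + e : ℤ) := by rw [ht]
        rw [hye, hxv]
        push_cast at this
        rw [this]; ring
      · obtain ⟨t, ht, htb⟩ := hc b hb j
        exact ⟨t, by omega, htb⟩
    · refine ⟨y j, fun b hb => ?_⟩
      rcases Finset.mem_insert.mp hb with rfl | hb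
      · exact ⟨0, by omega, by simp⟩
      · obtain ⟨t, ht, htb⟩ := hc b hb j
        obtain ⟨q, hq⟩ := Int.eq_ofNat_of_zero_le (a := -((v : ℤ) + e)) (by omega)
        refine ⟨t + q, by omega, ?_⟩
        have : ((q : ℤ) : ZMod (L j)) = (-((v : ℤ) + e) : ℤ) := by rw [hq]
        rw [htb, hye, hxv]
        push_cast at this ⊢
        rw [this]; ring
  choose d hd using key
  exact ⟨d, fun b hb j => hd j b hb⟩

theorem FitsIn.subset_box {w ζ : ℕ} {U : Finset (Lattice L)} (h : FitsIn w U) (hw : w < ζ) :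
    ∃ A ∈ localSubsystems (L := L) ζ, U ⊆ A := by
  classical
  obtain ⟨c, hc⟩ := h
  refine ⟨box ζ c, Finset.mem_image_of_mem _ (Finset.mem_univ c), fun b hb => ?_⟩
  simp only [box, Finset.mem_filter, Finset.mem_univ, true_and]
  intro j
  obtain ⟨t, ht, hbt⟩ := hc b hb j
  -- Reducing the offset modulo `L j` can only decrease it, so boxes wider than the torus cause no
  -- trouble.
  rw [hbt, add_sub_cancel_left, ZMod.val_natCast]
  exact (Nat.mod_le _ _).trans_lt (ht.trans_lt hw)

theorem mem_clusters {δ : ℝ} {S C : Finset (Lattice L)} (hS : S ≠ ∅) :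
    C ∈ clusters δ S ↔ ∃ a ∈ S, ∀ b, b ∈ C ↔ b ∈ S ∧ (clusterGraph δ S).Reachable a b := by
  unfold clusters
  rw [if_neg hS]
  simp only [Finset.mem_image, Finset.ext_iff, Finset.mem_filter]
  exact exists_congr fun a => and_congr_right fun _ => forall_congr' fun b => Iff.comm

/-- The set is grown inside the cluster one point at a time. A walk from `a` to a missing point must
leave `U` along an edge, and this edge has length at most `⌊δ⌋₊`. -/
theorem exists_fitsIn_of_reachable {δ : ℝ} {S C : Finset (Lattice L)} {a : Lattice L}
    (ha : a ∈ S) (hC : ∀ b, b ∈ C ↔ b ∈ S ∧ (clusterGraph δ S).Reachable a b) (k : ℕ)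
    (hk : k + 1 ≤ C.card) :
    ∃ U ⊆ C, a ∈ U ∧ U.card = k + 1 ∧ FitsIn (k * ⌊δ⌋₊) U := by
  induction k with
  | zero =>
    refine ⟨{a}, ?_, by simp, by simp, a, fun b hb j => ⟨0, by simp, ?_⟩⟩
    · simpa [hC] using ha
    · rw [Finset.mem_singleton.mp hb]; simp
  | succ k ih =>
    obtain ⟨U, hU, haU, hcard, hfit⟩ := ih (by omega)
    obtain ⟨z, hz, hzU⟩ := Finset.exists_mem_notMem_of_card_lt_card (s := U) (t := C) (by omega)
    obtain ⟨p⟩ := ((hC z).mp hz).2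
    obtain ⟨d, -, hd1, hd2⟩ := p.exists_boundary_dart (U : Set (Lattice L)) haU hzU
    have hadj := d.adj
    have h1 : d.fst ∈ U := hd1
    have h2 : d.snd ∉ U := hd2
    have hy : d.snd ∈ C :=
      (hC _).mpr ⟨hadj.2.2.1, (((hC _).mp (hU h1)).2).trans hadj.reachable⟩
    refine ⟨insert d.snd U, Finset.insert_subset hy hU, Finset.mem_insert_of_mem haU, ?_, ?_⟩
    · rw [Finset.card_insert_of_notMem h2, hcard]
    · have := hfit.insert_point (y := d.snd) (r := ⌊δ⌋₊) h1 (by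
        rw [latticeDist_comm]; exact Nat.le_floor hadj.2.2.2)
      rwa [Nat.succ_mul]

theorem exists_localSubsystem_of_mem_clusters {m ζ : ℕ} {δ : ℝ} (hm : 0 < m) (hδ : 0 < δ)
    (hζ : ζ = ⌈(m : ℝ) * δ⌉₊) {S : Finset (Lattice L)} (hS : S.card ≤ m)
    {C : Finset (Lattice L)} (hC : C ∈ clusters δ S) :
    ∃ A ∈ localSubsystems (L := L) ζ, C ⊆ A := by
  classical
  have hm' : (0 : ℝ) < m := by exact_mod_cast hm
  -- Joining at most `m` points takes at most `m - 1` enlargements. The inequality must be strict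
  -- because `FitsIn w` means side length `w + 1`.
  have hlt : (m - 1) * ⌊δ⌋₊ < ζ := by
    rw [hζ, Nat.lt_ceil, Nat.cast_mul, Nat.cast_sub (by omega : 1 ≤ m)]
    have hf : ((⌊δ⌋₊ : ℕ) : ℝ) ≤ δ := Nat.floor_le hδ.le
    rcases Nat.eq_zero_or_pos ⌊δ⌋₊ with h0 | h0
    · rw [h0]; simp only [Nat.cast_zero, mul_zero]; positivity
    · have : (0 : ℝ) < ⌊δ⌋₊ := by exact_mod_cast h0
      push_cast
      nlinarith
  by_cases h0 : S = ∅
  · rw [clusters, if_pos h0] at hC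
    rw [Finset.mem_singleton.mp hC]
    exact ⟨box ζ 0, Finset.mem_image_of_mem _ (Finset.mem_univ _), Finset.empty_subset _⟩
  · obtain ⟨a, ha, hCa⟩ := (mem_clusters h0).mp hC
    have haC : a ∈ C := (hCa a).mpr ⟨ha, SimpleGraph.Reachable.refl a⟩
    have hpos : 0 < C.card := Finset.card_pos.mpr ⟨a, haC⟩
    obtain ⟨U, hU, -, hcard, hfit⟩ := exists_fitsIn_of_reachable (δ := δ) ha hCa (C.card - 1)
      (by omega)
    have hUC : U = C := Finset.eq_of_subset_of_card_le hU (by omega)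
    rw [hUC] at hfit
    have hCS : C.card ≤ m := (Finset.card_le_card fun b hb => ((hCa b).mp hb).1).trans hS
    refine hfit.subset_box (lt_of_le_of_lt ?_ hlt)
    gcongr

theorem card_clusters_le {m : ℕ} (hm : 0 < m) {δ : ℝ} {S : Finset (Lattice L)}
    (hS : S.card ≤ m) : (clusters δ S).card ≤ m := by
  unfold clusters
  split_ifs
  -- The empty support has one cluster, which is why `m = 0` is excluded.
  · rw [Finset.card_singleton]; exact hm
  · exact Finset.card_image_le.trans hS

theorem biUnion_clusters (δ : ℝ) (S : Finset (Lattice L)) :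
    (clusters δ S).biUnion id = S := by
  by_cases h : S = ∅
  · simp [clusters, h]
  · ext b
    simp only [Finset.mem_biUnion, id]
    constructor
    · rintro ⟨C, hC, hb⟩
      obtain ⟨a, _, hCa⟩ := (mem_clusters h).mp hC
      exact ((hCa b).mp hb).1
    · intro hb
      classical
      refine ⟨S.filter fun c => (clusterGraph δ S).Reachable b c,
        (mem_clusters h).mpr ⟨b, hb, fun c => Finset.mem_filter⟩,
        Finset.mem_filter.mpr ⟨hb, SimpleGraph.Reachable.refl b⟩⟩

theorem lt_latticeDist_of_mem_clusters {δ : ℝ} {S C C' : Finset (Lattice L)}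
    (hC : C ∈ clusters δ S) (hC' : C' ∈ clusters δ S) (hne : C ≠ C') {a b : Lattice L}
    (ha : a ∈ C) (hb : b ∈ C') : δ < latticeDist a b := by
  by_cases h : S = ∅
  · rw [clusters, if_pos h] at hC hC'
    exact absurd ((Finset.mem_singleton.mp hC).trans (Finset.mem_singleton.mp hC').symm) hne
  · obtain ⟨x, hx, hCx⟩ := (mem_clusters h).mp hC
    obtain ⟨y, hy, hCy⟩ := (mem_clusters h).mp hC'
    obtain ⟨haS, hxa⟩ := (hCx a).mp ha
    obtain ⟨hbS, hyb⟩ := (hCy b).mp hb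
    by_contra hle
    push Not at hle
    have hab : (clusterGraph δ S).Reachable a b := by
      by_cases heq : a = b
      · rw [heq]
      · exact SimpleGraph.Adj.reachable (G := clusterGraph δ S) ⟨heq, haS, hbS, hle⟩
    have hxy : (clusterGraph δ S).Reachable x y := (hxa.trans hab).trans hyb.symm
    apply hne
    ext z
    rw [hCx, hCy]
    exact ⟨fun ⟨h1, h2⟩ => ⟨h1, hxy.symm.trans h2⟩, fun ⟨h1, h2⟩ => ⟨h1, hxy.trans h2⟩⟩

theorem sum_card_clusters {δ : ℝ} (hδ : 0 ≤ δ) (S : Finset (Lattice L)) :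
    ∑ C ∈ clusters δ S, C.card = S.card := by
  have h := Finset.card_biUnion (s := clusters δ S) (t := id) (by
    intro C hC C' hC' hne
    refine Finset.disjoint_left.mpr fun a ha ha' => ?_
    have := lt_latticeDist_of_mem_clusters hC hC' hne ha ha'
    rw [latticeDist_self] at this
    norm_num at this
    linarith)
  rw [biUnion_clusters] at h
  exact h.symm

/-! ### Factorization over clusters -/

theorem HasECP.abs_expect_restrict_union_sub_le {ξ δ : ℝ} (hξ : 0 < ξ) (hδ : 0 ≤ δ)
    {ρ : QState (Lattice L)} (hρ : HasECP ξ ρ) (P : PauliString (Lattice L))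
    {A B : Finset (Lattice L)} (h : ∀ a ∈ A, ∀ b ∈ B, δ < latticeDist a b) :
    |(ρ.expect (P.restrict (A ∪ B)).op).re -
      (ρ.expect (P.restrict A).op).re * (ρ.expect (P.restrict B).op).re| ≤
      Real.exp (-δ / ξ) := by
  have h0 : P.restrict (∅ : Finset (Lattice L)) = 0 := by
    funext i; simp [PauliString.restrict]
  -- `setDist` takes the default value `0` on empty sets, so these cases are separate. There one
  -- factor is the identity and the error is zero.
  rcases A.eq_empty_or_nonempty with rfl | hA
  · simp [h0, PauliString.op_zero, ρ.expect_one, Real.exp_nonneg]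
  rcases B.eq_empty_or_nonempty with rfl | hB
  · simp [h0, PauliString.op_zero, ρ.expect_one, Real.exp_nonneg]
  have hdisj : Disjoint A B := by
    refine Finset.disjoint_left.mpr fun a ha hb => ?_
    have := h a ha a hb
    rw [latticeDist_self] at this
    norm_num at this
    linarith
  have hsub : ∀ C, (P.restrict C).supp ⊆ C := fun C => by
    intro i hi
    by_contra hne
    simp [PauliString.supp, PauliString.restrict, hne] at hi
  have key := hρ A B (P.restrict A).op (P.restrict B).op (P.restrict A).op_isHermitian
    (P.restrict B).op_isHermitian ((P.restrict A).actsOn (hsub A)) ((P.restrict B).actsOn (hsub B))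
  have hre : (ρ.expect ((P.restrict A).op * (P.restrict B).op) -
      ρ.expect (P.restrict A).op * ρ.expect (P.restrict B).op).re =
      (ρ.expect (P.restrict (A ∪ B)).op).re -
      (ρ.expect (P.restrict A).op).re * (ρ.expect (P.restrict B).op).re := by
    rw [P.op_restrict_union hdisj, Complex.sub_re, Complex.mul_re,
      ρ.expect_im (P.restrict A).op_isHermitian]
    ring
  rw [← hre]
  refine (Complex.abs_re_le_norm _).trans (key.trans ?_)
  have h1 := (P.restrict A).specNorm_op
  have h2 := (P.restrict B).specNorm_op
  have h3 : 0 ≤ specNorm (P.restrict B).op := norm_nonneg _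
  have h4 : Real.exp (-(setDist A B : ℝ) / ξ) ≤ Real.exp (-δ / ξ) := by
    have := le_setDist hA hB fun a ha b hb => (h a ha b hb).le
    gcongr
  calc _ ≤ 1 * 1 * Real.exp (-(setDist A B : ℝ) / ξ) := by gcongr
    _ ≤ _ := by simpa using h4

/-- Induction over sets of clusters: splitting off a cluster costs one correlation error, and the
error already accumulated is multiplied by an expectation of modulus at most 1. -/
theorem HasECP.abs_expect_sub_prod_clusters_le {ξ δ : ℝ} (hξ : 0 < ξ) (hδ : 0 ≤ δ)
    {ρ : QState (Lattice L)} (hρ : HasECP ξ ρ) (P : PauliString (Lattice L)) :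
    |(ρ.expect P.op).re - ∏ C ∈ clusters δ P.supp, (ρ.expect (P.restrict C).op).re| ≤
      (clusters δ P.supp).card * Real.exp (-δ / ξ) := by
  classical
  have h0 : P.restrict (∅ : Finset (Lattice L)) = 0 := by
    funext i; simp [PauliString.restrict]
  have key : ∀ 𝒞 ⊆ clusters δ P.supp, |(ρ.expect (P.restrict (𝒞.biUnion id)).op).re -
      ∏ C ∈ 𝒞, (ρ.expect (P.restrict C).op).re| ≤ 𝒞.card * Real.exp (-δ / ξ) := by
    intro 𝒞
    induction 𝒞 using Finset.induction_on with
    | empty => simp [h0, PauliString.op_zero, ρ.expect_one]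
    | insert C 𝒞 hC ih =>
      intro hsub
      rw [Finset.insert_subset_iff] at hsub
      specialize ih hsub.2
      rw [Finset.biUnion_insert, Finset.prod_insert hC, Finset.card_insert_of_notMem hC, id]
      have h1 := hρ.abs_expect_restrict_union_sub_le hξ hδ P (A := C) (B := 𝒞.biUnion id) (by
        intro a ha b hb
        obtain ⟨C', hC', hb'⟩ := Finset.mem_biUnion.mp hb
        exact lt_latticeDist_of_mem_clusters hsub.1 (hsub.2 hC')
          (fun h => hC (h ▸ hC')) ha hb')
      have h2 := ρ.abs_expect_op_le_one (P.restrict C)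
      set x := (ρ.expect (P.restrict C).op).re
      set y := (ρ.expect (P.restrict (𝒞.biUnion id)).op).re
      set z := (ρ.expect (P.restrict (C ∪ 𝒞.biUnion id)).op).re
      set q := ∏ C ∈ 𝒞, (ρ.expect (P.restrict C).op).re
      have h3 : |x * (y - q)| ≤ 𝒞.card * Real.exp (-δ / ξ) := by
        rw [abs_mul]
        exact (mul_le_of_le_one_left (abs_nonneg _) h2).trans ih
      calc |z - x * q| = |(z - x * y) + x * (y - q)| := by ring_nf
        _ ≤ |z - x * y| + |x * (y - q)| := abs_add_le _ _
        _ ≤ _ := by push_cast; linarith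
  have := key _ subset_rfl
  rw [biUnion_clusters] at this
  rwa [P.restrict_supp] at this

end Geometry


/-! ### Hoeffding bounds for empirical means and their products -/

section Concentration

/-- By convexity the exponential lies below its chord over `[-B, B]`. For a centred variable the
linear part of the chord averages to zero, leaving `cosh`. -/
theorem exp_mul_le_cosh_add {B s y : ℝ} (hB : 0 < B) (hy : |y| ≤ B) :
    Real.exp (s * y) ≤ Real.cosh (s * B) + y / B * Real.sinh (s * B) := by
  obtain ⟨h1, h2⟩ := abs_le.mp hy
  have hc := convexOn_exp.2 (Set.mem_univ (s * B)) (Set.mem_univ (-(s * B)))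
    (show 0 ≤ (B + y) / (2 * B) by apply div_nonneg <;> linarith)
    (show 0 ≤ (B - y) / (2 * B) by apply div_nonneg <;> linarith) (by field_simp; ring)
  simp only [smul_eq_mul] at hc
  have e1 : (B + y) / (2 * B) * (s * B) + (B - y) / (2 * B) * -(s * B) = s * y := by
    field_simp; ring
  rw [e1] at hc
  refine hc.trans (le_of_eq ?_)
  rw [Real.cosh_eq, Real.sinh_eq]
  field_simp; ring

variable {Y : Type} [Fintype Y] {w : Y → ℝ}

theorem sum_mul_exp_le (hw0 : ∀ y, 0 ≤ w y) (hw1 : ∑ y, w y = 1) {X : Y → ℝ} {B : ℝ}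
    (hB : 0 < B) (hX : ∀ y, |X y| ≤ B) (hmean : ∑ y, w y * X y = 0) (s : ℝ) :
    ∑ y, w y * Real.exp (s * X y) ≤ Real.exp ((s * B) ^ 2 / 2) := by
  calc ∑ y, w y * Real.exp (s * X y)
      ≤ ∑ y, w y * (Real.cosh (s * B) + X y / B * Real.sinh (s * B)) := by
        gcongr with y
        · exact hw0 y
        · exact exp_mul_le_cosh_add hB (hX y)
    _ = Real.cosh (s * B) * ∑ y, w y + Real.sinh (s * B) / B * ∑ y, w y * X y := by
        rw [Finset.mul_sum, Finset.mul_sum, ← Finset.sum_add_distrib]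
        refine Finset.sum_congr rfl fun y _ => by ring
    _ = Real.cosh (s * B) := by rw [hw1, hmean]; ring
    _ ≤ _ := Real.cosh_le_exp_half_sq _

theorem sum_prod_weight_mul_prod (T : ℕ) (f : Y → ℝ) :
    ∑ S : Fin T → Y, (∏ t, w (S t)) * ∏ t, f (S t) = (∑ y, w y * f y) ^ T := by
  simp only [← Finset.prod_mul_distrib]
  have := Finset.prod_univ_sum (fun _ : Fin T => (Finset.univ : Finset Y))
    (fun _ y => w y * f y)
  rw [Fintype.piFinset_univ] at this
  rw [← this]
  simp

theorem sum_prod_weight (hw1 : ∑ y, w y = 1) (T : ℕ) :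
    ∑ S : Fin T → Y, ∏ t, w (S t) = 1 := by
  have := sum_prod_weight_mul_prod (w := w) T (fun _ => 1)
  simpa [hw1] using this

/-- The mean of `X` over the rounds of a record. -/
noncomputable def empMean {T : ℕ} (X : Y → ℝ) (S : Fin T → Y) : ℝ := 1 / (T : ℝ) * ∑ t, X (S t)

theorem abs_empMean_le {T : ℕ} (hT : 0 < T) {X : Y → ℝ} {b : ℝ} (hX : ∀ y, |X y| ≤ b)
    (S : Fin T → Y) : |empMean X S| ≤ b := by
  have hT' : (0 : ℝ) < T := by exact_mod_cast hT
  rw [empMean, abs_mul, abs_of_pos (by positivity : (0 : ℝ) < 1 / T), one_div,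
    inv_mul_le_iff₀ hT']
  refine (Finset.abs_sum_le_sum_abs _ _).trans ((Finset.sum_le_sum fun t _ => hX (S t)).trans ?_)
  simp

open Classical in
theorem weight_deviation_ge_le (hw0 : ∀ y, 0 ≤ w y) (hw1 : ∑ y, w y = 1) {X : Y → ℝ} {B : ℝ}
    (hB : 0 < B) (hX : ∀ y, |X y| ≤ B) (hmean : ∑ y, w y * X y = 0) {T : ℕ} (hT : 0 < T)
    {η : ℝ} (hη : 0 < η) :
    ∑ S : Fin T → Y, (∏ t, w (S t)) * (if η ≤ empMean X S then 1 else 0) ≤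
      Real.exp (-(T * η ^ 2 / (2 * B ^ 2))) := by
  have hT' : (0 : ℝ) < T := by exact_mod_cast hT
  -- The minimizer of the Chernoff exponent `T * (s ^ 2 * B ^ 2 / 2 - s * η)`.
  set s := η / B ^ 2 with hs
  have hs0 : 0 < s := by positivity
  calc ∑ S : Fin T → Y, (∏ t, w (S t)) * (if η ≤ empMean X S then 1 else 0)
      ≤ ∑ S : Fin T → Y, (∏ t, w (S t)) *
          (Real.exp (-(s * (T * η))) * ∏ t, Real.exp (s * X (S t))) := by
        gcongr with S
        · exact Finset.prod_nonneg fun t _ => hw0 _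
        · rw [← Real.exp_sum, ← Real.exp_add]
          split_ifs with h
          · rw [← Real.exp_zero]
            apply Real.exp_le_exp.mpr
            rw [empMean, one_div, le_inv_mul_iff₀ hT'] at h
            rw [← Finset.mul_sum]
            nlinarith
          · exact Real.exp_nonneg _
    _ = Real.exp (-(s * (T * η))) * (∑ y, w y * Real.exp (s * X y)) ^ T := by
        rw [← sum_prod_weight_mul_prod T (fun y => Real.exp (s * X y)), Finset.mul_sum]
        refine Finset.sum_congr rfl fun S _ => by ring
    _ ≤ Real.exp (-(s * (T * η))) * (Real.exp ((s * B) ^ 2 / 2)) ^ T := by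
        gcongr
        · exact Finset.sum_nonneg fun y _ => mul_nonneg (hw0 y) (Real.exp_nonneg _)
        · exact sum_mul_exp_le hw0 hw1 hB hX hmean s
    _ = _ := by
        rw [← Real.exp_nat_mul, ← Real.exp_add]
        congr 1
        rw [hs]; field_simp; ring

open Classical in
-- The one-sided bound for `X - μ` and `μ - X`, both bounded by `b + 1 ≤ 2 * b`; this turns `2 * B ^
-- 2` into `8 * b ^ 2`.
theorem weight_abs_deviation_ge_le (hw0 : ∀ y, 0 ≤ w y) (hw1 : ∑ y, w y = 1) {X : Y → ℝ}
    {b μ : ℝ} (hb : 1 ≤ b) (hX : ∀ y, |X y| ≤ b) (hmean : ∑ y, w y * X y = μ) (hμ : |μ| ≤ 1)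
    {T : ℕ} (hT : 0 < T) {η : ℝ} (hη : 0 < η) :
    ∑ S : Fin T → Y, (∏ t, w (S t)) * (if η ≤ |empMean X S - μ| then 1 else 0) ≤
      2 * Real.exp (-(T * η ^ 2 / (8 * b ^ 2))) := by
  have hT' : (T : ℝ) ≠ 0 := by exact_mod_cast hT.ne'
  have h1 := weight_deviation_ge_le (X := fun y => X y - μ) (B := 2 * b) hw0 hw1 (by linarith)
    (fun y => (abs_sub _ _).trans (by linarith [hX y]))
    (by simp only [mul_sub, Finset.sum_sub_distrib, hmean, ← Finset.sum_mul, hw1]; ring) hT hη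
  have h2 := weight_deviation_ge_le (X := fun y => μ - X y) (B := 2 * b) hw0 hw1 (by linarith)
    (fun y => (abs_sub _ _).trans (by linarith [hX y]))
    (by simp only [mul_sub, Finset.sum_sub_distrib, hmean, ← Finset.sum_mul, hw1]; ring) hT hη
  have e1 : ∀ S : Fin T → Y, empMean (fun y => X y - μ) S = empMean X S - μ := fun S => by
    simp only [empMean, Finset.sum_sub_distrib, Finset.sum_const, Finset.card_univ,
      Fintype.card_fin, nsmul_eq_mul]
    field_simp
  have e2 : ∀ S : Fin T → Y, empMean (fun y => μ - X y) S = -(empMean X S - μ) := fun S => by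
    simp only [empMean, Finset.sum_sub_distrib, Finset.sum_const, Finset.card_univ,
      Fintype.card_fin, nsmul_eq_mul]
    field_simp
    ring
  simp only [e1] at h1
  simp only [e2] at h2
  rw [show 2 * (2 * b) ^ 2 = 8 * b ^ 2 by ring] at h1 h2
  rw [two_mul]
  refine le_trans ?_ (add_le_add h1 h2)
  rw [← Finset.sum_add_distrib]
  refine Finset.sum_le_sum fun S _ => ?_
  rw [← mul_add]
  refine mul_le_mul_of_nonneg_left ?_ (Finset.prod_nonneg fun t _ => hw0 _)
  by_cases h3 : η ≤ |empMean X S - μ|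
  · rw [if_pos h3]
    rcases le_abs.mp h3 with h | h
    · rw [if_pos h]; split_ifs <;> norm_num
    · rw [if_pos h]; split_ifs <;> norm_num
  · rw [if_neg h3]; split_ifs <;> norm_num

theorem abs_prod_sub_prod_le {ι : Type} (s : Finset ι) {a μ : ι → ℝ} {η : ℝ} (hη : 0 ≤ η)
    (hμ : ∀ i, |μ i| ≤ 1) (h : ∀ i ∈ s, |a i - μ i| ≤ η) :
    |∏ i ∈ s, a i - ∏ i ∈ s, μ i| ≤ (1 + η) ^ s.card - 1 := by
  classical
  induction s using Finset.induction_on with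
  | empty => simp
  | insert i s hi ih =>
    have ih' := ih fun j hj => h j (Finset.mem_insert_of_mem hj)
    have hi' := h i (Finset.mem_insert_self i s)
    rw [Finset.prod_insert hi, Finset.prod_insert hi, Finset.card_insert_of_notMem hi]
    have ha : |a i| ≤ 1 + η := by
      calc |a i| = |μ i + (a i - μ i)| := by ring_nf
        _ ≤ _ := (abs_add_le _ _).trans (add_le_add (hμ i) hi')
    have hM : |∏ i ∈ s, μ i| ≤ 1 := by
      rw [Finset.abs_prod]
      exact Finset.prod_le_one (fun _ _ => abs_nonneg _) fun j _ => hμ j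
    calc |a i * ∏ i ∈ s, a i - μ i * ∏ i ∈ s, μ i|
        = |a i * (∏ i ∈ s, a i - ∏ i ∈ s, μ i) + (a i - μ i) * ∏ i ∈ s, μ i| := by ring_nf
      _ ≤ |a i| * |∏ i ∈ s, a i - ∏ i ∈ s, μ i| + |a i - μ i| * |∏ i ∈ s, μ i| := by
        rw [← abs_mul, ← abs_mul]; exact abs_add_le _ _
      _ ≤ (1 + η) * ((1 + η) ^ s.card - 1) + η * 1 := by gcongr
      _ = _ := by ring

/-- Mean squared error of a product of empirical means. -/
theorem sum_prod_weight_mul_sq_le (hw0 : ∀ y, 0 ≤ w y) (hw1 : ∑ y, w y = 1)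
    {ι : Type} [Fintype ι] {X : ι → Y → ℝ} {b : ℝ} {μ : ι → ℝ} (hb : 1 ≤ b)
    (hX : ∀ i y, |X i y| ≤ b) (hmean : ∀ i, ∑ y, w y * X i y = μ i) (hμ : ∀ i, |μ i| ≤ 1)
    {T : ℕ} (hT : 0 < T) {η : ℝ} (hη : 0 < η) {v e : ℝ} (hv : |v| ≤ 1)
    (he : |∏ i, μ i - v| ≤ e) :
    ∑ S : Fin T → Y, (∏ t, w (S t)) * (∏ i, empMean (X i) S - v) ^ 2 ≤
      (e + ((1 + η) ^ Fintype.card ι - 1)) ^ 2 +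
      (b ^ Fintype.card ι + 1) ^ 2 *
        (Fintype.card ι * (2 * Real.exp (-(T * η ^ 2 / (8 * b ^ 2))))) := by
  classical
  set q := Fintype.card ι with hq
  -- If all empirical means are `η`-accurate the first summand suffices. Otherwise the crude bound
  -- `b ^ q + 1` applies, and the sum of indicators is at least 1 (union bound).
  have hpt : ∀ S : Fin T → Y, (∏ i, empMean (X i) S - v) ^ 2 ≤ (e + ((1 + η) ^ q - 1)) ^ 2 +
      (b ^ q + 1) ^ 2 * ∑ i, (if η ≤ |empMean (X i) S - μ i| then 1 else 0) := by
    intro S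
    by_cases hS : ∃ i, η ≤ |empMean (X i) S - μ i|
    · obtain ⟨i, hi⟩ := hS
      have h1 : (1 : ℝ) ≤ ∑ i, (if η ≤ |empMean (X i) S - μ i| then 1 else 0) := by
        have := Finset.single_le_sum
          (f := fun i => (if η ≤ |empMean (X i) S - μ i| then (1 : ℝ) else 0))
          (fun i _ => by split_ifs <;> norm_num) (Finset.mem_univ i)
        simpa only [hi, if_true] using this
      have h2 : |∏ i, empMean (X i) S - v| ≤ b ^ q + 1 := by
        refine (abs_sub _ _).trans (add_le_add ?_ hv)
        rw [Finset.abs_prod, hq, ← Finset.card_univ, ← Finset.prod_const]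
        exact Finset.prod_le_prod (fun _ _ => abs_nonneg _)
          fun i _ => abs_empMean_le hT (hX i) S
      have h3 := sq_le_sq' (by linarith [neg_abs_le (∏ i, empMean (X i) S - v)])
        ((le_abs_self _).trans h2)
      have h4 := mul_le_mul_of_nonneg_left h1 (sq_nonneg (b ^ q + 1))
      nlinarith [sq_nonneg (e + ((1 + η) ^ q - 1))]
    · push Not at hS
      have h1 := abs_prod_sub_prod_le Finset.univ hη.le hμ
        (a := fun i => empMean (X i) S) fun i _ => (hS i).le
      rw [Finset.card_univ, ← hq] at h1
      have h2 : |∏ i, empMean (X i) S - v| ≤ e + ((1 + η) ^ q - 1) := by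
        calc _ = |(∏ i, empMean (X i) S - ∏ i, μ i) + (∏ i, μ i - v)| := by ring_nf
          _ ≤ _ := (abs_add_le _ _).trans (by linarith)
      have h3 := sq_le_sq' (by linarith [neg_abs_le (∏ i, empMean (X i) S - v)])
        ((le_abs_self _).trans h2)
      have h4 : ∀ i, (if η ≤ |empMean (X i) S - μ i| then (1 : ℝ) else 0) = 0 := fun i =>
        if_neg (not_le.mpr (hS i))
      simpa [h4] using h3
  calc ∑ S : Fin T → Y, (∏ t, w (S t)) * (∏ i, empMean (X i) S - v) ^ 2
      ≤ ∑ S : Fin T → Y, (∏ t, w (S t)) * ((e + ((1 + η) ^ q - 1)) ^ 2 +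
        (b ^ q + 1) ^ 2 * ∑ i, (if η ≤ |empMean (X i) S - μ i| then 1 else 0)) := by
        gcongr with S
        · exact Finset.prod_nonneg fun t _ => hw0 _
        · exact hpt S
    _ = (e + ((1 + η) ^ q - 1)) ^ 2 * (∑ S : Fin T → Y, ∏ t, w (S t)) + (b ^ q + 1) ^ 2 *
        ∑ i, ∑ S : Fin T → Y, (∏ t, w (S t)) *
          (if η ≤ |empMean (X i) S - μ i| then 1 else 0) := by
        rw [Finset.sum_comm]
        simp only [Finset.mul_sum, mul_add, Finset.sum_add_distrib]
        congr 1
        · exact Finset.sum_congr rfl fun S _ => mul_comm _ _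
        · exact Finset.sum_congr rfl fun S _ => Finset.sum_congr rfl fun i _ => by ring
    _ ≤ (e + ((1 + η) ^ q - 1)) ^ 2 * 1 + (b ^ q + 1) ^ 2 *
        ∑ i : ι, (2 * Real.exp (-(T * η ^ 2 / (8 * b ^ 2)))) := by
        rw [sum_prod_weight hw1]
        gcongr with i
        exact weight_abs_deviation_ge_le hw0 hw1 hb (hX i) (hmean i) (hμ i) hT hη
    _ = _ := by simp [hq]

end Concentration


/-! ### Calculus of the positive semidefinite order on kernels -/

section Kernels

variable {X Y : Type}

/-- The quadratic form of a kernel for the weights `c` at the points `p`. -/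
def kernelForm (k : X → X → ℝ) {ι : Type} [Fintype ι] (p : ι → X) (c : ι → ℝ) : ℝ :=
  ∑ i, ∑ j, c i * c j * k (p i) (p j)

/-- Positive semidefinite kernels. -/
def IsPSDKernel (k : X → X → ℝ) : Prop :=
  (∀ x y, k x y = k y x) ∧
    ∀ (ι : Type) [Fintype ι] (p : ι → X) (c : ι → ℝ), 0 ≤ kernelForm k p c

/-- The order of kernels. -/
def KernelLE (k k' : X → X → ℝ) : Prop := IsPSDKernel fun x y => k' x y - k x y

/-- The rank-one kernel of a function. -/
def rankOne (f : X → ℝ) (x y : X) : ℝ := f x * f y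

theorem kernelForm_add (k k' : X → X → ℝ) {ι : Type} [Fintype ι] (p : ι → X) (c : ι → ℝ) :
    kernelForm (fun x y => k x y + k' x y) p c = kernelForm k p c + kernelForm k' p c := by
  simp only [kernelForm, mul_add, Finset.sum_add_distrib]

theorem kernelForm_sub (k k' : X → X → ℝ) {ι : Type} [Fintype ι] (p : ι → X) (c : ι → ℝ) :
    kernelForm (fun x y => k x y - k' x y) p c = kernelForm k p c - kernelForm k' p c := by
  simp only [kernelForm, mul_sub, Finset.sum_sub_distrib]

theorem kernelForm_mul_left (a : ℝ) (k : X → X → ℝ) {ι : Type} [Fintype ι] (p : ι → X)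
    (c : ι → ℝ) : kernelForm (fun x y => a * k x y) p c = a * kernelForm k p c := by
  simp only [kernelForm, Finset.mul_sum]
  exact Finset.sum_congr rfl fun i _ => Finset.sum_congr rfl fun j _ => by ring

theorem kernelForm_rankOne (f : X → ℝ) {ι : Type} [Fintype ι] (p : ι → X) (c : ι → ℝ) :
    kernelForm (rankOne f) p c = (∑ i, c i * f (p i)) ^ 2 := by
  rw [sq, Finset.sum_mul_sum]
  exact Finset.sum_congr rfl fun i _ => Finset.sum_congr rfl fun j _ => by rw [rankOne]; ring

theorem IsPSDKernel.add {k k' : X → X → ℝ} (h : IsPSDKernel k) (h' : IsPSDKernel k') :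
    IsPSDKernel fun x y => k x y + k' x y :=
  ⟨fun x y => by beta_reduce; rw [h.1, h'.1], fun ι _ p c => by
    rw [kernelForm_add]; exact add_nonneg (h.2 ι p c) (h'.2 ι p c)⟩

theorem IsPSDKernel.mul_left {k : X → X → ℝ} (h : IsPSDKernel k) {a : ℝ} (ha : 0 ≤ a) :
    IsPSDKernel fun x y => a * k x y :=
  ⟨fun x y => by beta_reduce; rw [h.1], fun ι _ p c => by
    rw [kernelForm_mul_left]; exact mul_nonneg ha (h.2 ι p c)⟩

theorem isPSDKernel_rankOne (f : X → ℝ) : IsPSDKernel (rankOne f) :=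
  ⟨fun x y => mul_comm _ _, fun ι _ p c => by rw [kernelForm_rankOne]; positivity⟩

theorem isPSDKernel_one : IsPSDKernel fun _ _ : X => (1 : ℝ) := by
  refine (congrArg IsPSDKernel ?_).mp (isPSDKernel_rankOne fun _ : X => (1 : ℝ))
  funext x y; simp [rankOne]

theorem isPSDKernel_zero : IsPSDKernel fun _ _ : X => (0 : ℝ) := by
  refine (congrArg IsPSDKernel ?_).mp (isPSDKernel_rankOne fun _ : X => (0 : ℝ))
  funext x y; simp [rankOne]

theorem IsPSDKernel.sum {α : Type} (s : Finset α) {k : α → X → X → ℝ}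
    (h : ∀ a ∈ s, IsPSDKernel (k a)) : IsPSDKernel fun x y => ∑ a ∈ s, k a x y := by
  classical
  induction s using Finset.induction_on with
  | empty => simpa using isPSDKernel_zero
  | insert a s ha ih =>
    simp only [Finset.sum_insert ha]
    exact (h a (Finset.mem_insert_self a s)).add
      (ih fun b hb => h b (Finset.mem_insert_of_mem hb))

theorem IsPSDKernel.posSemidef {k : X → X → ℝ} (h : IsPSDKernel k) {ι : Type} [Fintype ι]
    (p : ι → X) : (Matrix.of fun i j => k (p i) (p j)).PosSemidef := by
  refine Matrix.PosSemidef.of_dotProduct_mulVec_nonneg ?_ fun c => ?_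
  · ext i j
    simp [Matrix.conjTranspose_apply, h.1 (p j) (p i)]
  · refine (h.2 ι p c).trans (le_of_eq ?_)
    simp only [kernelForm, dotProduct, Matrix.mulVec, Matrix.of_apply, Finset.mul_sum,
      Pi.star_apply, star_trivial]
    exact Finset.sum_congr rfl fun i _ => Finset.sum_congr rfl fun j _ => by ring

/-- Schur's product theorem for the kernel matrices of a finite family of points. -/
theorem IsPSDKernel.mul {k k' : X → X → ℝ} (h : IsPSDKernel k) (h' : IsPSDKernel k') :
    IsPSDKernel fun x y => k x y * k' x y := by
  refine ⟨fun x y => by beta_reduce; rw [h.1, h'.1], fun ι _ p c => ?_⟩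
  have hs := ((h.posSemidef p).hadamard (h'.posSemidef p)).dotProduct_mulVec_nonneg c
  refine hs.trans (le_of_eq ?_)
  simp only [kernelForm, dotProduct, Matrix.mulVec, Matrix.of_apply, Finset.mul_sum,
    Pi.star_apply, star_trivial, Matrix.hadamard_apply]
  exact Finset.sum_congr rfl fun i _ => Finset.sum_congr rfl fun j _ => by ring

theorem IsPSDKernel.prod {α : Type} (s : Finset α) {k : α → X → X → ℝ}
    (h : ∀ a ∈ s, IsPSDKernel (k a)) : IsPSDKernel fun x y => ∏ a ∈ s, k a x y := by
  classical
  induction s using Finset.induction_on with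
  | empty => simpa using isPSDKernel_one
  | insert a s ha ih =>
    simp only [Finset.prod_insert ha]
    exact (h a (Finset.mem_insert_self a s)).mul
      (ih fun b hb => h b (Finset.mem_insert_of_mem hb))

theorem IsPSDKernel.pow {k : X → X → ℝ} (h : IsPSDKernel k) (n : ℕ) :
    IsPSDKernel fun x y => k x y ^ n := by
  simpa using IsPSDKernel.prod (Finset.range n) (k := fun _ => k) fun _ _ => h

theorem IsPSDKernel.comp {k : Y → Y → ℝ} (h : IsPSDKernel k) (f : X → Y) :
    IsPSDKernel fun x y => k (f x) (f y) :=
  ⟨fun _ _ => h.1 _ _, fun ι _ p c => h.2 ι (f ∘ p) c⟩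

/-- The form equals that of `k` at the points `p i t`, indexed by pairs `(i, t)`, with weights
independent of `t`. -/
theorem IsPSDKernel.sum_sum {k : Y → Y → ℝ} (h : IsPSDKernel k) {α : Type} [Fintype α] :
    IsPSDKernel fun x y : α → Y => ∑ t, ∑ t', k (x t) (y t') := by
  refine ⟨fun x y => ?_, fun ι _ p c => ?_⟩
  · beta_reduce
    rw [Finset.sum_comm]
    exact Finset.sum_congr rfl fun i _ => Finset.sum_congr rfl fun j _ => h.1 _ _
  · have := h.2 (ι × α) (fun i => p i.1 i.2) fun i => c i.1
    refine this.trans (le_of_eq ?_)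
    simp only [kernelForm, Fintype.sum_prod_type, Finset.mul_sum]
    refine Finset.sum_congr rfl fun i _ => ?_
    rw [Finset.sum_comm]

theorem KernelLE.refl (k : X → X → ℝ) : KernelLE k k := by
  simpa [KernelLE] using isPSDKernel_zero

theorem KernelLE.trans {k₁ k₂ k₃ : X → X → ℝ} (h : KernelLE k₁ k₂) (h' : KernelLE k₂ k₃) :
    KernelLE k₁ k₃ := by
  have := IsPSDKernel.add h h'
  refine (congrArg IsPSDKernel ?_).mp this
  funext x y; ring

theorem KernelLE.isPSDKernel {k k' : X → X → ℝ} (h : KernelLE k k') (hk : IsPSDKernel k) :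
    IsPSDKernel k' := by
  have := hk.add h
  refine (congrArg IsPSDKernel ?_).mp this
  funext x y; ring

/-- The difference is `(k₁' - k₁) * k₂' + k₁ * (k₂' - k₂)`, a sum of Schur products. -/
theorem KernelLE.mul {k₁ k₁' k₂ k₂' : X → X → ℝ} (h₁ : KernelLE k₁ k₁') (h₂ : KernelLE k₂ k₂')
    (hk₁ : IsPSDKernel k₁) (hk₂ : IsPSDKernel k₂) :
    KernelLE (fun x y => k₁ x y * k₂ x y) fun x y => k₁' x y * k₂' x y := by
  have := (IsPSDKernel.mul h₁ (h₂.isPSDKernel hk₂)).add (IsPSDKernel.mul hk₁ h₂)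
  refine (congrArg IsPSDKernel ?_).mp this
  funext x y; ring

theorem KernelLE.prod {α : Type} (s : Finset α) {k k' : α → X → X → ℝ}
    (h : ∀ a ∈ s, KernelLE (k a) (k' a)) (hk : ∀ a ∈ s, IsPSDKernel (k a)) :
    KernelLE (fun x y => ∏ a ∈ s, k a x y) fun x y => ∏ a ∈ s, k' a x y := by
  classical
  induction s using Finset.induction_on with
  | empty => simpa using KernelLE.refl _
  | insert a s ha ih =>
    simp only [Finset.prod_insert ha]
    exact (h a (Finset.mem_insert_self a s)).mul
      (ih (fun b hb => h b (Finset.mem_insert_of_mem hb))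
        fun b hb => hk b (Finset.mem_insert_of_mem hb))
      (hk a (Finset.mem_insert_self a s))
      (IsPSDKernel.prod s fun b hb => hk b (Finset.mem_insert_of_mem hb))

theorem KernelLE.mul_left {k k' : X → X → ℝ} (h : KernelLE k k') {a : ℝ} (ha : 0 ≤ a) :
    KernelLE (fun x y => a * k x y) fun x y => a * k' x y := by
  have := IsPSDKernel.mul_left h ha
  refine (congrArg IsPSDKernel ?_).mp this
  funext x y; ring

theorem IsPSDKernel.mul_left_mono {k : X → X → ℝ} (h : IsPSDKernel k) {a b : ℝ} (hab : a ≤ b) :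
    KernelLE (fun x y => a * k x y) fun x y => b * k x y := by
  have := h.mul_left (sub_nonneg.mpr hab)
  refine (congrArg IsPSDKernel ?_).mp this
  funext x y; ring

theorem KernelLE.of_mem_sum {α : Type} {s : Finset α} {k : α → X → X → ℝ}
    (h : ∀ a ∈ s, IsPSDKernel (k a)) {a : α} (ha : a ∈ s) :
    KernelLE (k a) fun x y => ∑ a ∈ s, k a x y := by
  classical
  have := IsPSDKernel.sum (s.erase a) fun b hb => h b (Finset.mem_of_mem_erase hb)
  refine (congrArg IsPSDKernel ?_).mp this
  funext x y
  beta_reduce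
  rw [← Finset.add_sum_erase s _ ha]; ring

theorem KernelLE.sum_sum {k k' : Y → Y → ℝ} (h : KernelLE k k') {α : Type} [Fintype α] :
    KernelLE (fun x y : α → Y => ∑ t, ∑ t', k (x t) (y t'))
      fun x y : α → Y => ∑ t, ∑ t', k' (x t) (y t') := by
  have := IsPSDKernel.sum_sum (α := α) h
  refine (congrArg IsPSDKernel ?_).mp this
  funext x y
  simp only [Finset.sum_sub_distrib]

theorem KernelLE.comp {k k' : Y → Y → ℝ} (h : KernelLE k k') (f : X → Y) :
    KernelLE (fun x y => k (f x) (f y)) fun x y => k' (f x) (f y) :=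
  IsPSDKernel.comp h f

/-- Every term of the exponential series of a positive semidefinite kernel is dominated by the
exponential of the kernel. -/
theorem IsPSDKernel.pow_le_exp {k : X → X → ℝ} (h : IsPSDKernel k) (n : ℕ) :
    KernelLE (fun x y => 1 / (n.factorial : ℝ) * k x y ^ n) fun x y => Real.exp (k x y) := by
  refine ⟨fun x y => by beta_reduce; rw [h.1], fun ι _ p c => ?_⟩
  rw [kernelForm_sub, sub_nonneg]
  have hsum : HasSum (fun n : ℕ => kernelForm (fun x y => 1 / (n.factorial : ℝ) * k x y ^ n) p c)
      (kernelForm (fun x y => Real.exp (k x y)) p c) := by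
    unfold kernelForm
    refine hasSum_sum fun i _ => hasSum_sum fun j _ => HasSum.mul_left _ ?_
    have := NormedSpace.expSeries_div_hasSum_exp (k (p i) (p j))
    rw [← Real.exp_eq_exp_ℝ] at this
    simpa [div_eq_inv_mul] using this
  exact le_hasSum hsum n fun j _ => ((h.pow j).mul_left (by positivity)).2 ι p c

theorem IsPSDKernel.one_le_exp {k : X → X → ℝ} (h : IsPSDKernel k) :
    KernelLE (fun _ _ => 1) fun x y => Real.exp (k x y) := by
  simpa using h.pow_le_exp 0

theorem IsPSDKernel.exp {k : X → X → ℝ} (h : IsPSDKernel k) :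
    IsPSDKernel fun x y => Real.exp (k x y) :=
  h.one_le_exp.isPSDKernel isPSDKernel_one

/-- The triangle inequality for feature-space norms: each `f i` has norm at most `√R`, so the
combination has norm at most `(∑ |a i|) * √R`. It is carried out on quadratic forms, without
choosing a feature space. -/
theorem kernelLE_rankOne_sum {k : X → X → ℝ} (h : IsPSDKernel k) {α : Type} (s : Finset α)
    (f : α → X → ℝ) (a : α → ℝ) {R : ℝ} (hR : 0 ≤ R)
    (hf : ∀ i ∈ s, KernelLE (rankOne (f i)) fun x y => R * k x y) :
    KernelLE (rankOne fun x => ∑ i ∈ s, a i * f i x)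
      fun x y => ((∑ i ∈ s, |a i|) ^ 2 * R) * k x y := by
  refine ⟨fun x y => by beta_reduce; rw [h.1]; simp only [rankOne]; ring, fun ι _ p c => ?_⟩
  rw [kernelForm_sub, sub_nonneg, kernelForm_rankOne, kernelForm_mul_left]
  set q := kernelForm k p c with hq
  have hq0 : 0 ≤ q := h.2 ι p c
  have h1 : ∀ i ∈ s, |∑ j, c j * f i (p j)| ≤ Real.sqrt (R * q) := by
    intro i hi
    have := (hf i hi).2 ι p c
    rw [kernelForm_sub, sub_nonneg, kernelForm_rankOne, kernelForm_mul_left] at this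
    exact Real.abs_le_sqrt this
  have h2 : ∑ j, c j * ∑ i ∈ s, a i * f i (p j) = ∑ i ∈ s, a i * ∑ j, c j * f i (p j) := by
    simp only [Finset.mul_sum]
    rw [Finset.sum_comm]
    exact Finset.sum_congr rfl fun i _ => Finset.sum_congr rfl fun j _ => by ring
  have h3 : |∑ i ∈ s, a i * ∑ j, c j * f i (p j)| ≤ (∑ i ∈ s, |a i|) * Real.sqrt (R * q) := by
    rw [Finset.sum_mul]
    refine (Finset.abs_sum_le_sum_abs _ _).trans (Finset.sum_le_sum fun i hi => ?_)
    rw [abs_mul]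
    exact mul_le_mul_of_nonneg_left (h1 i hi) (abs_nonneg _)
  rw [h2, ← sq_abs]
  calc _ ≤ ((∑ i ∈ s, |a i|) * Real.sqrt (R * q)) ^ 2 := by gcongr
    _ = _ := by rw [mul_pow, Real.sq_sqrt (mul_nonneg hR hq0)]; ring

end Kernels

/-! ### Shadow estimates are dominated by truncated shadow kernels -/

section ShadowKernel

/-- The single-round kernel on the qubits of `A`. -/
noncomputable def roundKernel {G : Type} (γ : ℝ) (A : Finset G) (w w' : G → Fin 3 × Bool) : ℝ :=
  ∏ i ∈ A, (1 + γ / (A.card : ℝ) * (snapshot (w i) * snapshot (w' i)).trace.re)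

variable {G : Type} [Fintype G] [DecidableEq G] {γ τ : ℝ}

theorem isPSDKernel_trace_snapshot :
    IsPSDKernel fun w w' => (snapshot w * snapshot w').trace.re := by
  simp only [trace_snapshot_mul_snapshot]
  exact (IsPSDKernel.sum Finset.univ fun a _ => isPSDKernel_rankOne (pauliCoeff a)).mul_left
    (by norm_num)

theorem kernelLE_rankOne_pauliCoeff (a : Fin 4) :
    KernelLE (fun w w' => 1 / 2 * rankOne (pauliCoeff a) w w')
      fun w w' => (snapshot w * snapshot w').trace.re := by
  simp only [trace_snapshot_mul_snapshot]
  exact (KernelLE.of_mem_sum (s := Finset.univ) (k := fun a => rankOne (pauliCoeff a))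
    (fun a _ => isPSDKernel_rankOne (pauliCoeff a)) (Finset.mem_univ a)).mul_left (by norm_num)

theorem isPSDKernel_one_add_trace {s : ℝ} (hs : 0 ≤ s) :
    IsPSDKernel fun w w' => 1 + s * (snapshot w * snapshot w').trace.re :=
  isPSDKernel_one.add (isPSDKernel_trace_snapshot.mul_left hs)

theorem isPSDKernel_roundKernel (hγ : 0 ≤ γ) (A : Finset G) : IsPSDKernel (roundKernel γ A) := by
  have hs : 0 ≤ γ / (A.card : ℝ) := by positivity
  have h := fun i : G => (isPSDKernel_one_add_trace hs).comp fun w : G → Fin 3 × Bool => w i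
  exact IsPSDKernel.prod A fun i _ => h i

/-- The identity is covered by the constant `1` at no cost, and the other Pauli matrices by the
trace term. Hence a string only pays for the sites of its support. -/
theorem kernelLE_pauliCoeff_one_add {s : ℝ} (hs : 0 < s) (a : Fin 4) :
    KernelLE (rankOne (pauliCoeff a)) fun w w' =>
      (if a = 0 then 1 else 2 / s) * (1 + s * (snapshot w * snapshot w').trace.re) := by
  split_ifs with h
  · have := isPSDKernel_trace_snapshot.mul_left hs.le
    refine (congrArg IsPSDKernel ?_).mp this
    funext w w'
    rw [h, rankOne, pauliCoeff_zero, pauliCoeff_zero]; ring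
  · have := (isPSDKernel_one.mul_left (a := 2 / s) (by positivity)).add
      (IsPSDKernel.mul_left (kernelLE_rankOne_pauliCoeff a) (a := 2) (by norm_num))
    refine (congrArg IsPSDKernel ?_).mp this
    funext w w'
    field_simp; ring

theorem kernelLE_rankOne_roundEst (hγ : 0 < γ) {A : Finset G} {P : PauliString G}
    (hP : P.supp ⊆ A) {M : ℝ} (hA : (A.card : ℝ) ≤ M) :
    KernelLE (rankOne (roundEst P)) fun w w' =>
      (2 * M / γ) ^ P.supp.card * roundKernel γ A w w' := by
  -- For empty `A` the factor `γ / A.card` is `0`, not positive, but both kernels are constantly 1.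
  rcases A.eq_empty_or_nonempty with rfl | hne
  · have h0 : P.supp = ∅ := Finset.subset_empty.mp hP
    have h1 : ∀ i, P i = 0 := fun i => by
      by_contra h
      have : i ∈ P.supp := by simp [PauliString.supp, h]
      simp [h0] at this
    refine (congrArg IsPSDKernel ?_).mp isPSDKernel_zero
    funext w w'
    simp [h0, roundKernel, rankOne, roundEst, h1, pauliCoeff_zero]
  have hcard : (0 : ℝ) < A.card := by exact_mod_cast Finset.card_pos.mpr hne
  have hs : 0 < γ / (A.card : ℝ) := by positivity
  have h1 := KernelLE.prod A
    (k := fun i (w w' : G → Fin 3 × Bool) => rankOne (pauliCoeff (P i)) (w i) (w' i))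
    (fun i _ => (kernelLE_pauliCoeff_one_add hs (P i)).comp fun w : G → Fin 3 × Bool => w i)
    fun i _ => (isPSDKernel_rankOne _).comp fun w : G → Fin 3 × Bool => w i
  have e1 : (fun w w' : G → Fin 3 × Bool =>
      ∏ i ∈ A, rankOne (pauliCoeff (P i)) (w i) (w' i)) = rankOne (roundEst P) := by
    funext w w'
    simp only [rankOne, Finset.prod_mul_distrib, roundEst]
    congr 1 <;>
    · refine Finset.prod_subset (Finset.subset_univ A) fun i _ hi => ?_
      have : P i = 0 := by
        by_contra h
        exact hi (hP (by simp [PauliString.supp, h]))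
      rw [this, pauliCoeff_zero]
  rw [e1] at h1
  refine h1.trans ?_
  have e2 : (∏ i ∈ A, if P i = 0 then (1 : ℝ) else 2 / (γ / (A.card : ℝ))) =
      (2 / (γ / (A.card : ℝ))) ^ P.supp.card := by
    rw [Finset.prod_ite, Finset.prod_const_one, one_mul, Finset.prod_const]
    congr 2
    ext i
    simp only [Finset.mem_filter, PauliString.supp, Finset.mem_univ, true_and]
    exact ⟨fun h => h.2, fun h => ⟨hP (by simp [PauliString.supp, h]), h⟩⟩
  simp only [Finset.prod_mul_distrib, e2]
  refine (isPSDKernel_roundKernel hγ.le A).mul_left_mono ?_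
  gcongr ?_ ^ _
  rw [div_div_eq_mul_div]
  gcongr

/-- The empirical estimate of the expectation value of a Pauli string. -/
noncomputable def shadowEst {T : ℕ} (P : PauliString G) (S : Shadow G T) : ℝ :=
  empMean (roundEst P) S

/-- The mean of the single-round kernel over pairs of rounds. -/
noncomputable def meanKernel (γ : ℝ) (A : Finset G) {T : ℕ} (S S' : Shadow G T) : ℝ :=
  1 / (T : ℝ) ^ 2 * ∑ t, ∑ t', roundKernel γ A (S t) (S' t')

theorem truncatedShadowKernel_eq (A : Finset G) {T : ℕ} (S S' : Shadow G T) :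
    truncatedShadowKernel τ γ A S S' = Real.exp (τ * meanKernel γ A S S') := by
  simp only [truncatedShadowKernel, meanKernel, roundKernel]
  congr 1; ring

theorem isPSDKernel_meanKernel (hγ : 0 ≤ γ) (A : Finset G) {T : ℕ} :
    IsPSDKernel (meanKernel γ A (T := T)) :=
  (isPSDKernel_roundKernel hγ A).sum_sum.mul_left (by positivity)

theorem one_le_truncatedShadowKernel (hγ : 0 ≤ γ) (hτ : 0 ≤ τ) (A : Finset G) {T : ℕ} :
    KernelLE (fun _ _ => 1) (truncatedShadowKernel τ γ A (T := T)) := by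
  have := ((isPSDKernel_meanKernel (T := T) hγ A).mul_left hτ).one_le_exp
  simpa only [← truncatedShadowKernel_eq] using this

theorem kernelLE_rankOne_shadowEst (hγ : 0 < γ) {A : Finset G} {P : PauliString G}
    (hP : P.supp ⊆ A) {M : ℝ} (hA : (A.card : ℝ) ≤ M) {T : ℕ} :
    KernelLE (rankOne (shadowEst P (T := T))) fun S S' =>
      (2 * M / γ) ^ P.supp.card * meanKernel γ A S S' := by
  have := ((kernelLE_rankOne_roundEst hγ hP hA).sum_sum (α := Fin T)).mul_left
    (a := 1 / (T : ℝ) ^ 2) (by positivity)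
  refine (congrArg₂ KernelLE ?_ ?_).mp this
  · funext S S'
    simp only [rankOne, shadowEst, empMean, ← Finset.mul_sum, ← Finset.sum_mul]
    ring
  · funext S S'
    simp only [meanKernel, ← Finset.mul_sum]
    ring

theorem kernelLE_rankOne_multiset_prod (hγ : 0 < γ) {A : Finset G} {M : ℝ}
    (hA : (A.card : ℝ) ≤ M) {T : ℕ} (Q : Multiset (PauliString G)) (hQ : ∀ P ∈ Q, P.supp ⊆ A) :
    KernelLE (rankOne fun S : Shadow G T => (Q.map fun P => shadowEst P S).prod) fun S S' =>
      (2 * M / γ) ^ (Q.map fun P => P.supp.card).sum * meanKernel γ A S S' ^ Q.card := by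
  induction Q using Multiset.induction_on with
  | empty =>
    refine (congrArg IsPSDKernel ?_).mp isPSDKernel_zero
    funext S S'
    simp [rankOne]
  | cons P Q ih =>
    have h := (kernelLE_rankOne_shadowEst (T := T) hγ (hQ P (Multiset.mem_cons_self P Q)) hA).mul
      (ih fun P' hP' => hQ P' (Multiset.mem_cons_of_mem hP'))
      (isPSDKernel_rankOne _) (isPSDKernel_rankOne _)
    refine (congrArg₂ KernelLE ?_ ?_).mp h
    · funext S S'
      simp only [rankOne, Multiset.map_cons, Multiset.prod_cons]; ring
    · funext S S'
      simp only [Multiset.map_cons, Multiset.sum_cons, Multiset.card_cons]; ring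

/-- With `r = Q.card`, the `r`-th term of the exponential series of `τ * meanKernel` dominates the
power `meanKernel ^ r` up to the factor `r! / τ ^ r ≤ (q / τ) ^ r`. -/
theorem kernelLE_rankOne_multiset_prod_truncatedShadowKernel (hγ : 0 < γ) (hτ : 0 < τ)
    {A : Finset G} {M : ℝ} (hA : (A.card : ℝ) ≤ M) {T : ℕ} (Q : Multiset (PauliString G))
    (hQ : ∀ P ∈ Q, P.supp ⊆ A) {q : ℕ} (hq : Q.card ≤ q) :
    KernelLE (rankOne fun S : Shadow G T => (Q.map fun P => shadowEst P S).prod) fun S S' =>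
      ((q / τ) ^ Q.card * (2 * M / γ) ^ (Q.map fun P => P.supp.card).sum) *
        truncatedShadowKernel τ γ A S S' := by
  have hM : 0 ≤ M := le_trans (Nat.cast_nonneg _) hA
  have hmean := isPSDKernel_meanKernel (T := T) hγ.le A
  have h1 := kernelLE_rankOne_multiset_prod (T := T) hγ hA Q hQ
  have h2 := ((hmean.mul_left hτ.le).pow_le_exp Q.card).mul_left
    (a := (2 * M / γ) ^ (Q.map fun P => P.supp.card).sum * (Q.card.factorial / τ ^ Q.card))
    (by positivity)
  have h3 := ((hmean.mul_left hτ.le).exp).mul_left_mono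
    (a := (2 * M / γ) ^ (Q.map fun P => P.supp.card).sum * (Q.card.factorial / τ ^ Q.card))
    (b := (q / τ) ^ Q.card * (2 * M / γ) ^ (Q.map fun P => P.supp.card).sum) (by
      rw [mul_comm]
      gcongr
      rw [div_pow]
      gcongr
      have : (Q.card.factorial : ℝ) ≤ (Q.card : ℝ) ^ Q.card := by
        exact_mod_cast Nat.factorial_le_pow Q.card
      refine this.trans ?_
      gcongr)
  refine h1.trans (KernelLE.trans ?_ (h2.trans ?_))
  · refine (congrArg IsPSDKernel ?_).mp isPSDKernel_zero
    funext S S'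
    have : (Q.card.factorial : ℝ) ≠ 0 := by positivity
    beta_reduce
    rw [mul_pow]
    field_simp; ring
  · simpa only [truncatedShadowKernel_eq] using h3

/-- The extreme values `(1 ± 9) / 2` occur for equal axes; unequal axes give `1 / 2`. -/
theorem abs_trace_snapshot_le (w w' : Fin 3 × Bool) :
    |(snapshot w * snapshot w').trace.re| ≤ 5 := by
  rw [trace_snapshot_mul_snapshot, Fin.sum_univ_succ, Fin.sum_univ_three]
  obtain ⟨k, o⟩ := w
  obtain ⟨k', o'⟩ := w'
  fin_cases k <;> fin_cases k' <;> cases o <;> cases o' <;>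
    simp [pauliCoeff] <;> norm_num [abs_le]

theorem abs_roundKernel_le (hγ : 0 ≤ γ) (A : Finset G) (w w' : G → Fin 3 × Bool) :
    |roundKernel γ A w w'| ≤ Real.exp (5 * γ) := by
  rcases A.eq_empty_or_nonempty with rfl | hne
  · simp [roundKernel, hγ]
  have hcard : (0 : ℝ) < A.card := by exact_mod_cast Finset.card_pos.mpr hne
  rw [roundKernel, Finset.abs_prod]
  calc ∏ i ∈ A, |1 + γ / (A.card : ℝ) * (snapshot (w i) * snapshot (w' i)).trace.re|
      ≤ ∏ i ∈ A, Real.exp (5 * γ / A.card) := by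
        refine Finset.prod_le_prod (fun _ _ => abs_nonneg _) fun i _ => ?_
        have h1 := abs_trace_snapshot_le (w i) (w' i)
        have h2 : |γ / (A.card : ℝ) * (snapshot (w i) * snapshot (w' i)).trace.re| ≤
            γ / A.card * 5 := by
          rw [abs_mul, abs_of_nonneg (by positivity : 0 ≤ γ / (A.card : ℝ))]
          gcongr
        have h3 := Real.add_one_le_exp (5 * γ / A.card)
        have h4 : γ / A.card * 5 = 5 * γ / A.card := by ring
        refine (abs_add_le _ _).trans ?_
        rw [abs_one]
        linarith
    _ = Real.exp (5 * γ) := by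
        rw [Finset.prod_const, ← Real.exp_nat_mul]
        congr 1; field_simp

theorem truncatedShadowKernel_le (hγ : 0 ≤ γ) (hτ : 0 ≤ τ) (A : Finset G) {T : ℕ}
    (hT : 0 < T) (S S' : Shadow G T) :
    truncatedShadowKernel τ γ A S S' ≤ Real.exp (τ * Real.exp (5 * γ)) := by
  have hT' : (0 : ℝ) < T := by exact_mod_cast hT
  rw [truncatedShadowKernel_eq, meanKernel]
  gcongr
  rw [one_div, inv_mul_le_iff₀ (by positivity)]
  calc _ ≤ ∑ t : Fin T, ∑ t' : Fin T, Real.exp (5 * γ) := by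
        gcongr with t _ t' _
        exact (le_abs_self _).trans (abs_roundKernel_le hγ A _ _)
    _ = _ := by simp; ring

end ShadowKernel


/-! ### Constrained ridge regression in feature space: existence, growth, stability -/

section Ridge

variable {X : Type} {H : Type} [NormedAddCommGroup H] [InnerProductSpace ℝ H]
  {φ : X → H} {N : ℕ} {lam Bsq : ℝ}

/-- The regularized empirical loss of a linear predictor in feature space. -/
noncomputable def ridgeObj (φ : X → H) (lam : ℝ) (Z : Fin N → X × ℝ) (w : H) : ℝ :=
  1 / (N : ℝ) * ∑ i, ((Z i).2 - inner ℝ w (φ (Z i).1)) ^ 2 / 2 + lam * ‖w‖ ^ 2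

/-- `w` minimizes the regularized empirical loss over the ball of squared radius `Bsq`. -/
def IsRidgeMin (φ : X → H) (lam Bsq : ℝ) (Z : Fin N → X × ℝ) (w : H) : Prop :=
  ‖w‖ ^ 2 ≤ Bsq ∧ ∀ u : H, ‖u‖ ^ 2 ≤ Bsq → ridgeObj φ lam Z w ≤ ridgeObj φ lam Z u

/-- The weight vector in feature space belonging to the coefficients `α`. -/
noncomputable def featureComb (φ : X → H) (Z : Fin N → X × ℝ) : (Fin N → ℝ) →ₗ[ℝ] H :=
  Fintype.linearCombination ℝ fun j => φ (Z j).1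

theorem featureComb_apply (Z : Fin N → X × ℝ) (α : Fin N → ℝ) :
    featureComb φ Z α = ∑ j, α j • φ (Z j).1 := rfl

theorem kernelModel_eq {k : X → X → ℝ} (hφ : ∀ x y, k x y = inner ℝ (φ x) (φ y))
    (Z : Fin N → X × ℝ) (α : Fin N → ℝ) (x : X) :
    kernelModel k Z α x = inner ℝ (featureComb φ Z α) (φ x) := by
  simp only [kernelModel, featureComb_apply, sum_inner, real_inner_smul_left, hφ]

theorem weightNormSq_eq {k : X → X → ℝ} (hφ : ∀ x y, k x y = inner ℝ (φ x) (φ y))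
    (Z : Fin N → X × ℝ) (α : Fin N → ℝ) :
    weightNormSq k Z α = ‖featureComb φ Z α‖ ^ 2 := by
  rw [← real_inner_self_eq_norm_sq, featureComb_apply, sum_inner]
  simp only [inner_sum, real_inner_smul_left, real_inner_smul_right, weightNormSq, hφ]
  exact Finset.sum_congr rfl fun i _ => Finset.sum_congr rfl fun j _ => by ring

theorem regLoss_eq {k : X → X → ℝ} (hφ : ∀ x y, k x y = inner ℝ (φ x) (φ y))
    (Z : Fin N → X × ℝ) (α : Fin N → ℝ) :
    regLoss k lam Z α = ridgeObj φ lam Z (featureComb φ Z α) := by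
  simp only [regLoss, ridgeObj, kernelModel_eq hφ, weightNormSq_eq hφ]

/-- The kernel matrix may be singular, and then the admissible coefficients form an unbounded set.
Compactness is therefore used for the weight vectors in the span of the features. -/
theorem exists_isKRRSolution [FiniteDimensional ℝ H] {k : X → X → ℝ}
    (hφ : ∀ x y, k x y = inner ℝ (φ x) (φ y)) (hB : 0 ≤ Bsq) (Z : Fin N → X × ℝ) :
    ∃ α : Fin N → ℝ, IsKRRSolution k lam Bsq Z α := by
  set V := LinearMap.range (featureComb φ Z)
  have hc : IsCompact ((V : Set H) ∩ {w | ‖w‖ ^ 2 ≤ Bsq}) := by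
    refine IsCompact.of_isClosed_subset (isCompact_closedBall (0 : H) (Real.sqrt Bsq)) ?_ ?_
    · exact V.closed_of_finiteDimensional.inter
        (isClosed_le (by fun_prop) continuous_const)
    · rintro w ⟨-, hw⟩
      rw [mem_closedBall_zero_iff]
      exact Real.le_sqrt_of_sq_le hw
  obtain ⟨w, ⟨⟨α, rfl⟩, hw⟩, hmin⟩ := hc.exists_isMinOn ⟨0, V.zero_mem, by simpa using hB⟩
    (f := ridgeObj φ lam Z) (by unfold ridgeObj; fun_prop)
  refine ⟨α, by rw [weightNormSq_eq hφ]; exact hw, fun β hβ => ?_⟩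
  rw [regLoss_eq hφ, regLoss_eq hφ]
  rw [weightNormSq_eq hφ] at hβ
  exact hmin ⟨⟨β, rfl⟩, hβ⟩

/-- Representer theorem: projecting a competitor onto the span of the training features preserves
its predictions on the data and does not increase its norm. -/
theorem IsKRRSolution.isRidgeMin [FiniteDimensional ℝ H] {k : X → X → ℝ}
    (hφ : ∀ x y, k x y = inner ℝ (φ x) (φ y)) (hlam : 0 ≤ lam) {Z : Fin N → X × ℝ}
    {α : Fin N → ℝ} (h : IsKRRSolution k lam Bsq Z α) :
    IsRidgeMin φ lam Bsq Z (featureComb φ Z α) := by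
  refine ⟨by rw [← weightNormSq_eq hφ]; exact h.1, fun u hu => ?_⟩
  set V := LinearMap.range (featureComb φ Z)
  obtain ⟨β, hβ⟩ := (V.orthogonalProjectionOnto u).2
  have hin : ∀ i, inner ℝ (featureComb φ Z β) (φ (Z i).1) = inner ℝ u (φ (Z i).1) := fun i => by
    rw [hβ]
    exact Submodule.inner_orthogonalProjectionOnto_eq_of_mem_right
      (⟨φ (Z i).1, Pi.single i 1, by simp [featureComb]⟩ : V) u
  have hnorm : ‖featureComb φ Z β‖ ≤ ‖u‖ := by
    rw [hβ]; exact V.norm_orthogonalProjectionOnto_apply_le u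
  have hsq : ‖featureComb φ Z β‖ ^ 2 ≤ ‖u‖ ^ 2 := by gcongr
  have h2 := h.2 β (by rw [weightNormSq_eq hφ]; exact hsq.trans hu)
  rw [regLoss_eq hφ, regLoss_eq hφ] at h2
  refine h2.trans ?_
  simp only [ridgeObj, hin]
  gcongr

theorem ridgeObj_add_smul (Z : Fin N → X × ℝ) (w d : H) (t : ℝ) :
    ridgeObj φ lam Z (w + t • d) = ridgeObj φ lam Z w +
      t * (1 / (N : ℝ) * ∑ i, -(((Z i).2 - inner ℝ w (φ (Z i).1)) * inner ℝ d (φ (Z i).1)) +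
        2 * lam * inner ℝ w d) +
      t ^ 2 * (1 / (N : ℝ) * ∑ i, inner ℝ d (φ (Z i).1) ^ 2 / 2 + lam * ‖d‖ ^ 2) := by
  have h1 : ‖w + t • d‖ ^ 2 = ‖w‖ ^ 2 + 2 * t * inner ℝ w d + t ^ 2 * ‖d‖ ^ 2 := by
    rw [norm_add_sq_real, real_inner_smul_right, norm_smul, mul_pow, Real.norm_eq_abs, sq_abs]
    ring
  have h2 : ∑ i, ((Z i).2 - inner ℝ (w + t • d) (φ (Z i).1)) ^ 2 / 2 =
      ∑ i, ((Z i).2 - inner ℝ w (φ (Z i).1)) ^ 2 / 2 +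
      t * ∑ i, -(((Z i).2 - inner ℝ w (φ (Z i).1)) * inner ℝ d (φ (Z i).1)) +
      t ^ 2 * ∑ i, inner ℝ d (φ (Z i).1) ^ 2 / 2 := by
    rw [Finset.mul_sum, Finset.mul_sum, ← Finset.sum_add_distrib, ← Finset.sum_add_distrib]
    refine Finset.sum_congr rfl fun i _ => ?_
    rw [inner_add_left, real_inner_smul_left]; ring
  rw [ridgeObj, ridgeObj, h1, h2]; ring

/-- Quadratic growth of the regularized empirical loss at its minimizer. -/
theorem IsRidgeMin.growth {Z : Fin N → X × ℝ} {w : H} (hw : IsRidgeMin φ lam Bsq Z w) {u : H}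
    (hu : ‖u‖ ^ 2 ≤ Bsq) :
    ridgeObj φ lam Z w + (1 / (N : ℝ) * ∑ i, inner ℝ (u - w) (φ (Z i).1) ^ 2 / 2 +
      lam * ‖u - w‖ ^ 2) ≤ ridgeObj φ lam Z u := by
  have hexp := ridgeObj_add_smul (φ := φ) (lam := lam) Z w (u - w)
  set a := 1 / (N : ℝ) * ∑ i, -(((Z i).2 - inner ℝ w (φ (Z i).1)) *
    inner ℝ (u - w) (φ (Z i).1)) + 2 * lam * inner ℝ w (u - w)
  set b := 1 / (N : ℝ) * ∑ i, inner ℝ (u - w) (φ (Z i).1) ^ 2 / 2 + lam * ‖u - w‖ ^ 2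
  have hB : 0 ≤ Bsq := (sq_nonneg _).trans hu
  -- Minimality along the segment to `u`, which stays in the ball by convexity; `a` is the
  -- directional derivative.
  have hball : ∀ t : ℝ, 0 < t → t ≤ 1 → 0 ≤ a + t * b := by
    intro t ht ht1
    have hmem : ‖w + t • (u - w)‖ ^ 2 ≤ Bsq := by
      have hw' : ‖w‖ ≤ Real.sqrt Bsq := Real.le_sqrt_of_sq_le hw.1
      have hu' : ‖u‖ ≤ Real.sqrt Bsq := Real.le_sqrt_of_sq_le hu
      have h1 : w + t • (u - w) = (1 - t) • w + t • u := by
        rw [smul_sub, sub_smul, one_smul]; abel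
      have h2 : ‖w + t • (u - w)‖ ≤ Real.sqrt Bsq := by
        rw [h1]
        refine (norm_add_le _ _).trans ?_
        rw [norm_smul, norm_smul, Real.norm_eq_abs, Real.norm_eq_abs, abs_of_pos ht,
          abs_of_nonneg (by linarith : 0 ≤ 1 - t)]
        nlinarith
      rw [← Real.sq_sqrt hB]
      gcongr
    have h3 := hw.2 _ hmem
    rw [hexp t] at h3
    have h4 : 0 ≤ t * (a + t * b) := by nlinarith
    exact nonneg_of_mul_nonneg_right h4 ht
  have ha : 0 ≤ a := by
    by_contra hneg
    push Not at hneg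
    -- If `a < 0`, the step size `min 1 (-a / (2 * b))` gives `a + t * b ≤ a / 2 < 0`.
    have hb : 0 < b := by linarith [hball 1 one_pos le_rfl]
    have h1 := hball (min 1 (-a / (2 * b))) (lt_min one_pos (by apply div_pos <;> linarith))
      (min_le_left _ _)
    have h2 : min 1 (-a / (2 * b)) * b ≤ -a / (2 * b) * b := by gcongr; exact min_le_right _ _
    have h3 : -a / (2 * b) * b = -a / 2 := by field_simp
    linarith
  have h1 := hexp 1
  rw [one_smul, add_sub_cancel] at h1
  rw [h1]; linarith

/-- Adding the two growth inequalities leaves only a term linear in the label difference. Besides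
uniqueness this gives Lipschitz dependence on the labels, which is what measurability of the learned
weight rests on. -/
theorem IsRidgeMin.norm_sub_le {κ : ℝ} (hlam : 0 < lam) (hN : 0 < N)
    (hκ : ∀ x, ‖φ x‖ ^ 2 ≤ κ) {x : Fin N → X} {y y' : Fin N → ℝ} {w w' : H}
    (hw : IsRidgeMin φ lam Bsq (fun i => (x i, y i)) w)
    (hw' : IsRidgeMin φ lam Bsq (fun i => (x i, y' i)) w') :
    ‖w' - w‖ ≤ Real.sqrt κ / (2 * lam) * ‖y' - y‖ := by
  have hN' : (0 : ℝ) < N := by exact_mod_cast hN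
  have h1 := hw.growth hw'.1
  have h2 := hw'.growth hw.1
  have p1 : 0 ≤ 1 / (N : ℝ) * ∑ i, inner ℝ (w' - w) (φ (x i)) ^ 2 / 2 := by positivity
  have p2 : 0 ≤ 1 / (N : ℝ) * ∑ i, inner ℝ (w - w') (φ (x i)) ^ 2 / 2 := by positivity
  rw [norm_sub_rev w w'] at h2
  have key : ridgeObj φ lam (fun i => (x i, y i)) w' - ridgeObj φ lam (fun i => (x i, y i)) w +
      (ridgeObj φ lam (fun i => (x i, y' i)) w - ridgeObj φ lam (fun i => (x i, y' i)) w') =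
      1 / (N : ℝ) * ∑ i, (y' i - y i) * inner ℝ (w' - w) (φ (x i)) := by
    have : ∀ i, (y' i - y i) * inner ℝ (w' - w) (φ (x i)) =
        (y i - inner ℝ w' (φ (x i))) ^ 2 / 2 - (y i - inner ℝ w (φ (x i))) ^ 2 / 2 +
        ((y' i - inner ℝ w (φ (x i))) ^ 2 / 2 - (y' i - inner ℝ w' (φ (x i))) ^ 2 / 2) := by
      intro i; rw [inner_sub_left]; ring
    simp only [this, Finset.sum_add_distrib, Finset.sum_sub_distrib, ridgeObj]; ring
  have bound : 1 / (N : ℝ) * ∑ i, (y' i - y i) * inner ℝ (w' - w) (φ (x i)) ≤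
      ‖y' - y‖ * (‖w' - w‖ * Real.sqrt κ) := by
    rw [one_div, inv_mul_le_iff₀ hN']
    calc _ ≤ ∑ i : Fin N, ‖y' - y‖ * (‖w' - w‖ * Real.sqrt κ) := by
          refine Finset.sum_le_sum fun i _ => ?_
          refine (le_abs_self _).trans ?_
          rw [abs_mul]
          have e1 : |y' i - y i| ≤ ‖y' - y‖ := norm_le_pi_norm (y' - y) i
          have e2 : |inner ℝ (w' - w) (φ (x i))| ≤ ‖w' - w‖ * Real.sqrt κ := by
            refine (abs_real_inner_le_norm _ _).trans ?_
            gcongr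
            exact Real.le_sqrt_of_sq_le (hκ _)
          gcongr
      _ = _ := by simp
  have h3 : 2 * lam * ‖w' - w‖ ^ 2 ≤ ‖y' - y‖ * (‖w' - w‖ * Real.sqrt κ) := by linarith
  rcases eq_or_lt_of_le (norm_nonneg (w' - w)) with h0 | h0
  · rw [← h0]; positivity
  · have h4 : 2 * lam * ‖w' - w‖ ≤ ‖y' - y‖ * Real.sqrt κ := by
      refine le_of_mul_le_mul_right ?_ h0
      nlinarith
    rw [div_mul_eq_mul_div, le_div_iff₀ (by positivity)]
    linarith

/-- Here `r`, `s` are training residuals, `a`, `b` the changes of prediction and `Δ` the change of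
weight. The hypothesis `hsum` forces `c * Δ ≤ q * (|r| + |s|)`, so the change is controlled by the
training losses themselves and no bound on the labels is needed. -/
theorem exchange_bound {r s a b c Δ κ lam N : ℝ} (hlam : 0 < lam) (hN : 0 < N) (hΔ0 : 0 ≤ Δ)
    (hc0 : 0 ≤ c) (hc2 : c ^ 2 = κ) (ha : |a| ≤ c * Δ) (hb : |b| ≤ c * Δ)
    (hsum : 2 * lam * Δ ^ 2 * N ≤ -(r * a) + s * b) :
    (r - a) ^ 2 / 2 + (s + b) ^ 2 / 2 ≤
      (1 + 4 * (κ / (2 * lam * N) + (κ / (2 * lam * N)) ^ 2)) * (r ^ 2 / 2 + s ^ 2 / 2) := by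
  have hκ0 : 0 ≤ κ := hc2 ▸ sq_nonneg c
  obtain ⟨R, hR⟩ : ∃ R, R = |r| + |s| := ⟨_, rfl⟩
  have hR0 : 0 ≤ R := by rw [hR]; positivity
  have hcross : -(r * a) + s * b ≤ R * (c * Δ) := by
    have e1 : -(r * a) ≤ |r| * (c * Δ) := by
      refine (neg_le_abs _).trans ?_
      rw [abs_mul]; gcongr
    have e2 : s * b ≤ |s| * (c * Δ) := by
      refine (le_abs_self _).trans ?_
      rw [abs_mul]; gcongr
    rw [hR, add_mul]; linarith
  obtain ⟨q, hq⟩ : ∃ q, q = κ / (2 * lam * N) := ⟨_, rfl⟩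
  rw [← hq]
  have hden : 0 < 2 * lam * N := by positivity
  have hq0 : 0 ≤ q := by rw [hq]; positivity
  have hcΔ : c * Δ ≤ q * R := by
    rcases eq_or_lt_of_le hΔ0 with h0 | h0
    · rw [← h0, mul_zero]; positivity
    · have h3 := hsum.trans hcross
      have h4 : 2 * lam * N * Δ ≤ R * c := by
        refine le_of_mul_le_mul_right ?_ h0
        linarith
      have h5 := mul_le_mul_of_nonneg_left h4 hc0
      rw [hq, div_mul_eq_mul_div, le_div_iff₀ hden, ← hc2]
      linarith
  have hcΔ0 : 0 ≤ c * Δ := by positivity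
  have ha2 : a ^ 2 ≤ (q * R) ^ 2 := by
    rw [← sq_abs a]; gcongr; exact ha.trans hcΔ
  have hb2 : b ^ 2 ≤ (q * R) ^ 2 := by
    rw [← sq_abs b]; gcongr; exact hb.trans hcΔ
  have hR2 : R ^ 2 ≤ 2 * (r ^ 2 + s ^ 2) := by
    rw [hR, ← sq_abs r, ← sq_abs s]; nlinarith [sq_nonneg (|r| - |s|)]
  
  have h5 : -(r * a) + s * b ≤ q * R ^ 2 := by
    refine hcross.trans ?_
    calc R * (c * Δ) ≤ R * (q * R) := by gcongr
      _ = _ := by ring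
  have h6 : (q + q ^ 2) * R ^ 2 ≤ (q + q ^ 2) * (2 * (r ^ 2 + s ^ 2)) := by gcongr
  linarith

/-- Exchanging one sample: the losses on the exchanged samples are controlled by the training
losses. -/
theorem IsRidgeMin.exchange {κ : ℝ} (hlam : 0 < lam) (hN : 0 < N)
    (hκ : ∀ x, ‖φ x‖ ^ 2 ≤ κ) {Z : Fin N → X × ℝ} {i : Fin N} {z' : X × ℝ} {w w' : H}
    (hw : IsRidgeMin φ lam Bsq Z w) (hw' : IsRidgeMin φ lam Bsq (Function.update Z i z') w') :
    ((Z i).2 - inner ℝ w' (φ (Z i).1)) ^ 2 / 2 + (z'.2 - inner ℝ w (φ z'.1)) ^ 2 / 2 ≤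
      (1 + 4 * (κ / (2 * lam * N) + (κ / (2 * lam * N)) ^ 2)) *
        (((Z i).2 - inner ℝ w (φ (Z i).1)) ^ 2 / 2 + (z'.2 - inner ℝ w' (φ z'.1)) ^ 2 / 2) := by
  have hN' : (0 : ℝ) < N := by exact_mod_cast hN
  have hκ0 : 0 ≤ κ := (sq_nonneg _).trans (hκ z'.1)
  have h1 := hw.growth hw'.1
  have h2 := hw'.growth hw.1
  have s1 : ∀ F : X × ℝ → ℝ, ∑ j, F (Z j) = F (Z i) + ∑ j ∈ Finset.univ.erase i, F (Z j) :=
    fun F => (Finset.add_sum_erase _ (fun j => F (Z j)) (Finset.mem_univ i)).symm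
  have s2 : ∀ F : X × ℝ → ℝ, ∑ j, F (Function.update Z i z' j) =
      F z' + ∑ j ∈ Finset.univ.erase i, F (Z j) := fun F => by
    rw [← Finset.add_sum_erase _ (fun j => F (Function.update Z i z' j)) (Finset.mem_univ i),
      Function.update_self]
    congr 1
    refine Finset.sum_congr rfl fun j hj => ?_
    rw [Function.update_of_ne (Finset.ne_of_mem_erase hj)]
  unfold ridgeObj at h1 h2
  rw [s1 fun z => (z.2 - inner ℝ w (φ z.1)) ^ 2 / 2,
    s1 fun z => (z.2 - inner ℝ w' (φ z.1)) ^ 2 / 2,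
    s1 fun z => inner ℝ (w' - w) (φ z.1) ^ 2 / 2] at h1
  rw [s2 fun z => (z.2 - inner ℝ w (φ z.1)) ^ 2 / 2,
    s2 fun z => (z.2 - inner ℝ w' (φ z.1)) ^ 2 / 2,
    s2 fun z => inner ℝ (w - w') (φ z.1) ^ 2 / 2, norm_sub_rev w w'] at h2
  have p1 : 0 ≤ ∑ j ∈ Finset.univ.erase i, inner ℝ (w' - w) (φ (Z j).1) ^ 2 / 2 :=
    Finset.sum_nonneg fun _ _ => by positivity
  have p2 : 0 ≤ ∑ j ∈ Finset.univ.erase i, inner ℝ (w - w') (φ (Z j).1) ^ 2 / 2 :=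
    Finset.sum_nonneg fun _ _ => by positivity
  set A1 := ∑ j ∈ Finset.univ.erase i, ((Z j).2 - inner ℝ w (φ (Z j).1)) ^ 2 / 2
  set A2 := ∑ j ∈ Finset.univ.erase i, ((Z j).2 - inner ℝ w' (φ (Z j).1)) ^ 2 / 2
  set p := ∑ j ∈ Finset.univ.erase i, inner ℝ (w' - w) (φ (Z j).1) ^ 2 / 2
  set p' := ∑ j ∈ Finset.univ.erase i, inner ℝ (w - w') (φ (Z j).1) ^ 2 / 2
  set Δ := ‖w' - w‖ with hΔ
  have hΔ0 : 0 ≤ Δ := norm_nonneg _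
  set r := (Z i).2 - inner ℝ w (φ (Z i).1) with hr
  set s := z'.2 - inner ℝ w' (φ z'.1) with hs
  set a := inner ℝ (w' - w) (φ (Z i).1) with ha
  set b := inner ℝ (w' - w) (φ z'.1) with hb
  have eb : inner ℝ (w - w') (φ z'.1) = -b := by rw [hb, ← neg_sub w' w, inner_neg_left]
  have er : (Z i).2 - inner ℝ w' (φ (Z i).1) = r - a := by rw [hr, ha, inner_sub_left]; ring
  have es : z'.2 - inner ℝ w (φ z'.1) = s + b := by rw [hs, hb, inner_sub_left]; ring
  rw [er] at h1 ⊢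
  rw [es] at h2 ⊢
  rw [eb] at h2
  have ha' : |a| ≤ Real.sqrt κ * Δ := by
    rw [mul_comm]
    refine (abs_real_inner_le_norm _ _).trans ?_
    gcongr
    exact Real.le_sqrt_of_sq_le (hκ _)
  have hb' : |b| ≤ Real.sqrt κ * Δ := by
    rw [mul_comm]
    refine (abs_real_inner_le_norm _ _).trans ?_
    gcongr
    exact Real.le_sqrt_of_sq_le (hκ _)
  -- In the sum of both growth inequalities the losses on the common samples cancel, as do the
  -- regularizers.
  have hsum : 2 * lam * Δ ^ 2 * N ≤ -(r * a) + s * b := by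
    have e : (1 / (N : ℝ)) * (-(r * a) + s * b - p - p') =
      (1 / (N : ℝ) * ((r - a) ^ 2 / 2 + A2) - 1 / (N : ℝ) * (r ^ 2 / 2 + A1)
        - 1 / (N : ℝ) * (a ^ 2 / 2 + p)) + (1 / (N : ℝ) * ((s + b) ^ 2 / 2 + A1)
        - 1 / (N : ℝ) * (s ^ 2 / 2 + A2) - 1 / (N : ℝ) * ((-b) ^ 2 / 2 + p')) := by ring
    have h3 : 2 * lam * Δ ^ 2 ≤ (1 / (N : ℝ)) * (-(r * a) + s * b - p - p') := by
      rw [e]; linarith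
    have h4 : 1 / (N : ℝ) * (-(r * a) + s * b - p - p') * N = -(r * a) + s * b - p - p' := by
      field_simp
    have h5 := mul_le_mul_of_nonneg_right h3 hN'.le
    rw [h4] at h5
    linarith
  exact exchange_bound hlam hN' hΔ0 (Real.sqrt_nonneg _) (Real.sq_sqrt hκ0) ha' hb' hsum

end Ridge

/-! ### Feature maps, and dominated functions as linear functionals -/

section Representation

variable {X : Type} [Fintype X]

/-- On a finite set the kernel is one matrix `Bᴴ * B`, and the columns of `B` are the features. -/
theorem IsPSDKernel.exists_feature {k : X → X → ℝ} (hk : IsPSDKernel k) :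
    ∃ φ : X → EuclideanSpace ℝ X, ∀ x y, k x y = inner ℝ (φ x) (φ y) := by
  classical
  obtain ⟨B, hB⟩ : ∃ B : Matrix X X ℝ, (Matrix.of k) = B.conjTranspose * B := by
    have h := hk.posSemidef (id : X → X)
    open scoped MatrixOrder in
    obtain ⟨B, hB⟩ := CStarAlgebra.nonneg_iff_eq_star_mul_self.mp h.nonneg
    exact ⟨B, hB⟩
  refine ⟨fun x => WithLp.toLp 2 fun z => B z x, fun x y => ?_⟩
  have := congrFun (congrFun hB x) y
  rw [Matrix.of_apply] at this
  rw [this, Matrix.mul_apply, PiLp.inner_apply]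
  refine Finset.sum_congr rfl fun z _ => ?_
  simp [mul_comm]

/-- A function whose rank-one kernel is dominated by `Bsq * k` is a linear functional of squared
norm at most `Bsq` in feature space. -/
theorem KernelLE.exists_weight {H : Type} [NormedAddCommGroup H] [InnerProductSpace ℝ H]
    [FiniteDimensional ℝ H] {φ : X → H} {k : X → X → ℝ}
    (hφ : ∀ x y, k x y = inner ℝ (φ x) (φ y)) {f : X → ℝ} {Bsq : ℝ}
    (hB : 0 ≤ Bsq) (hf : KernelLE (rankOne f) fun x y => Bsq * k x y) :
    ∃ u : H, ‖u‖ ^ 2 ≤ Bsq ∧ ∀ x, f x = inner ℝ u (φ x) := by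
  classical
  set Φ : (X → ℝ) →ₗ[ℝ] H := Fintype.linearCombination ℝ φ with hΦ
  set F : (X → ℝ) →ₗ[ℝ] ℝ := Fintype.linearCombination ℝ f with hF
  have hbound : ∀ c, F c ^ 2 ≤ Bsq * ‖Φ c‖ ^ 2 := by
    intro c
    have := hf.2 X id c
    rw [kernelForm_sub, sub_nonneg, kernelForm_rankOne, kernelForm_mul_left] at this
    have e : kernelForm k id c = ‖Φ c‖ ^ 2 := by
      rw [← real_inner_self_eq_norm_sq, hΦ, Fintype.linearCombination_apply, sum_inner]
      simp only [inner_sum, real_inner_smul_left, real_inner_smul_right, kernelForm, hφ, id]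
      exact Finset.sum_congr rfl fun i _ => Finset.sum_congr rfl fun j _ => by ring
    rw [e] at this
    simpa [hF, Fintype.linearCombination_apply] using this
  -- By `hbound`, `F` vanishes where `Φ` does, hence factors through `Φ` as some functional `g`.
  have hker : F ∈ (LinearMap.ker Φ).dualAnnihilator := by
    rw [Submodule.mem_dualAnnihilator]
    intro c hc
    have := hbound c
    rw [LinearMap.mem_ker.mp hc, norm_zero] at this
    nlinarith [sq_nonneg (F c)]
  rw [← LinearMap.range_dualMap_eq_dualAnnihilator_ker] at hker
  obtain ⟨g, hg⟩ := hker
  set u₀ : H := (InnerProductSpace.toDual ℝ H).symm (LinearMap.toContinuousLinearMap g)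
  have hu₀ : ∀ v, inner ℝ u₀ v = g v := fun v => InnerProductSpace.toDual_symm_apply
  set V := LinearMap.range Φ
  obtain ⟨c, hc⟩ := (V.orthogonalProjectionOnto u₀).2
  have hin : ∀ b, inner ℝ (Φ c) (Φ b) = F b := fun b => by
    have h1 : inner ℝ (Φ c) (Φ b) = inner ℝ u₀ (Φ b) := by
      rw [hc]
      exact Submodule.inner_orthogonalProjectionOnto_eq_of_mem_right (⟨Φ b, b, rfl⟩ : V) u₀
    rw [h1, hu₀, ← hg]
    rfl
  refine ⟨Φ c, ?_, fun x => ?_⟩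
  · have h1 := hbound c
    rw [← hin c, real_inner_self_eq_norm_sq] at h1
    -- `hbound` at `c` itself reads `‖Φ c‖ ^ 4 ≤ Bsq * ‖Φ c‖ ^ 2`; one factor is cancelled.
    rcases eq_or_lt_of_le (sq_nonneg ‖Φ c‖) with h0 | h0
    · rwa [← h0]
    · nlinarith
  · have := hin (Pi.single x 1)
    simpa [hΦ, hF] using this.symm

end Representation


/-! ### Exchangeability of i.i.d. samples -/

section Exchange

theorem measurable_update_exchange {Ω : Type} [MeasurableSpace Ω] {N : ℕ} (i : Fin N) :
    Measurable fun p : (Fin N → Ω) × Ω => (Function.update p.1 i p.2, p.1 i) := by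
  refine Measurable.prodMk (measurable_pi_iff.mpr fun j => ?_) (by fun_prop)
  by_cases hj : j = i
  · subst hj; simpa using measurable_snd
  · simp only [Function.update_of_ne hj]
    fun_prop

/-- A fresh sample and one of the samples of an i.i.d. tuple can be exchanged. -/
theorem lintegral_update_exchange {Ω : Type} [MeasurableSpace Ω] (P : Measure Ω)
    [IsProbabilityMeasure P] {N : ℕ} (i : Fin N) {F : (Fin N → Ω) × Ω → ℝ≥0∞}
    (hF : Measurable F) :
    ∫⁻ Z, ∫⁻ z, F (Function.update Z i z, Z i) ∂P ∂(Measure.pi fun _ : Fin N => P) =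
      ∫⁻ Z, ∫⁻ z, F (Z, z) ∂P ∂(Measure.pi fun _ : Fin N => P) := by
  set μ := Measure.pi fun _ : Fin N => P with hμ
  set μ' := Measure.pi fun _ : Fin (N + 1) => P with hμ'
  have hupd := measurable_update_exchange (Ω := Ω) i
  -- The data and the fresh sample form one i.i.d. tuple of length `N + 1`, with the fresh sample in
  -- position `0`. The claim is then invariance under the transposition of `0` and `i.succ`.
  have key : ∀ K : (Fin N → Ω) × Ω → ℝ≥0∞, Measurable K →
      ∫⁻ Z, ∫⁻ z, K (Z, z) ∂P ∂μ = ∫⁻ W, K (fun j => W j.succ, W 0) ∂μ' := by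
    intro K hK
    have hp := measurePreserving_piFinSuccAbove (fun _ : Fin (N + 1) => P) 0
    have hK' : Measurable fun q : Ω × (Fin N → Ω) => K (q.2, q.1) :=
      hK.comp measurable_swap
    have h1 := hp.lintegral_comp hK'
    rw [lintegral_prod_symm' _ hK'] at h1
    refine h1.symm.trans (lintegral_congr fun W => ?_)
    rfl
  rw [key (fun p => F (Function.update p.1 i p.2, p.1 i)) (hF.comp hupd), key F hF]
  have hs := measurePreserving_arrowCongr' (fun _ : Fin (N + 1) => P)
    (fun _ : Fin (N + 1) => P) (Equiv.swap 0 i.succ) (MeasurableEquiv.refl Ω)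
    (fun _ => MeasurePreserving.id P)
  have hF' : Measurable fun W : Fin (N + 1) → Ω => F (fun j => W j.succ, W 0) := by
    refine hF.comp (Measurable.prodMk ?_ (measurable_pi_apply 0))
    exact measurable_pi_iff.mpr fun j => measurable_pi_apply _
  rw [← hs.lintegral_comp hF']
  refine lintegral_congr fun W => ?_
  have e : ∀ j, (MeasurableEquiv.arrowCongr' (Equiv.swap 0 i.succ) (MeasurableEquiv.refl Ω)) W j =
      W (Equiv.swap 0 i.succ j) := fun j => by
    change W ((Equiv.swap 0 i.succ).symm j) = _
    rw [Equiv.symm_swap]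
  simp only [e, Equiv.swap_apply_left]
  congr 2
  funext j
  by_cases hj : j = i
  · subst hj; simp
  · rw [Function.update_of_ne hj, Equiv.swap_apply_of_ne_of_ne (Fin.succ_ne_zero j)
      (fun h => hj (Fin.succ_injective _ h))]

end Exchange

/-! ### Oracle inequality for ridge regression in feature space -/

section Risk

variable {X : Type} [Finite X] [MeasurableSpace X] [MeasurableSingletonClass X]
  {H : Type} [NormedAddCommGroup H] [InnerProductSpace ℝ H] [MeasurableSpace H] [BorelSpace H]
  [SecondCountableTopology H]
  {φ : X → H} {N : ℕ} {lam Bsq κ : ℝ}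

/-- For fixed inputs the minimizer is Lipschitz in the labels, and there are finitely many inputs.
Coefficient vectors need not depend measurably on the data, but their feature-space weights do. -/
theorem measurable_of_isRidgeMin (hlam : 0 < lam) (hN : 0 < N) (hκ : ∀ x, ‖φ x‖ ^ 2 ≤ κ)
    {W : (Fin N → X × ℝ) → H} (hW : ∀ Z, IsRidgeMin φ lam Bsq Z (W Z)) : Measurable W := by
  have hg : Measurable fun q : (Fin N → X) × (Fin N → ℝ) => W fun i => (q.1 i, q.2 i) := by
    refine measurable_from_prod_countable_right fun x => ?_
    refine (LipschitzWith.of_dist_le_mul (K := (Real.sqrt κ / (2 * lam)).toNNReal)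
      fun y y' => ?_).continuous.measurable
    rw [dist_eq_norm, dist_eq_norm, Real.coe_toNNReal _ (by positivity)]
    exact (hW fun i => (x i, y' i)).norm_sub_le hlam hN hκ (hW fun i => (x i, y i))
  have hsplit : Measurable fun Z : Fin N → X × ℝ => (fun i => (Z i).1, fun i => (Z i).2) :=
    Measurable.prodMk (by fun_prop) (by fun_prop)
  exact hg.comp hsplit

theorem measurable_sq_loss {W : (Fin N → X × ℝ) → H} (hW : Measurable W) :
    Measurable fun q : (Fin N → X × ℝ) × (X × ℝ) =>
      ENNReal.ofReal ((q.2.2 - inner ℝ (W q.1) (φ q.2.1)) ^ 2 / 2) := by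
  have hφ : Measurable φ := measurable_of_finite φ
  refine Measurable.ennreal_ofReal (Measurable.div_const (Measurable.pow_const
    (Measurable.sub (by fun_prop) (Measurable.inner (hW.comp measurable_fst)
      (hφ.comp (by fun_prop)))) 2) 2)

/-- Expected risk of constrained ridge regression in feature space. -/
theorem lintegral_expectedLoss_isRidgeMin_le (P : Measure (X × ℝ)) [IsProbabilityMeasure P]
    (hlam : 0 < lam) (hN : 0 < N) (hκ0 : 0 ≤ κ) (hκ : ∀ x, ‖φ x‖ ^ 2 ≤ κ)
    {W : (Fin N → X × ℝ) → H} (hW : ∀ Z, IsRidgeMin φ lam Bsq Z (W Z)) {u : H}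
    (hu : ‖u‖ ^ 2 ≤ Bsq) :
    ∫⁻ Z, expectedLoss P (fun x => inner ℝ (W Z) (φ x)) ∂(Measure.pi fun _ : Fin N => P) ≤
      ENNReal.ofReal (1 + 4 * (κ / (2 * lam * N) + (κ / (2 * lam * N)) ^ 2)) *
        (expectedLoss P (fun x => inner ℝ u (φ x)) + ENNReal.ofReal (lam * Bsq)) := by
  set C := 1 + 4 * (κ / (2 * lam * N) + (κ / (2 * lam * N)) ^ 2) with hC
  have hC0 : 0 ≤ C := by positivity
  have hWm := measurable_of_isRidgeMin hlam hN hκ hW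
  set μ := Measure.pi fun _ : Fin N => P with hμ
  set G : (Fin N → X × ℝ) × (X × ℝ) → ℝ≥0∞ := fun q =>
    ENNReal.ofReal ((q.2.2 - inner ℝ (W q.1) (φ q.2.1)) ^ 2 / 2) with hG
  have hGm : Measurable G := measurable_sq_loss hWm
  have hA : ∫⁻ Z, expectedLoss P (fun x => inner ℝ (W Z) (φ x)) ∂μ = ∫⁻ Z, ∫⁻ z, G (Z, z) ∂P ∂μ :=
    rfl
  rw [hA]
  set A := ∫⁻ Z, ∫⁻ z, G (Z, z) ∂P ∂μ with hAdef
  have hGi : ∀ i, Measurable fun Z => G (Z, Z i) := fun i =>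
    hGm.comp (measurable_id.prodMk (measurable_pi_apply i))
  -- Averaging the exchange inequality: both losses on its left are out of sample with mean `A`, and
  -- both on its right are training losses with the same mean.
  have hstep : ∀ i, A ≤ ENNReal.ofReal C * ∫⁻ Z, G (Z, Z i) ∂μ := by
    intro i
    have hupd := measurable_update_exchange (Ω := X × ℝ) i
    have h1 : ∫⁻ Z, ∫⁻ z, G (Function.update Z i z, Z i) ∂P ∂μ = A :=
      lintegral_update_exchange P i hGm
    have hFm : Measurable fun q : (Fin N → X × ℝ) × (X × ℝ) => G (q.1, q.1 i) :=
      (hGi i).comp measurable_fst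
    have h2 : ∫⁻ Z, ∫⁻ z, G (Function.update Z i z, z) ∂P ∂μ = ∫⁻ Z, G (Z, Z i) ∂μ := by
      have h := lintegral_update_exchange P i hFm
      simpa only [Function.update_self, lintegral_const, measure_univ, mul_one] using h
    have hpt : ∀ Z z, G (Function.update Z i z, Z i) + G (Z, z) ≤
        ENNReal.ofReal C * (G (Z, Z i) + G (Function.update Z i z, z)) := by
      intro Z z
      have h := (hW Z).exchange (i := i) (z' := z) hlam hN hκ (hW (Function.update Z i z))
      simp only [hG]
      rw [← ENNReal.ofReal_add (by positivity) (by positivity),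
        ← ENNReal.ofReal_add (by positivity) (by positivity), ← ENNReal.ofReal_mul hC0]
      exact ENNReal.ofReal_le_ofReal h
    have hint : A + A ≤ ENNReal.ofReal C * (∫⁻ Z, G (Z, Z i) ∂μ + ∫⁻ Z, G (Z, Z i) ∂μ) := by
      have m1 : Measurable fun p : (Fin N → X × ℝ) × (X × ℝ) =>
          G (Function.update p.1 i p.2, p.1 i) := hGm.comp hupd
      calc A + A = ∫⁻ Z, ∫⁻ z, (G (Function.update Z i z, Z i) + G (Z, z)) ∂P ∂μ := by
            conv_lhs => enter [1]; rw [← h1]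
            rw [hAdef, ← lintegral_add_left m1.lintegral_prod_right']
            refine lintegral_congr fun Z => ?_
            exact (lintegral_add_left (m1.comp measurable_prodMk_left) _).symm
        _ ≤ ∫⁻ Z, ∫⁻ z, ENNReal.ofReal C * (G (Z, Z i) + G (Function.update Z i z, z)) ∂P ∂μ :=
            lintegral_mono fun Z => lintegral_mono fun z => hpt Z z
        _ = ENNReal.ofReal C * ∫⁻ Z, ∫⁻ z, (G (Z, Z i) + G (Function.update Z i z, z)) ∂P ∂μ := by
            rw [← lintegral_const_mul' _ _ ENNReal.ofReal_ne_top]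
            refine lintegral_congr fun Z => ?_
            rw [lintegral_const_mul' _ _ ENNReal.ofReal_ne_top]
        _ = _ := by
            congr 1
            conv_rhs => enter [2]; rw [← h2]
            rw [← lintegral_add_left (hGi i)]
            refine lintegral_congr fun Z => ?_
            rw [lintegral_add_left measurable_const, lintegral_const, measure_univ, mul_one]
    rw [← two_mul, ← two_mul, mul_left_comm] at hint
    exact (ENNReal.mul_le_mul_iff_right two_ne_zero ENNReal.ofNat_ne_top).mp hint
  have hN0 : (0 : ℝ) < N := by exact_mod_cast hN
  -- Minimality against the fixed competitor `u`, dropping the regularizer of `W Z`.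
  have hpt : ∀ Z, ∑ i, G (Z, Z i) ≤
      ∑ i, ENNReal.ofReal (((Z i).2 - inner ℝ u (φ (Z i).1)) ^ 2 / 2) +
        N * ENNReal.ofReal (lam * Bsq) := by
    intro Z
    have h := (hW Z).2 u hu
    unfold ridgeObj at h
    have h1 : lam * ‖u‖ ^ 2 ≤ lam * Bsq := by gcongr
    have h2 : 0 ≤ lam * ‖W Z‖ ^ 2 := by positivity
    have h3 : 1 / (N : ℝ) * ∑ i, ((Z i).2 - inner ℝ (W Z) (φ (Z i).1)) ^ 2 / 2 ≤
      1 / (N : ℝ) * ∑ i, ((Z i).2 - inner ℝ u (φ (Z i).1)) ^ 2 / 2 + lam * Bsq := by linarith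
    rw [one_div, inv_mul_le_iff₀ hN0, mul_add, mul_inv_cancel_left₀ hN0.ne'] at h3
    simp only [hG]
    rw [← ENNReal.ofReal_sum_of_nonneg fun _ _ => by positivity,
      ← ENNReal.ofReal_sum_of_nonneg fun _ _ => by positivity, ← ENNReal.ofReal_natCast,
      ← ENNReal.ofReal_mul hN0.le, ← ENNReal.ofReal_add (Finset.sum_nonneg fun _ _ => by positivity)
        (mul_nonneg hN0.le (h1.trans' (by positivity)))]
    exact ENNReal.ofReal_le_ofReal h3
  have hφm : Measurable φ := measurable_of_finite φ
  have hum : Measurable fun z : X × ℝ => ENNReal.ofReal ((z.2 - inner ℝ u (φ z.1)) ^ 2 / 2) :=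
    Measurable.ennreal_ofReal (Measurable.div_const (Measurable.pow_const
      (Measurable.sub (by fun_prop) (Measurable.inner measurable_const
        (hφm.comp (by fun_prop)))) 2) 2)
  have humi : ∀ i : Fin N, Measurable fun Z : Fin N → X × ℝ =>
      ENNReal.ofReal (((Z i).2 - inner ℝ u (φ (Z i).1)) ^ 2 / 2) := fun i =>
    hum.comp (measurable_pi_apply i)
  have hsum : N * A ≤ N * (ENNReal.ofReal C *
      (expectedLoss P (fun x => inner ℝ u (φ x)) + ENNReal.ofReal (lam * Bsq))) := by
    calc N * A = ∑ _i : Fin N, A := by simp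
      _ ≤ ∑ i, ENNReal.ofReal C * ∫⁻ Z, G (Z, Z i) ∂μ := Finset.sum_le_sum fun i _ => hstep i
      _ = ENNReal.ofReal C * ∫⁻ Z, ∑ i, G (Z, Z i) ∂μ := by
        rw [← Finset.mul_sum, lintegral_finsetSum _ fun i _ => hGi i]
      _ ≤ ENNReal.ofReal C * ∫⁻ Z,
          (∑ i, ENNReal.ofReal (((Z i).2 - inner ℝ u (φ (Z i).1)) ^ 2 / 2) +
            N * ENNReal.ofReal (lam * Bsq)) ∂μ := by
        gcongr with Z
        exact hpt Z
      _ = ENNReal.ofReal C * (N * (expectedLoss P (fun x => inner ℝ u (φ x)) +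
            ENNReal.ofReal (lam * Bsq))) := by
        congr 1
        rw [lintegral_add_right _ measurable_const, lintegral_const, measure_univ, mul_one,
          lintegral_finsetSum _ fun i _ => humi i, mul_add]
        congr 1
        have : ∀ i : Fin N, ∫⁻ Z, ENNReal.ofReal (((Z i).2 - inner ℝ u (φ (Z i).1)) ^ 2 / 2) ∂μ =
            expectedLoss P (fun x => inner ℝ u (φ x)) := fun i =>
          (measurePreserving_eval (fun _ : Fin N => P) i).lintegral_comp hum
        simp [this]
      _ = _ := by ring
  exact (ENNReal.mul_le_mul_iff_right (by exact_mod_cast hN.ne') (ENNReal.natCast_ne_top N)).mp hsum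

end Risk

/-! ### The oracle inequality for kernel models -/

section KRR

variable {X : Type} [Fintype X] [MeasurableSpace X] [MeasurableSingletonClass X]
  {N : ℕ} {lam Bsq κ : ℝ} {k : X → X → ℝ}

theorem IsPSDKernel.exists_isKRRSolution (hk : IsPSDKernel k) (hB : 0 ≤ Bsq)
    (Z : Fin N → X × ℝ) : ∃ α : Fin N → ℝ, IsKRRSolution k lam Bsq Z α := by
  obtain ⟨φ, hφ⟩ := hk.exists_feature
  exact GLQK.exists_isKRRSolution hφ hB Z

/-- Oracle inequality for the expected risk of constrained kernel ridge regression. -/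
theorem lintegral_expectedLoss_kernelModel_le (hk : IsPSDKernel k) (P : Measure (X × ℝ))
    [IsProbabilityMeasure P] (hlam : 0 < lam) (hN : 0 < N) (hκ0 : 0 ≤ κ)
    (hκ : ∀ x, k x x ≤ κ) (hB : 0 ≤ Bsq) {f : X → ℝ}
    (hf : KernelLE (rankOne f) fun x y => Bsq * k x y)
    {a : (Fin N → X × ℝ) → Fin N → ℝ} (ha : ∀ Z, IsKRRSolution k lam Bsq Z (a Z)) :
    ∫⁻ Z, expectedLoss P (kernelModel k Z (a Z)) ∂(Measure.pi fun _ : Fin N => P) ≤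
      ENNReal.ofReal (1 + 4 * (κ / (2 * lam * N) + (κ / (2 * lam * N)) ^ 2)) *
        (expectedLoss P f + ENNReal.ofReal (lam * Bsq)) := by
  obtain ⟨φ, hφ⟩ := hk.exists_feature
  obtain ⟨u, hu, hfu⟩ := KernelLE.exists_weight hφ hB hf
  have h := lintegral_expectedLoss_isRidgeMin_le P hlam hN hκ0
    (fun x => by rw [← real_inner_self_eq_norm_sq, ← hφ]; exact hκ x)
    (fun Z => (ha Z).isRidgeMin hφ hlam.le) hu
  have e1 : ∀ Z, kernelModel k Z (a Z) = fun x => inner ℝ (featureComb φ Z (a Z)) (φ x) :=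
    fun Z => funext fun x => kernelModel_eq hφ Z (a Z) x
  have e2 : f = fun x => inner ℝ u (φ x) := funext hfu
  simp only [e1]
  rw [e2]
  exact h

end KRR


/-! ### Products of estimates are dominated by the polynomial GLQK -/

section LocalKernel

variable {D : ℕ} {L : Fin D → ℕ} [∀ i, NeZero (L i)] {τ γ : ℝ} {ζ : ℕ}

theorem card_box_le (ζ : ℕ) (a : Lattice L) : (box ζ a).card ≤ ζ ^ D := by
  have h := Finset.card_le_card_of_injOn (s := box ζ a)
    (t := Fintype.piFinset fun _ : Fin D => Finset.range ζ)
    (fun b j => (b j - a j).val)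
    (fun b hb => by
      simp only [box, Finset.coe_filter, Finset.mem_univ, true_and, Set.mem_ofPred_eq] at hb
      simpa [Fintype.mem_piFinset] using hb)
    (fun b _ b' _ hbb' => by
      funext j
      exact sub_left_injective (ZMod.val_injective _ (congrFun hbb' j)))
  simpa using h

theorem card_le_of_mem_localSubsystems {A : Finset (Lattice L)}
    (hA : A ∈ localSubsystems (L := L) ζ) : (A.card : ℝ) ≤ (ζ : ℝ) ^ D := by
  obtain ⟨a, -, rfl⟩ := Finset.mem_image.mp hA
  exact_mod_cast card_box_le ζ a

theorem card_localSubsystems_le :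
    (localSubsystems (L := L) ζ).card ≤ Fintype.card (Lattice L) :=
  Finset.card_image_le

theorem card_localSubsystems_pos : 0 < (localSubsystems (L := L) ζ).card :=
  Finset.card_pos.mpr (Finset.univ_nonempty.image _)

/-- The mean of the truncated shadow kernels over the local subsystems. -/
noncomputable def meanLocalKernel (τ γ : ℝ) (ζ : ℕ) {T : ℕ} (S S' : Shadow (Lattice L) T) : ℝ :=
  1 / ((localSubsystems (L := L) ζ).card : ℝ) *
    ∑ A ∈ localSubsystems (L := L) ζ, truncatedShadowKernel τ γ A S S'

theorem isPSDKernel_truncatedShadowKernel {G : Type} [Fintype G] [DecidableEq G] (hγ : 0 ≤ γ)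
    (hτ : 0 ≤ τ) (A : Finset G) {T : ℕ} : IsPSDKernel (truncatedShadowKernel τ γ A (T := T)) :=
  (one_le_truncatedShadowKernel hγ hτ A).isPSDKernel isPSDKernel_one

theorem isPSDKernel_meanLocalKernel (hγ : 0 ≤ γ) (hτ : 0 ≤ τ) {T : ℕ} :
    IsPSDKernel (meanLocalKernel (L := L) τ γ ζ (T := T)) :=
  (IsPSDKernel.sum (localSubsystems (L := L) ζ)
    (k := fun A => truncatedShadowKernel τ γ A (T := T))
    fun A _ => isPSDKernel_truncatedShadowKernel hγ hτ A).mul_left (by positivity)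

theorem polyGLQK_eq (h : ℕ) {T : ℕ} (S S' : Shadow (Lattice L) T) :
    polyGLQK τ γ ζ h S S' = meanLocalKernel τ γ ζ S S' ^ h := rfl

theorem isPSDKernel_polyGLQK (hγ : 0 ≤ γ) (hτ : 0 ≤ τ) (h : ℕ) {T : ℕ} :
    IsPSDKernel (polyGLQK (L := L) τ γ ζ h (T := T)) :=
  (isPSDKernel_meanLocalKernel hγ hτ).pow h

theorem truncatedShadowKernel_kernelLE_meanLocalKernel (hγ : 0 ≤ γ) (hτ : 0 ≤ τ)
    {A : Finset (Lattice L)} (hA : A ∈ localSubsystems (L := L) ζ) {T : ℕ} :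
    KernelLE (truncatedShadowKernel τ γ A (T := T)) fun S S' =>
      ((localSubsystems (L := L) ζ).card : ℝ) * meanLocalKernel τ γ ζ S S' := by
  have h := KernelLE.of_mem_sum (s := localSubsystems (L := L) ζ)
    (k := fun A => truncatedShadowKernel τ γ A (T := T))
    (fun A _ => isPSDKernel_truncatedShadowKernel hγ hτ A) hA
  refine (congrArg₂ KernelLE rfl ?_).mp h
  funext S S'
  have : ((localSubsystems (L := L) ζ).card : ℝ) ≠ 0 := by
    exact_mod_cast card_localSubsystems_pos.ne'
  rw [meanLocalKernel]; field_simp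

theorem polyGLQK_self_le (hγ : 0 ≤ γ) (hτ : 0 ≤ τ) (h : ℕ) {T : ℕ} (hT : 0 < T)
    (S S' : Shadow (Lattice L) T) :
    polyGLQK τ γ ζ h S S' ≤ Real.exp (h * τ * Real.exp (5 * γ)) := by
  have hpos : (0 : ℝ) < (localSubsystems (L := L) ζ).card := by
    exact_mod_cast card_localSubsystems_pos
  rw [polyGLQK_eq, mul_assoc, Real.exp_nat_mul]
  have h0 : 0 ≤ meanLocalKernel τ γ ζ S S' :=
    mul_nonneg (by positivity) (Finset.sum_nonneg fun A _ => (Real.exp_pos _).le)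
  gcongr
  rw [meanLocalKernel, one_div, inv_mul_le_iff₀ hpos]
  refine (Finset.sum_le_sum fun A _ => truncatedShadowKernel_le hγ hτ A hT S S').trans ?_
  simp

/-- Products of shadow estimates that are covered by `a` local subsystems. -/
theorem kernelLE_rankOne_polyGLQK (hγ : 0 < γ) (hτ : 0 < τ) {h a q : ℕ} (hah : a ≤ h)
    (Q : Fin a → Multiset (PauliString (Lattice L))) (A : Fin a → Finset (Lattice L))
    (hA : ∀ l, A l ∈ localSubsystems (L := L) ζ) (hQ : ∀ l, ∀ P ∈ Q l, P.supp ⊆ A l)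
    (hcard : (∑ l, Q l).card ≤ q)
    (hsupp : ((∑ l, Q l).map fun P => P.supp.card).sum ≤ q) (hqτ : 1 ≤ q / τ)
    (hζγ : 1 ≤ 2 * (ζ : ℝ) ^ D / γ) {T : ℕ} :
    KernelLE (rankOne fun S : Shadow (Lattice L) T => ((∑ l, Q l).map fun P => shadowEst P S).prod)
      fun S S' => ((q / τ) ^ q * (2 * (ζ : ℝ) ^ D / γ) ^ q * (Fintype.card (Lattice L) : ℝ) ^ h) *
        polyGLQK τ γ ζ h S S' := by
  set M := 2 * (ζ : ℝ) ^ D / γ with hM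
  set c := ((localSubsystems (L := L) ζ).card : ℝ) with hc
  have hc0 : 0 < c := by rw [hc]; exact_mod_cast card_localSubsystems_pos
  have hcn : c ≤ Fintype.card (Lattice L) := by rw [hc]; exact_mod_cast card_localSubsystems_le
  have hmean := isPSDKernel_meanLocalKernel (L := L) (ζ := ζ) (T := T) hγ.le hτ.le
  have hcards : (∑ l, Q l).card = ∑ l, (Q l).card := by
    simp
  have hmaps : ((∑ l, Q l).map fun P => P.supp.card).sum =
      ∑ l, ((Q l).map fun P => P.supp.card).sum := by
    rw [← Multiset.coe_mapAddMonoidHom, map_sum, ← Multiset.coe_sumAddMonoidHom, map_sum]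
  have hprods : ∀ S : Shadow (Lattice L) T, ((∑ l, Q l).map fun P => shadowEst P S).prod =
      ∏ l, ((Q l).map fun P => shadowEst P S).prod := fun S => by
    rw [← Multiset.coe_mapAddMonoidHom, map_sum, Multiset.prod_sum]
  have hpart : ∀ l, KernelLE
      (rankOne fun S : Shadow (Lattice L) T => ((Q l).map fun P => shadowEst P S).prod)
      fun S S' => (((q / τ) ^ (Q l).card * M ^ ((Q l).map fun P => P.supp.card).sum) * c) *
        meanLocalKernel τ γ ζ S S' := by
    intro l
    have hl : (Q l).card ≤ q := by
      refine le_trans ?_ (hcards ▸ hcard)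
      exact Finset.single_le_sum (f := fun l => (Q l).card) (fun _ _ => Nat.zero_le _)
        (Finset.mem_univ l)
    have h1 := kernelLE_rankOne_multiset_prod_truncatedShadowKernel (T := T) hγ hτ
      (card_le_of_mem_localSubsystems (hA l)) (Q l) (hQ l) hl
    refine h1.trans ((KernelLE.mul_left
      (truncatedShadowKernel_kernelLE_meanLocalKernel (T := T) hγ.le hτ.le (hA l))
      (a := (q / τ) ^ (Q l).card * M ^ ((Q l).map fun P => P.supp.card).sum)
      (by positivity)).trans ?_)
    refine (congrArg₂ KernelLE ?_ rfl).mp (KernelLE.refl _)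
    funext S S'
    ring
  -- A term may need fewer than `h` parts; the `h - a` spare factors of the kernel dominate the
  -- constant 1.
  have hone : KernelLE (fun _ _ : Shadow (Lattice L) T => (1 : ℝ)) fun S S' =>
      c * meanLocalKernel τ γ ζ S S' := by
    obtain ⟨A₀, hA₀⟩ := Finset.card_pos.mp (card_localSubsystems_pos (L := L) (ζ := ζ))
    exact (one_le_truncatedShadowKernel hγ.le hτ.le A₀).trans
      (truncatedShadowKernel_kernelLE_meanLocalKernel hγ.le hτ.le hA₀)
  have hpad := KernelLE.prod (Finset.range (h - a))
    (k := fun _ (_ _ : Shadow (Lattice L) T) => (1 : ℝ)) (fun _ _ => hone)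
    fun _ _ => isPSDKernel_one
  have hall := (KernelLE.prod Finset.univ (fun l _ => hpart l)
    fun l _ => isPSDKernel_rankOne _).mul hpad
    (IsPSDKernel.prod Finset.univ fun l _ => isPSDKernel_rankOne _)
    (IsPSDKernel.prod _ fun _ _ => isPSDKernel_one)
  -- Both bases are at least 1 by `hqτ` and `hζγ`, so the exponents may be raised to `q`.
  have hR : (∏ l, (q / τ) ^ (Q l).card * M ^ ((Q l).map fun P => P.supp.card).sum) ≤
      (q / τ) ^ q * M ^ q := by
    rw [Finset.prod_mul_distrib, Finset.prod_pow_eq_pow_sum, Finset.prod_pow_eq_pow_sum,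
      ← hcards, ← hmaps]
    gcongr
  refine KernelLE.trans ?_ (((isPSDKernel_polyGLQK (L := L) (ζ := ζ) (T := T) hγ.le hτ.le h
    ).mul_left_mono (a := (∏ l, (q / τ) ^ (Q l).card *
      M ^ ((Q l).map fun P => P.supp.card).sum) * c ^ h)) ?_)
  · refine (congrArg₂ KernelLE ?_ ?_).mp hall
    · funext S S'
      simp only [rankOne, hprods, Finset.prod_mul_distrib, Finset.prod_const_one, mul_one]
    · funext S S'
      rw [polyGLQK_eq]
      simp only [Finset.prod_mul_distrib, Finset.prod_const, Finset.card_univ, Fintype.card_fin,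
        Finset.card_range]
      have e1 : c ^ h = c ^ a * c ^ (h - a) := by rw [← pow_add, Nat.add_sub_cancel' hah]
      have e2 : meanLocalKernel τ γ ζ S S' ^ h = meanLocalKernel τ γ ζ S S' ^ a *
          meanLocalKernel τ γ ζ S S' ^ (h - a) := by rw [← pow_add, Nat.add_sub_cancel' hah]
      rw [e1, e2]; ring
  · gcongr

end LocalKernel

/-! ### Counting cluster factors, covers, and the cluster approximation error -/

section Factors

variable {D : ℕ} {L : Fin D → ℕ} [∀ i, NeZero (L i)] {p m : ℕ} {g : PauliPoly (Lattice L) p}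
  {δ : ℝ}

theorem PauliPoly.mem_clusterFactors {i : Fin g.numTerms} {P : PauliString (Lattice L)} :
    P ∈ g.clusterFactors δ i ↔
      ∃ j, ∃ C ∈ clusters δ (g.strings i j).supp, (g.strings i j).restrict C = P := by
  simp [PauliPoly.clusterFactors, Multiset.mem_sum]

theorem PauliPoly.IsBody.card_supp_le (hg : g.IsBody m) {i : Fin g.numTerms}
    {P : PauliString (Lattice L)} (hP : P ∈ g.clusterFactors δ i) : P.supp.card ≤ m := by
  obtain ⟨j, C, -, rfl⟩ := PauliPoly.mem_clusterFactors.mp hP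
  rw [PauliString.supp_restrict]
  exact (Finset.card_le_card Finset.inter_subset_left).trans (hg i j)

theorem PauliPoly.IsBody.card_clusterFactors_le (hg : g.IsBody m) (hm : 0 < m)
    (i : Fin g.numTerms) : (g.clusterFactors δ i).card ≤ m * p := by
  have : (g.clusterFactors δ i).card = ∑ j, (clusters δ (g.strings i j).supp).card := by
    simp [PauliPoly.clusterFactors]
  rw [this]
  refine (Finset.sum_le_sum fun j _ => card_clusters_le hm (hg i j)).trans ?_
  simp [mul_comm]

/-- Clusters of one support are disjoint, so splitting does not increase the total weight. -/
theorem PauliPoly.IsBody.sum_card_supp_le (hg : g.IsBody m) (hδ : 0 ≤ δ)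
    (i : Fin g.numTerms) :
    ((g.clusterFactors δ i).map fun P => P.supp.card).sum ≤ m * p := by
  have : ((g.clusterFactors δ i).map fun P => P.supp.card).sum =
      ∑ j, ∑ C ∈ clusters δ (g.strings i j).supp, ((g.strings i j).restrict C).supp.card := by
    rw [PauliPoly.clusterFactors, ← Multiset.coe_mapAddMonoidHom, map_sum,
      ← Multiset.coe_sumAddMonoidHom, map_sum]
    refine Finset.sum_congr rfl fun j _ => ?_
    simp only [Multiset.coe_mapAddMonoidHom, Multiset.coe_sumAddMonoidHom, Multiset.map_map]
    rfl
  rw [this]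
  calc _ ≤ ∑ j : Fin p, m := by
        refine Finset.sum_le_sum fun j _ => ?_
        refine le_trans (Finset.sum_le_sum fun C _ => ?_)
          ((sum_card_clusters hδ (g.strings i j).supp).le.trans (hg i j))
        rw [PauliString.supp_restrict]
        exact Finset.card_le_card Finset.inter_subset_right
    _ = _ := by simp [mul_comm]

theorem exists_cover_of_forall {𝒜 : Finset (Finset (Lattice L))}
    (M : Multiset (PauliString (Lattice L))) (h : ∀ P ∈ M, ∃ A ∈ 𝒜, P.supp ⊆ A) :
    ∃ (a : ℕ) (Q : Fin a → Multiset (PauliString (Lattice L))) (A : Fin a → Finset (Lattice L)),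
      M = ∑ l, Q l ∧ (∀ l, A l ∈ 𝒜) ∧ ∀ l, ∀ P ∈ Q l, P.supp ⊆ A l := by
  induction M using Multiset.induction_on with
  | empty => exact ⟨0, Fin.elim0, Fin.elim0, by simp, fun l => l.elim0, fun l => l.elim0⟩
  | cons P M ih =>
    obtain ⟨a, Q, A, hM, hA, hQ⟩ := ih fun P' hP' => h P' (Multiset.mem_cons_of_mem hP')
    obtain ⟨A₀, hA₀, hP⟩ := h P (Multiset.mem_cons_self P M)
    refine ⟨a + 1, Fin.cons {P} Q, Fin.cons A₀ A, ?_, ?_, ?_⟩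
    · rw [Fin.sum_univ_succ]
      simp [hM]
    · intro l
      refine Fin.cases ?_ (fun l => ?_) l
      · simpa using hA₀
      · simpa using hA l
    · intro l
      refine Fin.cases ?_ (fun l => ?_) l
      · simpa using hP
      · simpa using hQ l

/-- The local-cover number is attained by an actual cover of every term. -/
theorem PauliPoly.IsBody.exists_coveredBy (hg : g.IsBody m) (hm : 0 < m) (hδ : 0 < δ) {ζ : ℕ}
    (hζ : ζ = ⌈(m : ℝ) * δ⌉₊) (i : Fin g.numTerms) :
    ∃ a ≤ g.localCoverNumber δ ζ, g.CoveredBy δ ζ i a := by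
  -- Without a cover the infimum would be the default `0`. Giving every factor its own box shows
  -- that one exists.
  have hne : {a | g.CoveredBy δ ζ i a}.Nonempty := by
    refine exists_cover_of_forall (𝒜 := localSubsystems ζ) (g.clusterFactors δ i)
      fun P hP => ?_
    obtain ⟨j, C, hC, rfl⟩ := PauliPoly.mem_clusterFactors.mp hP
    obtain ⟨A, hA, hCA⟩ := exists_localSubsystem_of_mem_clusters hm hδ hζ (hg i j) hC
    refine ⟨A, hA, ?_⟩
    rw [PauliString.supp_restrict]
    exact Finset.inter_subset_right.trans hCA
  refine ⟨sInf {a | g.CoveredBy δ ζ i a}, ?_, Nat.sInf_mem hne⟩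
  exact Finset.le_sup (f := fun i => sInf {a | g.CoveredBy δ ζ i a}) (Finset.mem_univ i)

theorem abs_prod_sub_prod_le_sum {ι : Type} (s : Finset ι) {a b : ι → ℝ}
    (ha : ∀ i, |a i| ≤ 1) (hb : ∀ i, |b i| ≤ 1) :
    |∏ i ∈ s, a i - ∏ i ∈ s, b i| ≤ ∑ i ∈ s, |a i - b i| := by
  classical
  induction s using Finset.induction_on with
  | empty => simp
  | insert i s hi ih =>
    rw [Finset.prod_insert hi, Finset.prod_insert hi, Finset.sum_insert hi]
    have hM : |∏ i ∈ s, b i| ≤ 1 := by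
      rw [Finset.abs_prod]
      exact Finset.prod_le_one (fun _ _ => abs_nonneg _) fun j _ => hb j
    calc |a i * ∏ i ∈ s, a i - b i * ∏ i ∈ s, b i|
        = |(a i - b i) * ∏ i ∈ s, b i + a i * (∏ i ∈ s, a i - ∏ i ∈ s, b i)| := by ring_nf
      _ ≤ |a i - b i| * |∏ i ∈ s, b i| + |a i| * |∏ i ∈ s, a i - ∏ i ∈ s, b i| := by
        rw [← abs_mul, ← abs_mul]; exact abs_add_le _ _
      _ ≤ |a i - b i| * 1 + 1 * ∑ i ∈ s, |a i - b i| := by gcongr; exact ha i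
      _ = _ := by ring

/-- The terms of the cluster approximation. -/
theorem PauliPoly.IsBody.abs_prod_sub_prod_clusterFactors_le (hg : g.IsBody m) (hm : 0 < m)
    {ξ : ℝ} (hξ : 0 < ξ) (hδ : 0 ≤ δ) {ρ : QState (Lattice L)} (hρ : HasECP ξ ρ)
    (i : Fin g.numTerms) :
    |((g.clusterFactors δ i).map fun P => (ρ.expect P.op).re).prod -
      ∏ j, (ρ.expect (g.strings i j).op).re| ≤ m * p * Real.exp (-δ / ξ) := by
  have h1 : ((g.clusterFactors δ i).map fun P => (ρ.expect P.op).re).prod =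
      ∏ j, ∏ C ∈ clusters δ (g.strings i j).supp,
        (ρ.expect ((g.strings i j).restrict C).op).re := by
    rw [PauliPoly.clusterFactors, ← Multiset.coe_mapAddMonoidHom, map_sum,
      Multiset.prod_sum]
    refine Finset.prod_congr rfl fun j _ => ?_
    simp only [Multiset.coe_mapAddMonoidHom, Multiset.map_map]
    rfl
  rw [h1]
  refine (abs_prod_sub_prod_le_sum Finset.univ (fun j => ?_)
    fun j => ρ.abs_expect_op_le_one _).trans ?_
  · rw [Finset.abs_prod]
    exact Finset.prod_le_one (fun _ _ => abs_nonneg _) fun C _ => ρ.abs_expect_op_le_one _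
  · calc _ ≤ ∑ j : Fin p, (m : ℝ) * Real.exp (-δ / ξ) := by
          refine Finset.sum_le_sum fun j _ => ?_
          rw [abs_sub_comm]
          refine (hρ.abs_expect_sub_prod_clusters_le hξ hδ (g.strings i j)).trans ?_
          have : ((clusters δ (g.strings i j).supp).card : ℝ) ≤ m := by
            exact_mod_cast card_clusters_le hm (hg i j)
          gcongr
      _ = _ := by simp; ring

end Factors


/-! ### Integrals against the data distribution as finite sums over shadows -/

section DataDistribution

variable {G : Type} [Fintype G] [DecidableEq G] {p T : ℕ}

theorem QState.measurable_expect (O : Operator G) :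
    Measurable fun ρ : QState G => ρ.expect O := by
  have h : ∀ s t, Measurable fun ρ : QState G => ρ.1 s t := fun s t =>
    (measurable_pi_apply t).comp ((measurable_pi_apply s).comp measurable_subtype_coe)
  simp only [QState.expect, Matrix.trace, Matrix.diag, Matrix.mul_apply, QState.mat,
    Matrix.of_apply]
  exact Finset.measurable_sum _ fun s _ => Finset.measurable_sum _ fun t _ =>
    measurable_const.mul (h t s)

theorem measurable_roundProb (w : G → Fin 3 × Bool) :
    Measurable fun ρ : QState G => roundProb ρ w :=
  measurable_const.mul (Complex.measurable_re.comp (QState.measurable_expect _))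

theorem PauliPoly.measurable_eval (g : PauliPoly G p) : Measurable g.eval := by
  unfold PauliPoly.eval
  exact Finset.measurable_sum _ fun i _ => measurable_const.mul
    (Finset.measurable_prod _ fun j _ => Complex.measurable_re.comp (QState.measurable_expect _))

theorem lintegral_map_shadowDist (ρ : QState G) (y : ℝ) {F : Shadow G T × ℝ → ℝ≥0∞}
    (hF : Measurable F) :
    ∫⁻ z, F z ∂((shadowDist T ρ).map fun S => (S, y)) =
      ∑ S : Shadow G T, ENNReal.ofReal (∏ t, roundProb ρ (S t)) * F (S, y) := by
  rw [lintegral_map hF (measurable_of_finite _), shadowDist, lintegral_finsetSum_measure]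
  refine Finset.sum_congr rfl fun S _ => ?_
  rw [lintegral_smul_measure, lintegral_dirac, smul_eq_mul]

theorem measurable_map_shadowDist (g : PauliPoly G p) :
    Measurable fun ρ : QState G => (shadowDist T ρ).map fun S => (S, g.eval ρ) := by
  refine Measure.measurable_of_measurable_coe _ fun s hs => ?_
  have h : ∀ ρ : QState G, ((shadowDist T ρ).map fun S => (S, g.eval ρ)) s =
      ∑ S : Shadow G T, ENNReal.ofReal (∏ t, roundProb ρ (S t)) *
        s.indicator 1 (S, g.eval ρ) := fun ρ => by
    rw [← lintegral_map_shadowDist ρ (g.eval ρ) (measurable_one.indicator hs),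
      lintegral_indicator_one hs]
  simp only [h]
  refine Finset.measurable_sum _ fun S _ => Measurable.mul ?_ ?_
  · exact Measurable.ennreal_ofReal (Finset.measurable_prod _ fun t _ => measurable_roundProb _)
  · exact (measurable_one.indicator hs).comp (measurable_const.prodMk g.measurable_eval)

theorem lintegral_dataDist (𝒟 : Measure (QState G)) (g : PauliPoly G p)
    {F : Shadow G T × ℝ → ℝ≥0∞} (hF : Measurable F) :
    ∫⁻ z, F z ∂(dataDist 𝒟 g T) = ∫⁻ ρ, ∑ S : Shadow G T,
      ENNReal.ofReal (∏ t, roundProb ρ (S t)) * F (S, g.eval ρ) ∂𝒟 := by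
  rw [dataDist, Measure.lintegral_bind (measurable_map_shadowDist g).aemeasurable hF.aemeasurable]
  exact lintegral_congr fun ρ => lintegral_map_shadowDist ρ _ hF

theorem isProbabilityMeasure_dataDist (𝒟 : Measure (QState G)) [IsProbabilityMeasure 𝒟]
    (g : PauliPoly G p) : IsProbabilityMeasure (dataDist 𝒟 g T) := by
  constructor
  rw [← lintegral_one, lintegral_dataDist 𝒟 g measurable_const]
  have h : ∀ ρ : QState G, ∑ S : Shadow G T,
      ENNReal.ofReal (∏ t, roundProb ρ (S t)) * (1 : Shadow G T × ℝ → ℝ≥0∞) (S, g.eval ρ) = 1 := by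
    intro ρ
    simp only [Pi.one_apply, mul_one]
    rw [← ENNReal.ofReal_sum_of_nonneg fun S _ =>
      Finset.prod_nonneg fun t _ => roundProb_nonneg ρ _, sum_prod_weight (sum_roundProb ρ),
      ENNReal.ofReal_one]
  simpa using lintegral_congr (μ := 𝒟) h

/-- The expected loss of a model is at most half its mean squared error over the shadows of any
fixed state. -/
theorem expectedLoss_dataDist_le {𝒟 : Measure (QState G)} [IsProbabilityMeasure 𝒟]
    (g : PauliPoly G p) {f : Shadow G T → ℝ} {b : ℝ}
    (h : ∀ᵐ ρ ∂𝒟, ∑ S : Shadow G T, (∏ t, roundProb ρ (S t)) * (f S - g.eval ρ) ^ 2 ≤ b) :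
    expectedLoss (dataDist 𝒟 g T) f ≤ ENNReal.ofReal (b / 2) := by
  have hF : Measurable fun z : Shadow G T × ℝ => ENNReal.ofReal ((z.2 - f z.1) ^ 2 / 2) := by
    have : Measurable f := measurable_of_finite f
    fun_prop
  rw [expectedLoss, lintegral_dataDist 𝒟 g hF]
  calc _ ≤ ∫⁻ _, ENNReal.ofReal (b / 2) ∂𝒟 := by
        refine lintegral_mono_ae (h.mono fun ρ hρ => ?_)
        have h0 : ∀ S : Shadow G T, 0 ≤ ∏ t, roundProb ρ (S t) := fun S =>
          Finset.prod_nonneg fun t _ => roundProb_nonneg ρ _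
        simp only [← ENNReal.ofReal_mul (h0 _)]
        rw [← ENNReal.ofReal_sum_of_nonneg fun S _ => mul_nonneg (h0 S) (by positivity)]
        apply ENNReal.ofReal_le_ofReal
        rw [le_div_iff₀ two_pos, Finset.sum_mul]
        refine le_trans (le_of_eq (Finset.sum_congr rfl fun S _ => ?_)) hρ
        ring
    _ = _ := by simp

end DataDistribution

/-! ### Accuracy and feature-space norm of the shadow polynomial -/

section ShadowPolynomial

variable {D : ℕ} {L : Fin D → ℕ} [∀ i, NeZero (L i)] {p m : ℕ}

/-- The estimate of the cluster approximation of a polynomial from a classical shadow. -/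
noncomputable def PauliPoly.shadowPoly (g : PauliPoly (Lattice L) p) (δ : ℝ) {T : ℕ}
    (S : Shadow (Lattice L) T) : ℝ :=
  ∑ i, g.coeff i * ((g.clusterFactors δ i).map fun P => shadowEst P S).prod

/-- Cauchy–Schwarz with weights `|g.coeff i|`, which reduces the error to that of single terms. -/
theorem PauliPoly.sq_shadowPoly_sub_eval_le (g : PauliPoly (Lattice L) p) (δ : ℝ) {T : ℕ}
    (S : Shadow (Lattice L) T) (ρ : QState (Lattice L)) :
    (g.shadowPoly δ S - g.eval ρ) ^ 2 ≤ g.norm1 * ∑ i, |g.coeff i| *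
      (((g.clusterFactors δ i).map fun P => shadowEst P S).prod -
        ∏ j, (ρ.expect (g.strings i j).op).re) ^ 2 := by
  rw [PauliPoly.shadowPoly, PauliPoly.eval, ← Finset.sum_sub_distrib, PauliPoly.norm1]
  refine Finset.sum_sq_le_sum_mul_sum_of_sq_le_mul _ (fun _ _ => abs_nonneg _)
    (fun _ _ => by positivity) fun i _ => ?_
  rw [← mul_sub, mul_pow, ← sq_abs (g.coeff i)]
  exact le_of_eq (by ring)

theorem PauliPoly.IsBody.sum_weight_mul_sq_term_le {g : PauliPoly (Lattice L) p}
    (hg : g.IsBody m) (hm : 0 < m) {ξ δ : ℝ} (hξ : 0 < ξ) (hδ : 0 ≤ δ)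
    {ρ : QState (Lattice L)} (hρ : HasECP ξ ρ) (i : Fin g.numTerms) {T : ℕ} (hT : 0 < T)
    {η : ℝ} (hη : 0 < η) :
    ∑ S : Shadow (Lattice L) T, (∏ t, roundProb ρ (S t)) *
      (((g.clusterFactors δ i).map fun P => shadowEst P S).prod -
        ∏ j, (ρ.expect (g.strings i j).op).re) ^ 2 ≤
      (m * p * Real.exp (-δ / ξ) + ((1 + η) ^ (m * p) - 1)) ^ 2 +
      ((3 ^ m) ^ (m * p) + 1) ^ 2 *
        ((m * p : ℕ) * (2 * Real.exp (-(T * η ^ 2 / (8 * (3 ^ m) ^ 2))))) := by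
  set M := g.clusterFactors δ i with hM
  have hcard : Fintype.card M ≤ m * p := by
    rw [Multiset.card_coe]; exact hg.card_clusterFactors_le hm i
  -- The multiset is used as an index type, so repeated strings stay separate factors.
  have hprod : ∀ F : PauliString (Lattice L) → ℝ, (M.map F).prod = ∏ P : M, F P := fun F => by
    rw [Finset.prod_eq_multiset_prod, ← Multiset.map_univ M F]
  have h3 : (1 : ℝ) ≤ 3 ^ m := one_le_pow₀ (by norm_num)
  have key := sum_prod_weight_mul_sq_le (w := roundProb ρ) (T := T) (roundProb_nonneg ρ)
    (sum_roundProb ρ) (X := fun P : M => roundEst (P : PauliString (Lattice L)))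
    (μ := fun P : M => (ρ.expect (P : PauliString (Lattice L)).op).re) h3
    (fun P y => (abs_roundEst_le _ y).trans
      (pow_le_pow_right₀ (by norm_num) (hg.card_supp_le (δ := δ) (i := i) Multiset.coe_mem)))
    (fun P => sum_roundProb_mul_roundEst ρ _) (fun P => ρ.abs_expect_op_le_one _) hT hη
    (v := ∏ j, (ρ.expect (g.strings i j).op).re) (e := m * p * Real.exp (-δ / ξ))
    (by
      rw [Finset.abs_prod]
      exact Finset.prod_le_one (fun _ _ => abs_nonneg _) fun j _ => ρ.abs_expect_op_le_one _)
    (by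
      rw [← hprod fun P => (ρ.expect P.op).re]
      exact hg.abs_prod_sub_prod_clusterFactors_le hm hξ hδ hρ i)
  simp only [hprod]
  refine key.trans ?_
  have h1 : (1 : ℝ) ≤ (1 + η) ^ Fintype.card M := one_le_pow₀ (by linarith)
  have h2 : (1 + η) ^ Fintype.card M ≤ (1 + η) ^ (m * p) :=
    pow_le_pow_right₀ (by linarith) hcard
  have h4 : ((3 : ℝ) ^ m) ^ Fintype.card M ≤ (3 ^ m) ^ (m * p) := pow_le_pow_right₀ h3 hcard
  have h5 : (0 : ℝ) ≤ m * p * Real.exp (-δ / ξ) := by positivity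
  have h6 : (Fintype.card M : ℝ) ≤ (m * p : ℕ) := by exact_mod_cast hcard
  have h7 : (0 : ℝ) ≤ m * p * Real.exp (-δ / ξ) + ((1 + η) ^ Fintype.card M - 1) := by linarith
  gcongr

theorem PauliPoly.IsBody.sum_weight_mul_sq_le {g : PauliPoly (Lattice L) p}
    (hg : g.IsBody m) (hm : 0 < m) {ξ δ : ℝ} (hξ : 0 < ξ) (hδ : 0 ≤ δ)
    {ρ : QState (Lattice L)} (hρ : HasECP ξ ρ) {T : ℕ} (hT : 0 < T) {η R : ℝ} (hη : 0 < η)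
    (hR : (m * p * Real.exp (-δ / ξ) + ((1 + η) ^ (m * p) - 1)) ^ 2 +
      ((3 ^ m) ^ (m * p) + 1) ^ 2 *
        ((m * p : ℕ) * (2 * Real.exp (-(T * η ^ 2 / (8 * (3 ^ m) ^ 2))))) ≤ R) :
    ∑ S : Shadow (Lattice L) T, (∏ t, roundProb ρ (S t)) * (g.shadowPoly δ S - g.eval ρ) ^ 2 ≤
      g.norm1 ^ 2 * R := by
  have hn : 0 ≤ g.norm1 := Finset.sum_nonneg fun i _ => abs_nonneg _
  calc _ ≤ ∑ S : Shadow (Lattice L) T, (∏ t, roundProb ρ (S t)) *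
          (g.norm1 * ∑ i, |g.coeff i| *
            (((g.clusterFactors δ i).map fun P => shadowEst P S).prod -
              ∏ j, (ρ.expect (g.strings i j).op).re) ^ 2) := by
        gcongr with S
        · exact Finset.prod_nonneg fun t _ => roundProb_nonneg ρ _
        · exact g.sq_shadowPoly_sub_eval_le δ S ρ
    _ = g.norm1 * ∑ i, |g.coeff i| * ∑ S : Shadow (Lattice L) T, (∏ t, roundProb ρ (S t)) *
            (((g.clusterFactors δ i).map fun P => shadowEst P S).prod -
              ∏ j, (ρ.expect (g.strings i j).op).re) ^ 2 := by
        simp only [Finset.mul_sum]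
        rw [Finset.sum_comm]
        exact Finset.sum_congr rfl fun i _ => Finset.sum_congr rfl fun S _ => by ring
    _ ≤ g.norm1 * ∑ i, |g.coeff i| * R := by
        gcongr with i
        exact (hg.sum_weight_mul_sq_term_le hm hξ hδ hρ i hT hη).trans hR
    _ = _ := by rw [← Finset.sum_mul, PauliPoly.norm1]; ring

/-- The shadow estimate of the cluster approximation lies in a ball of the feature space of the
polynomial GLQK. -/
theorem PauliPoly.IsBody.kernelLE_rankOne_shadowPoly {g : PauliPoly (Lattice L) p}
    (hg : g.IsBody m) (hm : 0 < m) {δ τ γ : ℝ} (hδ : 0 < δ) {ζ : ℕ}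
    (hζ : ζ = ⌈(m : ℝ) * δ⌉₊) (hτ : 0 < τ) (hγ : 0 < γ) (hmpτ : 1 ≤ (m : ℝ) * p / τ)
    (hζγ : 1 ≤ 2 * (ζ : ℝ) ^ D / γ) {T : ℕ} :
    KernelLE (rankOne fun S : Shadow (Lattice L) T => g.shadowPoly δ S) fun S S' =>
      (g.norm1 ^ 2 * ((2 * m * p * (ζ : ℝ) ^ D / (τ * γ)) ^ (m * p) *
        (Fintype.card (Lattice L) : ℝ) ^ g.localCoverNumber δ ζ)) *
        polyGLQK τ γ ζ (g.localCoverNumber δ ζ) S S' := by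
  refine kernelLE_rankOne_sum (isPSDKernel_polyGLQK hγ.le hτ.le _) Finset.univ
    (fun i S => ((g.clusterFactors δ i).map fun P => shadowEst P S).prod) g.coeff (by positivity)
    fun i _ => ?_
  obtain ⟨a, ha, Q, A, hQ, hA, hQA⟩ := hg.exists_coveredBy hm hδ hζ i
  have h := kernelLE_rankOne_polyGLQK (T := T) (q := m * p) hγ hτ ha Q A hA hQA
    (hQ ▸ hg.card_clusterFactors_le hm i) (hQ ▸ hg.sum_card_supp_le hδ.le i)
    (by push_cast; exact hmpτ) hζγ
  rw [← hQ] at h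
  refine (congrArg₂ KernelLE rfl ?_).mp h
  funext S S'
  congr 2
  rw [← mul_pow]
  congr 1
  push_cast
  field_simp

end ShadowPolynomial


/-! ### Numerical estimates and the main theorem -/

theorem one_add_pow_sub_one_le {x : ℝ} (hx0 : 0 < x) (hx1 : x ≤ 1) {q : ℕ} (hq : 0 < q) :
    (1 + x / (3 * q)) ^ q - 1 ≤ 4 / 9 * x := by
  have hq' : (0 : ℝ) < q := by exact_mod_cast hq
  have h1 : (1 + x / (3 * q)) ^ q ≤ Real.exp (x / 3) := by
    have : x / 3 = q * (x / (3 * q)) := by field_simp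
    rw [this, Real.exp_nat_mul]
    gcongr
    linarith [Real.add_one_le_exp (x / (3 * q))]
  -- `exp (x / 3) - 1 ≤ x / 3 + x ^ 2 / 9`, and `x ^ 2 ≤ x`.
  have h2 := Real.abs_exp_sub_one_sub_id_le (x := x / 3) (by rw [abs_le]; constructor <;> linarith)
  have h3 := (abs_le.mp h2).2
  nlinarith

/-- The accuracy reached with the number of rounds required in the main theorem. -/
theorem shadow_accuracy_le {m p T : ℕ} (hm : 0 < m) (hp : 0 < p) {x : ℝ} (hx0 : 0 < x)
    (hx1 : x ≤ 1)
    (hT : 256 / (3 * x ^ 2) * 12 ^ m * ((m : ℝ) * p) ^ 2 *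
      Real.log (2 ^ (m + 5) * (m * p) * (3 ^ (m ^ 2 * p) + 1) ^ 2 / x ^ 2) ≤ T) :
    (x / 2 + ((1 + x / (3 * (m * p : ℕ))) ^ (m * p) - 1)) ^ 2 +
      (((3 : ℝ) ^ m) ^ (m * p) + 1) ^ 2 * ((m * p : ℕ) *
        (2 * Real.exp (-(T * (x / (3 * (m * p : ℕ))) ^ 2 / (8 * (3 ^ m) ^ 2))))) ≤ x ^ 2 := by
  have hq : 0 < m * p := Nat.mul_pos hm hp
  have hm' : (0 : ℝ) < m := by exact_mod_cast hm
  have hp' : (0 : ℝ) < p := by exact_mod_cast hp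
  have hq1 : (1 : ℝ) ≤ m * p := by exact_mod_cast hq
  have h1 := one_add_pow_sub_one_le hx0 hx1 hq
  have h0 : 0 ≤ (1 + x / (3 * (m * p : ℕ))) ^ (m * p) - 1 := by
    have : (1 : ℝ) ≤ (1 + x / (3 * (m * p : ℕ))) ^ (m * p) :=
      one_le_pow₀ (le_add_of_nonneg_right (by positivity))
    linarith
  -- `1 / 2 + 4 / 9 = 17 / 18`; the bad event below adds `1 / 16`, and `(17 / 18) ^ 2 + 1 / 16 < 1`.
  have hfirst : (x / 2 + ((1 + x / (3 * (m * p : ℕ))) ^ (m * p) - 1)) ^ 2 ≤ (17 / 18 * x) ^ 2 := by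
    gcongr
    linarith
  set Λ := 2 ^ (m + 5) * ((m : ℝ) * p) * (3 ^ (m ^ 2 * p) + 1) ^ 2 / x ^ 2 with hΛ
  have hx2 : x ^ 2 ≤ 1 := pow_le_one₀ hx0.le hx1
  have hΛ1 : 1 ≤ Λ := by
    rw [hΛ, le_div_iff₀ (by positivity), one_mul]
    have e1 : (1 : ℝ) ≤ 2 ^ (m + 5) := one_le_pow₀ (by norm_num)
    have e2 : (1 : ℝ) ≤ (3 ^ (m ^ 2 * p) + 1) ^ 2 :=
      one_le_pow₀ (le_add_of_nonneg_left (by positivity))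
    calc x ^ 2 ≤ 1 * 1 * 1 := by simpa using hx2
      _ ≤ _ := by gcongr
  have hΛ0 : 0 < Λ := by linarith
  have hlog : 0 ≤ Real.log Λ := Real.log_nonneg hΛ1
  have hexp : Real.exp (-(T * (x / (3 * (m * p : ℕ))) ^ 2 / (8 * (3 ^ m) ^ 2))) ≤ 1 / Λ := by
    rw [one_div, ← Real.exp_log (inv_pos.mpr hΛ0), Real.log_inv]
    apply Real.exp_le_exp.mpr
    rw [neg_le_neg_iff, le_div_iff₀ (by positivity)]
    have e1 : ((3 : ℝ) ^ m) ^ 2 ≤ 12 ^ m := by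
      rw [← pow_mul, mul_comm m 2, pow_mul]
      gcongr; norm_num
    calc Real.log Λ * (8 * (3 ^ m) ^ 2) ≤ Real.log Λ * (256 / 27 * 12 ^ m) := by
          gcongr; norm_num
      _ = 256 / (3 * x ^ 2) * 12 ^ m * ((m : ℝ) * p) ^ 2 * Real.log Λ *
            (x / (3 * (m * p : ℕ))) ^ 2 := by
          push_cast; field_simp; ring
      _ ≤ _ := by gcongr
  have hsecond : (((3 : ℝ) ^ m) ^ (m * p) + 1) ^ 2 * ((m * p : ℕ) *
      (2 * Real.exp (-(T * (x / (3 * (m * p : ℕ))) ^ 2 / (8 * (3 ^ m) ^ 2))))) ≤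
      x ^ 2 / 16 := by
    have e0 : ((3 : ℝ) ^ m) ^ (m * p) = 3 ^ (m ^ 2 * p) := by rw [← pow_mul]; ring_nf
    have e1 : (1 : ℝ) ≤ 2 ^ m := one_le_pow₀ (by norm_num)
    rw [e0]
    calc _ ≤ ((3 : ℝ) ^ (m ^ 2 * p) + 1) ^ 2 * ((m * p : ℕ) * (2 * (1 / Λ))) := by gcongr
      _ = x ^ 2 / (16 * 2 ^ m) := by
          rw [hΛ, pow_add]; push_cast; field_simp; norm_num
      _ ≤ x ^ 2 / (16 * 1) := by gcongr
      _ = _ := by ring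
  nlinarith [sq_nonneg x]

end GLQK

theorem theorem1 {D : ℕ} (L : Fin D → ℕ) [∀ i, NeZero (L i)] (m p : ℕ)
    (g : PauliPoly (Lattice L) p) (hg : g.IsBody m)
    (ξ : ℝ) (hξ : 0 < ξ) (𝒟 : Measure (QState (Lattice L))) [IsProbabilityMeasure 𝒟]
    (h𝒟 : ∀ᵐ ρ ∂𝒟, HasECP ξ ρ)
    (ε : ℝ) (hε : 0 < ε) (hε' : ε < g.norm1)
    (δ : ℝ) (hδ : δ = ξ * Real.log (2 * g.norm1 * m * p / ε))
    (ζ : ℕ) (hζ : ζ = ⌈(m : ℝ) * δ⌉₊)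
    (α : ℕ) (hα : α = g.localCoverNumber δ ζ)
    (n : ℕ) (hn : n = Fintype.card (Lattice L))
    (τ γ : ℝ) (hτ : 0 < τ) (hγ : 0 < γ)
    (hζγ : 1 ≤ 2 * (ζ : ℝ) ^ D / γ) (hmpτ : 1 ≤ (m : ℝ) * p / τ)
    (N T : ℕ)
    (hN : 600 / ε ^ 4 * g.norm1 ^ 4 * Real.exp (α * τ * Real.exp (5 * γ)) *
      (2 * m * p * (ζ : ℝ) ^ D / (τ * γ)) ^ (m * p) * (n : ℝ) ^ α ≤ N)
    (hT : 256 / (3 * ε ^ 2) * g.norm1 ^ 2 * 12 ^ m * ((m : ℝ) * p) ^ 2 *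
      Real.log (g.norm1 ^ 2 * 2 ^ (m + 5) * (m * p) * (3 ^ (m ^ 2 * p) + 1) ^ 2 / ε ^ 2) ≤ T)
    (Bsq : ℝ) (hBsq : Bsq = g.norm1 ^ 2 *
      (2 * m * p * (ζ : ℝ) ^ D / (τ * γ)) ^ (m * p) * (n : ℝ) ^ α)
    (lam : ℝ) (hlam : lam = ε ^ 2 / (6 * Bsq)) :
    (∀ Z : Fin N → Shadow (Lattice L) T × ℝ,
      ∃ a : Fin N → ℝ, IsKRRSolution (polyGLQK τ γ ζ α) lam Bsq Z a) ∧
    ∀ aStar : (Fin N → Shadow (Lattice L) T × ℝ) → Fin N → ℝ,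
      (∀ Z, IsKRRSolution (polyGLQK τ γ ζ α) lam Bsq Z (aStar Z)) →
      ∫⁻ Z, expectedLoss (dataDist 𝒟 g T) (kernelModel (polyGLQK τ γ ζ α) Z (aStar Z))
        ∂(Measure.pi fun _ : Fin N => dataDist 𝒟 g T) ≤ ENNReal.ofReal (ε ^ 2) := by
  -- The normalization `1 ≤ m * p / τ` excludes `m * p = 0`.
  have hmp : 0 < m * p := by
    rcases Nat.eq_zero_or_pos (m * p) with h | h
    · have : (m : ℝ) * p = 0 := by exact_mod_cast h
      rw [this, zero_div] at hmpτ
      linarith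
    · exact h
  have hm : 0 < m := Nat.pos_of_mul_pos_right hmp
  have hp : 0 < p := Nat.pos_of_mul_pos_left hmp
  have hm' : (0 : ℝ) < m := by exact_mod_cast hm
  have hp' : (0 : ℝ) < p := by exact_mod_cast hp
  have hmp1 : (1 : ℝ) ≤ m * p := by exact_mod_cast hmp
  have hn1 : 0 < g.norm1 := hε.trans hε'
  have hnpos : (0 : ℝ) < n := by rw [hn]; exact_mod_cast Fintype.card_pos
  have hζD : (0 : ℝ) < (ζ : ℝ) ^ D := by
    rcases eq_or_lt_of_le (by positivity : (0 : ℝ) ≤ (ζ : ℝ) ^ D) with h | h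
    · rw [← h, mul_zero, zero_div] at hζγ
      linarith
    · exact h
  have hY : 1 < 2 * g.norm1 * m * p / ε := by
    rw [one_lt_div hε]
    nlinarith
  have hδ0 : 0 < δ := by rw [hδ]; exact mul_pos hξ (Real.log_pos hY)
  -- The purpose of the choice of `δ`: clustering uses exactly half of the relative accuracy `ε /
  -- g.norm1`.
  have hexpδ : m * p * Real.exp (-δ / ξ) = ε / g.norm1 / 2 := by
    have : -δ / ξ = -Real.log (2 * g.norm1 * m * p / ε) := by rw [hδ]; field_simp
    rw [this, Real.exp_neg, Real.exp_log (by positivity)]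
    field_simp
  have hB0 : 0 < Bsq := by rw [hBsq]; positivity
  have hlam0 : 0 < lam := by rw [hlam]; positivity
  have hk : IsPSDKernel (polyGLQK (L := L) τ γ ζ α (T := T)) :=
    isPSDKernel_polyGLQK hγ.le hτ.le α
  refine ⟨fun Z => hk.exists_isKRRSolution hB0.le Z, fun aStar ha => ?_⟩
  set κ := Real.exp (α * τ * Real.exp (5 * γ)) with hκ
  have hκ0 : 0 < κ := Real.exp_pos _
  have hx0 : 0 < ε / g.norm1 := by positivity
  have hx1 : ε / g.norm1 ≤ 1 := (div_le_one hn1).mpr hε'.le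
  have hT' : 256 / (3 * (ε / g.norm1) ^ 2) * 12 ^ m * ((m : ℝ) * p) ^ 2 *
      Real.log (2 ^ (m + 5) * (m * p) * (3 ^ (m ^ 2 * p) + 1) ^ 2 / (ε / g.norm1) ^ 2) ≤ T := by
    refine le_trans (le_of_eq ?_) hT
    have e : 2 ^ (m + 5) * ((m : ℝ) * p) * (3 ^ (m ^ 2 * p) + 1) ^ 2 / (ε / g.norm1) ^ 2 =
      g.norm1 ^ 2 * 2 ^ (m + 5) * (m * p) * (3 ^ (m ^ 2 * p) + 1) ^ 2 / ε ^ 2 := by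
      field_simp
    rw [e]
    field_simp
  have hTpos : 0 < T := by
    have hlog : 0 < Real.log
        (g.norm1 ^ 2 * 2 ^ (m + 5) * (m * p) * (3 ^ (m ^ 2 * p) + 1) ^ 2 / ε ^ 2) := by
      apply Real.log_pos
      rw [one_lt_div (by positivity)]
      have e1 : (1 : ℝ) ≤ 2 ^ (m + 5) := one_le_pow₀ (by norm_num)
      have e2 : (1 : ℝ) ≤ (3 ^ (m ^ 2 * p) + 1) ^ 2 :=
        one_le_pow₀ (le_add_of_nonneg_left (by positivity))
      calc ε ^ 2 < g.norm1 ^ 2 * 1 * 1 * 1 := by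
            simp only [mul_one]; gcongr
        _ ≤ _ := by gcongr
    have : (0 : ℝ) < T := lt_of_lt_of_le (by positivity) hT
    exact_mod_cast this
  have hN' : 600 / ε ^ 4 * g.norm1 ^ 2 * κ * Bsq ≤ N := by
    refine le_trans (le_of_eq ?_) hN
    rw [hBsq]; ring
  have hNpos : 0 < N := by
    have : (0 : ℝ) < N := lt_of_lt_of_le (by positivity) hN'
    exact_mod_cast this
  have hNpos' : (0 : ℝ) < N := by exact_mod_cast hNpos
  have := isProbabilityMeasure_dataDist (T := T) 𝒟 g
  have hf : KernelLE (rankOne fun S : Shadow (Lattice L) T => g.shadowPoly δ S) fun S S' =>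
      Bsq * polyGLQK τ γ ζ α S S' := by
    have := hg.kernelLE_rankOne_shadowPoly (T := T) hm hδ0 hζ hτ hγ hmpτ hζγ
    rw [← hα, ← hn, ← mul_assoc, ← hBsq] at this
    exact this
  have hloss : expectedLoss (dataDist 𝒟 g T) (fun S => g.shadowPoly δ S) ≤
      ENNReal.ofReal (ε ^ 2 / 2) := by
    refine expectedLoss_dataDist_le g (h𝒟.mono fun ρ hρ => ?_)
    have := hg.sum_weight_mul_sq_le hm hξ hδ0.le hρ hTpos
      (η := ε / g.norm1 / (3 * (m * p : ℕ))) (R := (ε / g.norm1) ^ 2)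
      (by have : (0 : ℝ) < (m * p : ℕ) := by exact_mod_cast hmp
          positivity)
      (by rw [hexpδ]; exact shadow_accuracy_le hm hp hx0 hx1 hT')
    refine this.trans (le_of_eq ?_)
    field_simp
  -- Inserting `lam` and the bound on `N` gives `2 * lam * N ≥ 200 * κ * (g.norm1 / ε) ^ 2`, and `ε
  -- < g.norm1`.
  have hq : κ / (2 * lam * N) ≤ 1 / 200 := by
    have h200 : 200 * κ ≤ 2 * lam * N := by
      have hsq : ε ^ 2 ≤ g.norm1 ^ 2 := by gcongr
      calc 200 * κ = 200 * κ / ε ^ 2 * ε ^ 2 := by field_simp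
        _ ≤ 200 * κ / ε ^ 2 * g.norm1 ^ 2 := by gcongr
        _ = 2 * lam * (600 / ε ^ 4 * g.norm1 ^ 2 * κ * Bsq) := by
          rw [hlam]; field_simp; norm_num
        _ ≤ _ := by gcongr
    rw [div_le_div_iff₀ (by positivity) (by norm_num)]
    linarith
  have hq0 : 0 ≤ κ / (2 * lam * N) := by positivity
  refine (lintegral_expectedLoss_kernelModel_le hk (dataDist 𝒟 g T) hlam0 hNpos hκ0.le
    (fun S => polyGLQK_self_le hγ.le hτ.le α hTpos S S) hB0.le hf ha).trans ?_
  have hlamB : lam * Bsq = ε ^ 2 / 6 := by rw [hlam]; field_simp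
  calc _ ≤ ENNReal.ofReal (3 / 2) * (ENNReal.ofReal (ε ^ 2 / 2) + ENNReal.ofReal (ε ^ 2 / 6)) := by
        rw [hlamB]
        gcongr
        nlinarith
    _ = ENNReal.ofReal (ε ^ 2) := by
        rw [← ENNReal.ofReal_add (by positivity) (by positivity), ← ENNReal.ofReal_mul (by norm_num)]
        congr 1; ring
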